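/- Let $N\in\mathbb N$ and $1\le p<\infty$; let $B_j\subset\mathbb R^N$ be the closed ball of radius $j$ about $0$, and identify $\mathbb R^{N\times N}$ with the linear maps of $\mathbb R^N$. **Spaces.** Let $M=N$ or $M=N\times N$. $\mathfrak C_p(\mathbb R^M)$ is the set of Borel functions $f:\mathbb R\times\mathbb R^N\to\mathbb R^M$ such that for every compact $K\subset\mathbb R^N$ there is $m^K\in L^p_{loc}(\mathbb R)$ with $|f(t,x)|\le m^K(t)$ for a.e. $t$ and all $x\in K$. $\mathfrak{SC}_p$ is the set of $f\in\mathfrak C_p$ with $f(t,\cdot)$ continuous for a.e. $t$, and $\mathfrak{LC}_p$ is the set of $f\in\mathfrak C_p$ such that for every compact $K$ there is $l^K\in L^p_{loc}$ with $|f(t,x)-f(t,y)|\le l^K(t)|x-y|$ for a.e. $t$ and all $x,y\in K$; without an argument these symbols refer to $M=N$. A set $E\subset\mathfrak{LC}_p$ *has $L^1_{loc}$-equicontinuous $m$-bounds* if, with $m^j_f(t)=\sup_{x\in B_j}|f(t,x)|$, for all $j\in\mathbb N$, $r>0$, $\epsilon>0$ there is $\delta>0$ such that $\sup_{f\in E}\int_s^t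 m^j_f(u)\,du<\epsilon$ whenever $-r\le s\le t\le r$ and $t-s<\delta$. Such an $E$ determines the moduli $\Theta=\Theta(E)=\{\theta^I_j\}$, $\theta^I_j(s)=\sup_{t\in I,\,f\in E}\int_t^{t+s}m^j_f(u)\,du$, where $I=[q_1,q_2]$ with $q_1,q_2\in\mathbb Q$ and $j\in\mathbb N$. Let $\mathcal K^I_j$ be the set of continuous $x:I\to B_j$ with $|x(t)-x(s)|\le\theta^I_j(|t-s|)$ for $s,t\in I$. $\Theta\mathfrak C(\mathbb R^M)$ is the set of $f\in\mathfrak C_p(\mathbb R^M)$ such that, for all $I,j$, if $x_n\in\mathcal K^I_j$ converges uniformly to $x\in\mathcal K^I_j$, then $\int_I|f(t,x_n(t))-f(t,x(t))|^p\,dt\to0$. $\mathcal T_\Theta$ is the topology given by the seminorms $p_{I,j}(f)=\sup_{x\in\mathcal K^I_j}\big(\int_I|f(t,x(t))|^p\,dt\big)^{1/p}$ on $\Theta\mathfrak C(\mathbb R^M)$, and its restriction to $\mathfrak{LC}_p\subset\Theta\mathfrak C(\mathbb R^N)$. For $E\subset\mathfrak{LC}_p$ with $L^1_{loc}$-equicontinuous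 $m$-bounds, all of whose elements $f$ are $C^1$ in $x$ for a.e. $t$ with Jacobian $J_xf\in\mathfrak{SC}_p(\mathbb R^{N\times N})$, let $\overline{E}^{\,\mathrm{lin}}$ be the closure of $\{(f,J_xf): f\in E\}$ in $\mathfrak{LC}_p\times\Theta\mathfrak C(\mathbb R^{N\times N})$ for $\mathcal T_\Theta\times\mathcal T_\Theta$, $\Theta=\Theta(E)$. **Part 1.** Let $E_1\subset\mathfrak{LC}_p$ have $L^1_{loc}$-equicontinuous $m$-bounds, let every $f\in E_1$ be $C^1$ in $x$ for a.e. $t$ with $J_xf\in\mathfrak{SC}_p(\mathbb R^{N\times N})$, and let $(g,G)\in\overline{E_1}^{\,\mathrm{lin}}$ ($G$ need not be continuous in $x$). For every $x_0\in\mathbb R^N$ the problem $\dot x=g(t,x)$, $x(0)=x_0$ has a unique Carathéodory solution $x(\cdot,g,x_0)$ on an open maximal interval $I_{g,x_0}\ni0$, and for every $y_0\in\mathbb R^N$ the problem $\dot y=G(t,x(t,g,x_0))\,y$, $y(0)=y_0$ has a unique Carathéodory solution $y(\cdot,g,G,x_0,y_0)$ on $I_{g,x_0}$. If $[T_0,T_1]\subset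 I_{g,x_0}$, then for all sufficiently small $\varepsilon>0$ one has $[T_0,T_1]\subset I_{g,x_0+\varepsilon y_0}$ for every $y_0\in B_1$, and $$\lim_{\varepsilon\to0^+}\left|\frac{x(t,g,x_0+\varepsilon y_0)-x(t,g,x_0)}{\varepsilon}-y(t,g,G,x_0,y_0)\right|=0$$ uniformly for $t\in[T_0,T_1]$ and $y_0\in B_1$. **Part 2 (linearized skew-product semiflow).** Let $f\in\mathfrak{LC}_p$ be $C^1$ in $x$ for a.e. $t$ with $J_xf\in\mathfrak{SC}_p(\mathbb R^{N\times N})$, and suppose that the set of translates $\{f_\tau:\tau\in\mathbb R\}$, $f_\tau(t,x)=f(t+\tau,x)$, has $L^1_{loc}$-equicontinuous $m$-bounds. Let $\mathbb H=\overline{\{f_\tau:\tau\in\mathbb R\}}^{\,\mathrm{lin}}$ with the topology $\mathcal T_\Theta\times\mathcal T_\Theta$. Then $(t,g,G)\mapsto(g_t,G_t)$ is a continuous map $\mathbb R\times\mathbb H\to\mathbb H$; the set $\mathcal U=\{(t,g,G,x_0,y_0): (g,G)\in\mathbb H,\ x_0,y_0\in\mathbb R^N,\ t\in I_{g,x_0}\}$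 is open in $\mathbb R\times\mathbb H\times\mathbb R^N\times\mathbb R^N$ and contains every point with $t=0$; and $$\Psi(t,g,G,x_0,y_0)=\big(g_t,G_t,x(t,g,x_0),y(t,g,G,x_0,y_0)\big)$$ is continuous on $\mathcal U$ and is a local flow: $\Psi(0,\cdot)$ is the identity, and if $(s,g,G,x_0,y_0)\in\mathcal U$, then $(t,\Psi(s,g,G,x_0,y_0))\in\mathcal U$ if and only if $(s+t,g,G,x_0,y_0)\in\mathcal U$, in which case $\Psi(s+t,g,G,x_0,y_0)=\Psi(t,\Psi(s,g,G,x_0,y_0))$. -/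

import Mathlib

open MeasureTheory Set Filter Topology
open scoped ENNReal

noncomputable section

namespace Caratheodory

/-- Euclidean `N`-space. -/
abbrev Vec (N : ℕ) : Type := EuclideanSpace ℝ (Fin N)

/-- The real `N × N` matrices, as linear maps of `ℝ^N` with the operator norm. -/
abbrev Mat (N : ℕ) : Type := Vec N →L[ℝ] Vec N

/-- `m ∈ L^p_loc`. -/
def LpLoc (p : ℝ≥0∞) (m : ℝ → ℝ) : Prop :=
  ∀ a b : ℝ, MemLp m p (volume.restrict (Icc a b))

section Spaces

variable {N : ℕ} {F : Type*} [NormedAddCommGroup F] [MeasurableSpace F]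

/-- The class `ℭ_p`: Borel functions with an `L^p_loc` bound on every compact set. -/
structure IsC (p : ℝ≥0∞) (f : ℝ → Vec N → F) : Prop where
  measurable : Measurable (Function.uncurry f)
  mbound : ∀ K : Set (Vec N), IsCompact K →
    ∃ m : ℝ → ℝ, LpLoc p m ∧ ∀ᵐ t : ℝ, ∀ x ∈ K, ‖f t x‖ ≤ m t

/-- Lipschitz Carathéodory functions `𝔏ℭ_p`. -/
structure IsLC (p : ℝ≥0∞) (f : ℝ → Vec N → F) : Prop extends IsC p f where
  lbound : ∀ K : Set (Vec N), IsCompact K →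
    ∃ l : ℝ → ℝ, LpLoc p l ∧
      ∀ᵐ t : ℝ, ∀ x ∈ K, ∀ y ∈ K, ‖f t x - f t y‖ ≤ l t * ‖x - y‖

/-- Strong Carathéodory functions `𝔖ℭ_p`. -/
structure IsSC (p : ℝ≥0∞) (f : ℝ → Vec N → F) : Prop extends IsC p f where
  continuous : ∀ᵐ t : ℝ, Continuous (f t)

/-- A family of moduli `θ^I_j`, where `I = [q₁, q₂]`, written `θ q₁ q₂ j`. -/
abbrev Moduli : Type := ℚ → ℚ → ℕ → ℝ → ℝ

/-- `𝒦^I_j`, `I = [q₁, q₂]`: continuous curves `I → B_j` with modulus of continuity `θ^I_j`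
(a curve is a function on `ℝ` of which only the restriction to `I` is ever used). -/
def curves (N : ℕ) (θ : Moduli) (q₁ q₂ : ℚ) (j : ℕ) : Set (ℝ → Vec N) :=
  {x | ContinuousOn x (Icc (q₁ : ℝ) q₂) ∧ (∀ t ∈ Icc (q₁ : ℝ) q₂, ‖x t‖ ≤ j) ∧
    ∀ s ∈ Icc (q₁ : ℝ) q₂, ∀ t ∈ Icc (q₁ : ℝ) q₂, ‖x t - x s‖ ≤ θ q₁ q₂ j |t - s|}

/-- `Θ`-Carathéodory functions `Θℭ`. -/
structure IsThetaC (θ : Moduli) (p : ℝ≥0∞) (f : ℝ → Vec N → F) : Prop extends IsC p f where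
  tendsto : ∀ (q₁ q₂ : ℚ) (j : ℕ) (u : ℕ → ℝ → Vec N) (x : ℝ → Vec N),
    (∀ n, u n ∈ curves N θ q₁ q₂ j) → x ∈ curves N θ q₁ q₂ j →
    TendstoUniformlyOn u x atTop (Icc (q₁ : ℝ) q₂) →
    Tendsto (fun n => eLpNorm (fun t => f t (u n t) - f t (x t)) p
      (volume.restrict (Icc (q₁ : ℝ) q₂))) atTop (𝓝 0)

/-- The seminorm `p_{I,j}(f) = sup_{x ∈ 𝒦^I_j} ‖f(·, x(·))‖_{L^p(I)}`. -/
def thetaSeminorm (θ : Moduli) (p : ℝ≥0∞) (q₁ q₂ : ℚ) (j : ℕ) (f : ℝ → Vec N → F) : ℝ≥0∞ :=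
  ⨆ x ∈ curves N θ q₁ q₂ j, eLpNorm (fun t => f t (x t)) p (volume.restrict (Icc (q₁ : ℝ) q₂))

/-- Functions `ℝ × ℝ^N → F`, as carrier of the topology `𝒯_Θ`. -/
def FunSpace (_θ : Moduli) (_p : ℝ≥0∞) (N : ℕ) (F : Type*) : Type _ := ℝ → Vec N → F

/-- `𝒯_Θ`: generated by the balls `{h | p_{I,j}(h - f) < ε}` with centre `f ∈ Θℭ`. It is only used
on subsets of `Θℭ` (which contains `𝔏ℭ_p` and `𝔖ℭ_p`), where it is the topology defined by the
seminorms `p_{I,j}`. -/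
instance (θ : Moduli) (p : ℝ≥0∞) : TopologicalSpace (FunSpace θ p N F) :=
  TopologicalSpace.generateFrom
    {U | ∃ f : ℝ → Vec N → F, IsThetaC θ p f ∧ ∃ (q₁ q₂ : ℚ) (j : ℕ) (ε : ℝ≥0∞), 0 < ε ∧
      U = {h | thetaSeminorm θ p q₁ q₂ j (fun t x => h t x - f t x) < ε}}

end Spaces

section Bounds

variable {N : ℕ}

/-- The optimal `m`-bound of `f` on the closed ball `B_j`. -/
def optMBound (f : ℝ → Vec N → Vec N) (j : ℕ) (t : ℝ) : ℝ≥0∞ :=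
  ⨆ x ∈ Metric.closedBall (0 : Vec N) j, ‖f t x‖ₑ

/-- `E` has `L¹_loc`-equicontinuous `m`-bounds. -/
def EquicontinuousMBounds (E : Set (ℝ → Vec N → Vec N)) : Prop :=
  ∀ (j : ℕ) (r ε : ℝ), 0 < r → 0 < ε → ∃ δ > 0, ∀ s t : ℝ, -r ≤ s → s ≤ t → t ≤ r → t - s < δ →
    (⨆ f ∈ E, ∫⁻ u in Icc s t, optMBound f j u) < ENNReal.ofReal ε

/-- The moduli determined by `E`: `θ^I_j(s) = sup_{t ∈ I, f ∈ E} ∫_t^{t+s} m^j_f(u) du`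
(finite when `E` has `L¹_loc`-equicontinuous `m`-bounds). -/
def thetaOf (E : Set (ℝ → Vec N → Vec N)) : Moduli := fun q₁ q₂ j s =>
  (⨆ t ∈ Icc (q₁ : ℝ) q₂, ⨆ f ∈ E, ∫⁻ u in Icc t (t + s), optMBound f j u).toReal

/-- `J` is (a version of) the Jacobian `J_x f`: for almost every `t`, `J(t, x)` is the derivative
of `f(t, ·)` at `x`, for every `x`. -/
def IsJacobian (f : ℝ → Vec N → Vec N) (J : ℝ → Vec N → Mat N) : Prop :=
  ∀ᵐ t : ℝ, ∀ x, HasFDerivAt (f t) (J t x) x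

/-- `f` is continuously differentiable in `x` for a.e. `t`, with `J_x f ∈ 𝔖ℭ_p`. -/
def HasSCJacobian (p : ℝ≥0∞) (f : ℝ → Vec N → Vec N) : Prop :=
  (∀ᵐ t : ℝ, ContDiff ℝ 1 (f t)) ∧ ∃ J : ℝ → Vec N → Mat N, IsSC p J ∧ IsJacobian f J

/-- The `𝒯_Θ × 𝒯_Θ`-closure of `{(f, J_x f) | f ∈ E}` in `𝔏ℭ_p × Θℭ`, where `Θ` is the family
of moduli determined by `E`. -/
def linClosure (p : ℝ≥0∞) (E : Set (ℝ → Vec N → Vec N)) :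
    Set (FunSpace (thetaOf E) p N (Vec N) × FunSpace (thetaOf E) p N (Mat N)) :=
  {P | IsLC p P.1 ∧ IsThetaC (thetaOf E) p P.2} ∩
    closure {P | P.1 ∈ E ∧ IsSC p P.2 ∧ IsJacobian P.1 P.2}

end Bounds

section Solutions

variable {N : ℕ}

/-- `x` is a Carathéodory solution on `J` of `ẋ = f(t, x)`, `x(0) = x₀`
(`J` will be an interval that contains `0`). -/
def IsSolOn (f : ℝ → Vec N → Vec N) (x₀ : Vec N) (J : Set ℝ) (x : ℝ → Vec N) : Prop :=
  ContinuousOn x J ∧ ∀ t ∈ J, IntervalIntegrable (fun s => f s (x s)) volume 0 t ∧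
    x t = x₀ + ∫ s in (0 : ℝ)..t, f s (x s)

/-- The maximal interval of definition `I_{f,x₀}`. -/
def maxInterval (f : ℝ → Vec N → Vec N) (x₀ : Vec N) : Set ℝ :=
  {t | ∃ x, IsSolOn f x₀ (uIcc 0 t) x}

open Classical in
/-- The solution `x(t, f, x₀)`; the value off the maximal interval is irrelevant. -/
def sol (f : ℝ → Vec N → Vec N) (x₀ : Vec N) (t : ℝ) : Vec N :=
  if h : ∃ x, IsSolOn f x₀ (uIcc 0 t) x then h.choose t else 0

/-- `x` is a solution on `J`, and every solution on a subinterval that contains `0` is a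
restriction of it. -/
def IsUniqueSolOn (f : ℝ → Vec N → Vec N) (x₀ : Vec N) (J : Set ℝ) (x : ℝ → Vec N) : Prop :=
  IsSolOn f x₀ J x ∧ ∀ J' ⊆ J, J'.OrdConnected → (0 : ℝ) ∈ J' →
    ∀ z, IsSolOn f x₀ J' z → EqOn z x J'

/-- The vector field `(t, v) ↦ G(t, x(t, g, x₀)) v`. -/
def linField (g : ℝ → Vec N → Vec N) (G : ℝ → Vec N → Mat N) (x₀ : Vec N) :
    ℝ → Vec N → Vec N :=
  fun t v => G t (sol g x₀ t) v

/-- `y(t, g, G, x₀, y₀)`, the solution of `ẏ = G(t, x(t, g, x₀)) y`, `y(0) = y₀`. -/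
def linSol (g : ℝ → Vec N → Vec N) (G : ℝ → Vec N → Mat N) (x₀ y₀ : Vec N) : ℝ → Vec N :=
  sol (linField g G x₀) y₀

end Solutions

section Semiflow

variable {N : ℕ}

/-- The time translate `f_τ(t, x) = f(t + τ, x)`. -/
def translate {F : Type*} (τ : ℝ) (f : ℝ → Vec N → F) : ℝ → Vec N → F := fun t x => f (t + τ) x

/-- The set of all time translates of `f`. -/
def orbit (f : ℝ → Vec N → Vec N) : Set (ℝ → Vec N → Vec N) := range fun τ => translate τ f

/-- `ℍ`, the hull of `(f, J_x f)` in `(𝔏ℭ_p × Θℭ, 𝒯_Θ × 𝒯_Θ)`. Here `Θ` is determined by the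
translates of `f`, that is `θ_j(s) = sup_{t ∈ ℝ} ∫_t^{t+s} m^j_f(u) du`. -/
abbrev linHull (p : ℝ≥0∞) (f : ℝ → Vec N → Vec N) :
    Set (FunSpace (thetaOf (orbit f)) p N (Vec N) × FunSpace (thetaOf (orbit f)) p N (Mat N)) :=
  linClosure p (orbit f)

/-- The time translation `(t, g, G) ↦ (g_t, G_t)` on `ℍ`. -/
def baseMap (p : ℝ≥0∞) (f : ℝ → Vec N → Vec N) (q : ℝ × linHull p f) :
    FunSpace (thetaOf (orbit f)) p N (Vec N) × FunSpace (thetaOf (orbit f)) p N (Mat N) :=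
  (translate q.1 q.2.1.1, translate q.1 q.2.1.2)

/-- The domain `𝒰 ⊆ ℝ × ℍ × ℝ^N × ℝ^N` of the linearized skew-product semiflow. -/
def flowDomain (p : ℝ≥0∞) (f : ℝ → Vec N → Vec N) : Set (ℝ × linHull p f × Vec N × Vec N) :=
  {q | q.1 ∈ maxInterval q.2.1.1.1 q.2.2.1}

/-- The map `Ψ(t, g, G, x₀, y₀) = (g_t, G_t, x(t, g, x₀), y(t, g, G, x₀, y₀))`. -/
def flowMap (p : ℝ≥0∞) (f : ℝ → Vec N → Vec N) (q : ℝ × linHull p f × Vec N × Vec N) :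
    (FunSpace (thetaOf (orbit f)) p N (Vec N) × FunSpace (thetaOf (orbit f)) p N (Mat N)) ×
      Vec N × Vec N :=
  (baseMap p f (q.1, q.2.1), sol q.2.1.1.1 q.2.2.1 q.1,
    linSol q.2.1.1.1 q.2.1.1.2 q.2.2.1 q.2.2.2 q.1)

/-- `Ψ` is a local continuous skew-product flow on `ℍ × ℝ^N × ℝ^N` over the continuous flow on `ℍ`
given by time translation. -/
structure IsLinearizedSkewProductFlow (p : ℝ≥0∞) (f : ℝ → Vec N → Vec N) : Prop where
  base_mem : ∀ q : ℝ × linHull p f, baseMap p f q ∈ linHull p f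
  base_continuous : Continuous (baseMap p f)
  isOpen_domain : IsOpen (flowDomain p f)
  continuousOn : ContinuousOn (flowMap p f) (flowDomain p f)
  zero_mem : ∀ (P : linHull p f) (x₀ y₀ : Vec N), ((0 : ℝ), P, x₀, y₀) ∈ flowDomain p f
  map_zero : ∀ (P : linHull p f) (x₀ y₀ : Vec N), flowMap p f (0, P, x₀, y₀) = (P.1, x₀, y₀)
  mem_iff : ∀ (P Q : linHull p f) (x₀ y₀ x₁ y₁ : Vec N) (s t : ℝ),
    (s, P, x₀, y₀) ∈ flowDomain p f → flowMap p f (s, P, x₀, y₀) = (Q.1, x₁, y₁) →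
    ((t, Q, x₁, y₁) ∈ flowDomain p f ↔ (s + t, P, x₀, y₀) ∈ flowDomain p f)
  map_add : ∀ (P Q : linHull p f) (x₀ y₀ x₁ y₁ : Vec N) (s t : ℝ),
    (s, P, x₀, y₀) ∈ flowDomain p f → flowMap p f (s, P, x₀, y₀) = (Q.1, x₁, y₁) →
    (s + t, P, x₀, y₀) ∈ flowDomain p f →
    flowMap p f (s + t, P, x₀, y₀) = flowMap p f (t, Q, x₁, y₁)

end Semiflow

end Caratheodory

end

open Caratheodory

/-!
Let `(g, G)` be in the closure of the pairs `(f, J_x f)`, `f ∈ E`. The argument rests on the sets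
`𝒦^I_j` of admissible curves, over which convergence in `𝒯_Θ` is uniform.

*Moduli.* Constant curves are admissible, so testing with a countable dense set of them shows that
the optimal `m`-bounds of `g` obey the moduli `Θ(E)` (`mBounded_of_mem_linClosure`). Hence, if `x`
solves the problem for the truncated field `g(t, P_j x)`, where `P_j` is the metric projection onto
`B_j`, then `P_j ∘ x` is an admissible curve (`IsSolOn.ballProj_mem_curves`). Truncated problems have
solutions on every compact interval (`exists_isSolOn`), so no continuation argument is needed to
know that neighbouring solutions exist as long as the given one.

*Continuous dependence.* Grönwall's inequality with an integrable coefficient (`exists_stability`)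
compares a truncated solution for a field near `g` with a solution for `g`. It uses the Lipschitz
coefficient of `g` alone, and the error `∫ |g_n(t, x_n) - g(t, x_n)|` is bounded by a seminorm of
`g_n - g`, since `x_n` is admissible (`exists_continuousDependence`). The linear problem is treated
in the same way (`exists_linear_stability`), with the coefficient `G(t, x(t))`, which depends
continuously on the admissible curve `x` in `L^1` because `G ∈ Θℭ`.

*Differentiability.* `G` need not be a derivative of `g`. However, for admissible `x` and `y` the
segments `x + σ (y - x)` are admissible, because `𝒦^I_j` is convex. Integrating Taylor's formula for
`f` with Tonelli's theorem and passing to the limit gives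
`∫ |g(t, y) - g(t, x) - G(t, x)(y - x)| ≤ c ‖y - x‖_∞ sup_σ ‖G(·, x + σ (y - x)) - G(·, x)‖_p`
(`lintegral_remainder_le`). For `y = x(·, g, x₀ + ε y₀)` the right-hand side is `o(ε)`, and the
stability estimate applies to the difference quotient minus the solution of the linear problem.

*The flow.* The moduli of an orbit do not depend on the interval, so translates of admissible curves
are admissible. With Arzelà–Ascoli for `𝒦^I_j` and continuity of translation in `L^p`, this gives the
joint continuity of `(τ, h) ↦ h_τ` on `Θℭ` (`tendsto_translate`), hence invariance of the hull and
continuity of the base flow. The cocycle identities follow from uniqueness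
(`mem_maxInterval_translate_iff`, `sol_translate`, `linSol_translate`).
-/

namespace Caratheodory

/-! ### Integral inequalities with integrable coefficients -/

theorem integral_exp_neg_mul_abs_sub {c : ℝ} (hc : 0 < c) (t : ℝ) :
    Integrable (fun s : ℝ => Real.exp (-c * |t - s|)) ∧
      ∫ s : ℝ, Real.exp (-c * |t - s|) = 2 / c := by
  have h0 : ∫ s : ℝ, Real.exp (-c * |s|) = 2 / c := by
    rw [integral_comp_abs (f := fun s => Real.exp (-c * s)),
      integral_exp_mul_Ioi (neg_lt_zero.2 hc)]
    simp [div_eq_mul_inv, inv_neg]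
  have h1 : Integrable (fun s : ℝ => Real.exp (-c * |s|)) := by
    by_contra h
    rw [integral_undef h] at h0
    exact (div_pos two_pos hc).ne h0
  exact ⟨h1.comp_sub_left t, (integral_sub_left_eq_self _ volume t).trans h0⟩

/-- For large `c` the Volterra kernel `l(s) exp(-c |t - s|)` has mass at most `1/2`, uniformly
in `t`. This replaces the chain rule for `exp ∫ l`, and works in both time directions. -/
theorem exists_integral_mul_exp_le {l : ℝ → ℝ} (hl : Integrable l) :
    ∃ c : ℝ, 0 < c ∧ ∀ t, Integrable (fun s => ‖l s‖ * Real.exp (-c * |t - s|)) ∧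
      ∫ s, ‖l s‖ * Real.exp (-c * |t - s|) ≤ 1 / 2 := by
  obtain ⟨k, hk, hlk, hkc, hki⟩ :=
    hl.exists_hasCompactSupport_integral_sub_le (ε := 1 / 4) (by norm_num)
  obtain ⟨M, hM⟩ := hk.exists_bound_of_continuous hkc
  have hM0 : 0 ≤ M := (norm_nonneg _).trans (hM 0)
  -- replacing `l` by `k` costs `1/4`, and the bounded `k` contributes `2 M / c ≤ 1/4`
  refine ⟨8 * M + 1, by positivity, fun t => ?_⟩
  obtain ⟨he, hee⟩ := integral_exp_neg_mul_abs_sub (c := 8 * M + 1) (by positivity) t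
  have hexp : ∀ s, Real.exp (-(8 * M + 1) * |t - s|) ≤ 1 := fun s =>
    Real.exp_le_one_iff.2 (by nlinarith [abs_nonneg (t - s)])
  have hint : Integrable (fun s => ‖l s‖ * Real.exp (-(8 * M + 1) * |t - s|)) := by
    refine hl.norm.mono (hl.norm.1.mul he.1) (Eventually.of_forall fun s => ?_)
    rw [norm_mul, Real.norm_of_nonneg (Real.exp_pos _).le]
    exact mul_le_of_le_one_right (norm_nonneg _) (hexp s)
  refine ⟨hint, ?_⟩
  calc ∫ s, ‖l s‖ * Real.exp (-(8 * M + 1) * |t - s|)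
      ≤ ∫ s, (‖l s - k s‖ + M * Real.exp (-(8 * M + 1) * |t - s|)) := by
        refine integral_mono hint ((hl.sub hki).norm.add (he.const_mul M)) fun s => ?_
        have h1 : ‖l s‖ ≤ ‖l s - k s‖ + ‖k s‖ := by
          simpa using norm_add_le (l s - k s) (k s)
        have h2 := hexp s
        have h3 := (Real.exp_pos (-(8 * M + 1) * |t - s|)).le
        have h4 := hM s
        calc _ ≤ (‖l s - k s‖ + ‖k s‖) * Real.exp (-(8 * M + 1) * |t - s|) := by gcongr
          _ ≤ _ := by
            rw [add_mul]
            gcongr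
            exact mul_le_of_le_one_right (norm_nonneg _) h2
    _ ≤ 1 / 4 + M * (2 / (8 * M + 1)) := by
        have h1 := integral_add (f := fun s => ‖l s - k s‖) (hl.sub hki).norm (he.const_mul M)
        rw [h1, integral_const_mul, hee]
        gcongr
    _ ≤ 1 / 2 := by
        have : M * (2 / (8 * M + 1)) ≤ 1 / 4 := by
          rw [mul_div_assoc', div_le_div_iff₀ (by positivity) (by norm_num)]
          linarith
        linarith

theorem uIoc_zero_subset {a b t : ℝ} (h0 : (0 : ℝ) ∈ Icc a b) (ht : t ∈ Icc a b) :
    uIoc 0 t ⊆ Icc a b :=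
  uIoc_subset_uIcc.trans (ordConnected_Icc.uIcc_subset h0 ht)

theorem abs_eq_of_mem_uIoc {s t : ℝ} (hs : s ∈ uIoc 0 t) : |t| = |t - s| + |s| := by
  rcases le_total 0 t with h | h
  · rw [uIoc_of_le h] at hs
    rw [abs_of_nonneg h, abs_of_nonneg (sub_nonneg.2 hs.2), abs_of_pos hs.1]; ring
  · rw [uIoc_of_ge h] at hs
    rw [abs_of_nonpos h, abs_of_nonpos (sub_nonpos.2 hs.1.le), abs_of_nonpos hs.2]; ring

/-- The localized form of `exists_integral_mul_exp_le`, on an interval around the initial time. -/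
theorem exists_setIntegral_mul_exp_le {l : ℝ → ℝ} {a b : ℝ} (hl : IntegrableOn l (Icc a b))
    (h0 : (0 : ℝ) ∈ Icc a b) :
    ∃ c : ℝ, 0 < c ∧ ∀ t ∈ Icc a b, ∫ s in uIoc 0 t, ‖l s‖ * Real.exp (c * |s|) ≤
      1 / 2 * Real.exp (c * |t|) := by
  obtain ⟨c, hc, h⟩ := exists_integral_mul_exp_le (hl.integrable_indicator measurableSet_Icc)
  refine ⟨c, hc, fun t ht => ?_⟩
  obtain ⟨hi, hle⟩ := h t
  have hsub := uIoc_zero_subset h0 ht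
  have h1 : ∫ s in uIoc 0 t, ‖l s‖ * Real.exp (-c * |t - s|) ≤ 1 / 2 := by
    refine le_trans (le_of_eq ?_)
      ((setIntegral_le_integral (s := uIoc 0 t) hi (Eventually.of_forall fun s => ?_)).trans hle)
    · refine setIntegral_congr_fun measurableSet_uIoc fun s hs => ?_
      simp only [indicator_of_mem (hsub hs)]
    · positivity
  calc ∫ s in uIoc 0 t, ‖l s‖ * Real.exp (c * |s|)
      = ∫ s in uIoc 0 t, (‖l s‖ * Real.exp (-c * |t - s|)) * Real.exp (c * |t|) := by
        refine setIntegral_congr_fun measurableSet_uIoc fun s hs => ?_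
        rw [mul_assoc, ← Real.exp_add, abs_eq_of_mem_uIoc hs]
        ring_nf
    _ = (∫ s in uIoc 0 t, ‖l s‖ * Real.exp (-c * |t - s|)) * Real.exp (c * |t|) :=
        integral_mul_const _ _
    _ ≤ _ := by gcongr

/-- Grönwall's inequality in both time directions, with an integrable coefficient. -/
theorem exists_gronwall {l : ℝ → ℝ} {a b : ℝ} (hl : IntegrableOn l (Icc a b))
    (hl0 : ∀ s, 0 ≤ l s) (h0 : (0 : ℝ) ∈ Icc a b) :
    ∃ C : ℝ, 0 ≤ C ∧ ∀ (u : ℝ → ℝ) (c : ℝ), ContinuousOn u (Icc a b) → 0 ≤ c →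
      (∀ t ∈ Icc a b, u t ≤ c + ∫ s in uIoc 0 t, l s * u s) → ∀ t ∈ Icc a b, u t ≤ C * c := by
  obtain ⟨k, hk, hkl⟩ := exists_setIntegral_mul_exp_le hl h0
  refine ⟨2 * Real.exp (k * (b - a)), by positivity, fun u c hu hc h t ht => ?_⟩
  -- the maximum `S` of the weighted function satisfies `S ≤ c + S / 2`
  obtain ⟨τ, hτ, hmax⟩ := isCompact_Icc.exists_isMaxOn ⟨0, h0⟩
    (f := fun t => Real.exp (-k * |t|) * u t) (by fun_prop)
  set S := Real.exp (-k * |τ|) * u τ with hS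
  have hle : ∀ s ∈ Icc a b, u s ≤ Real.exp (k * |s|) * S := fun s hs => by
    have h1 : Real.exp (-k * |s|) * u s ≤ S := hmax hs
    have h2 : u s = Real.exp (k * |s|) * (Real.exp (-k * |s|) * u s) := by
      rw [← mul_assoc, ← Real.exp_add]; simp
    rw [h2]; gcongr
  have hS2 : S ≤ 2 * c := by
    by_cases hSn : S ≤ 0
    · linarith
    have hsub := uIoc_zero_subset h0 hτ
    have hlI : IntegrableOn l (uIoc 0 τ) := hl.mono_set hsub
    have hlu : IntegrableOn (fun s => l s * u s) (uIoc 0 τ) :=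
      (hl.mul_continuousOn hu isCompact_Icc).mono_set hsub
    have hle2 : IntegrableOn (fun s => l s * (Real.exp (k * |s|) * S)) (uIoc 0 τ) :=
      (hl.mul_continuousOn (by fun_prop) isCompact_Icc).mono_set hsub
    have h3 : ∫ s in uIoc 0 τ, l s * u s ≤ 1 / 2 * Real.exp (k * |τ|) * S := by
      calc ∫ s in uIoc 0 τ, l s * u s ≤ ∫ s in uIoc 0 τ, l s * (Real.exp (k * |s|) * S) :=
            setIntegral_mono_on hlu hle2 measurableSet_uIoc fun s hs =>
              mul_le_mul_of_nonneg_left (hle s (hsub hs)) (hl0 s)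
        _ = (∫ s in uIoc 0 τ, ‖l s‖ * Real.exp (k * |s|)) * S := by
            rw [← integral_mul_const]
            refine integral_congr_ae (Eventually.of_forall fun s => ?_)
            simp only [Real.norm_of_nonneg (hl0 s)]; ring
        _ ≤ _ := mul_le_mul_of_nonneg_right (hkl τ hτ) (not_le.1 hSn).le
    have h4 := h τ hτ
    have h5 : Real.exp (-k * |τ|) ≤ 1 :=
      Real.exp_le_one_iff.2 (by nlinarith [abs_nonneg τ])
    have h6 : Real.exp (-k * |τ|) * Real.exp (k * |τ|) = 1 := by
      rw [← Real.exp_add]; simp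
    have h7 : S ≤ Real.exp (-k * |τ|) * (c + 1 / 2 * Real.exp (k * |τ|) * S) := by
      rw [hS]; gcongr; linarith
    have h8 : Real.exp (-k * |τ|) * c ≤ c := mul_le_of_le_one_left hc h5
    have h9 : Real.exp (-k * |τ|) * (c + 1 / 2 * Real.exp (k * |τ|) * S) =
        Real.exp (-k * |τ|) * c + 1 / 2 * S := by
      linear_combination (1 / 2 * S) * h6
    linarith
  have h10 : |t| ≤ b - a := abs_le.2 ⟨by linarith [ht.1, h0.2], by linarith [ht.2, h0.1]⟩
  calc u t ≤ Real.exp (k * |t|) * S := hle t ht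
    _ ≤ Real.exp (k * |t|) * (2 * c) := by gcongr
    _ ≤ Real.exp (k * (b - a)) * (2 * c) := by gcongr
    _ = _ := by ring

theorem norm_intervalIntegral_le {E : Type*} [NormedAddCommGroup E] [NormedSpace ℝ E]
    {φ : ℝ → E} {k : ℝ → ℝ} {t : ℝ} (hk : IntegrableOn k (uIoc 0 t))
    (h : ∀ᵐ s ∂volume.restrict (uIoc 0 t), ‖φ s‖ ≤ k s) :
    ‖∫ s in (0 : ℝ)..t, φ s‖ ≤ ∫ s in uIoc 0 t, k s := by
  rw [intervalIntegral.norm_intervalIntegral_eq]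
  exact norm_integral_le_of_norm_le hk h

theorem continuousOn_of_integral {E : Type*} [NormedAddCommGroup E] [NormedSpace ℝ E]
    {φ w : ℝ → E} {w₀ : E} {a b : ℝ} (h0 : (0 : ℝ) ∈ Icc a b)
    (hφ : IntegrableOn φ (Icc a b)) (hw : ∀ t ∈ Icc a b, w t = w₀ + ∫ s in (0 : ℝ)..t, φ s) :
    ContinuousOn w (Icc a b) := by
  have h1 : ContinuousOn (fun t => w₀ + ∫ s in (0 : ℝ)..t, φ s) (Icc a b) := by
    have hab : a ≤ b := h0.1.trans h0.2
    have := intervalIntegral.continuousOn_primitive_interval' (a := 0)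
      ((intervalIntegrable_iff_integrableOn_Icc_of_le hab).2 hφ) (by rwa [uIcc_of_le hab])
    rw [uIcc_of_le hab] at this
    exact continuousOn_const.add this
  exact h1.congr hw

/-- The stability estimate behind uniqueness, continuous dependence and differentiability: `w` is
an integral curve whose velocity is bounded by `l ‖w‖` plus a forcing term of integral `ρ`. -/
theorem exists_stability {l : ℝ → ℝ} {a b : ℝ} (hl : IntegrableOn l (Icc a b))
    (hl0 : ∀ s, 0 ≤ l s) (h0 : (0 : ℝ) ∈ Icc a b) (E : Type*) [NormedAddCommGroup E]
    [NormedSpace ℝ E] :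
    ∃ C : ℝ, 0 ≤ C ∧ ∀ (φ w : ℝ → E) (w₀ : E) (r : ℝ → ℝ) (ρ : ℝ),
      IntegrableOn φ (Icc a b) → (∀ t ∈ Icc a b, w t = w₀ + ∫ s in (0 : ℝ)..t, φ s) →
      IntegrableOn r (Icc a b) → (∀ s, 0 ≤ r s) → ∫ s in Icc a b, r s ≤ ρ →
      (∀ᵐ t ∂volume.restrict (Icc a b), ‖φ t‖ ≤ l t * ‖w t‖ + r t) →
      ∀ t ∈ Icc a b, ‖w t‖ ≤ C * (‖w₀‖ + ρ) := by
  obtain ⟨C, hC, h⟩ := exists_gronwall hl hl0 h0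
  refine ⟨C, hC, fun φ w w₀ r ρ hφ hw hr hr0 hρ hle => ?_⟩
  have hwc := continuousOn_of_integral h0 hφ hw
  have hρ0 : 0 ≤ ρ := (integral_nonneg hr0).trans hρ
  refine h (fun t => ‖w t‖) _ hwc.norm (by positivity) fun t ht => ?_
  have hsub := uIoc_zero_subset h0 ht
  have hlw : IntegrableOn (fun s => l s * ‖w s‖) (uIoc 0 t) :=
    (hl.mul_continuousOn hwc.norm isCompact_Icc).mono_set hsub
  have h1 := norm_intervalIntegral_le (hlw.add (hr.mono_set hsub))
    (ae_restrict_of_ae_restrict_of_subset hsub hle)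
  rw [Pi.add_def, integral_add hlw (hr.mono_set hsub)] at h1
  have h2 : ∫ s in uIoc 0 t, r s ≤ ρ :=
    (setIntegral_mono_set hr (Eventually.of_forall hr0) hsub.eventuallyLE).trans hρ
  calc ‖w t‖ ≤ ‖w₀‖ + ‖∫ s in (0 : ℝ)..t, φ s‖ := by rw [hw t ht]; exact norm_add_le _ _
    _ ≤ _ := by linarith

/-! ### Carathéodory's existence theorem -/

variable {N : ℕ}

/-- Picard's theorem for fields which are Lipschitz in `x` with an integrable Lipschitz
coefficient: the integral operator contracts the sup norm weighted by `exp(-c |t|)`. -/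
theorem exists_isSolOn {F : ℝ → Vec N → Vec N} {l : ℝ → ℝ} {a b : ℝ}
    (h0 : (0 : ℝ) ∈ Icc a b) (hl : IntegrableOn l (Icc a b)) (hl0 : ∀ s, 0 ≤ l s)
    (hF : ∀ x : ℝ → Vec N, ContinuousOn x (Icc a b) →
      IntegrableOn (fun t => F t (x t)) (Icc a b))
    (hlip : ∀ᵐ t ∂volume.restrict (Icc a b), ∀ x y, ‖F t x - F t y‖ ≤ l t * ‖x - y‖)
    (x₀ : Vec N) : ∃ x, IsSolOn F x₀ (Icc a b) x := by
  have hab : a ≤ b := h0.1.trans h0.2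
  obtain ⟨c, hc, hcl⟩ := exists_setIntegral_mul_exp_le hl h0
  -- in the variable `z(t) = exp(-c |t|) x(t)` the weighted norm is the sup norm
  let e : C(Icc a b, Vec N) → ℝ → Vec N := fun z t => Real.exp (c * |t|) • IccExtend hab z t
  have he : ∀ z, Continuous (e z) := fun z => by
    have := z.continuous.Icc_extend' (h := hab)
    fun_prop
  let P : C(Icc a b, Vec N) → ℝ → Vec N := fun z t => x₀ + ∫ s in (0 : ℝ)..t, F s (e z s)
  have hP : ∀ z, ContinuousOn (P z) (Icc a b) := fun z =>
    continuousOn_of_integral h0 (hF _ (he z).continuousOn) fun t _ => rfl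
  let T : C(Icc a b, Vec N) → C(Icc a b, Vec N) := fun z =>
    ⟨fun t => Real.exp (-c * |(t : ℝ)|) • P z t, by
      have : Continuous fun t : Icc a b => P z t := (hP z).domRestrict
      exact (by fun_prop : Continuous fun t : Icc a b => Real.exp (-c * |(t : ℝ)|)).smul this⟩
  have hT : ContractingWith (1 / 2) T := by
    refine ⟨by norm_num, LipschitzWith.of_dist_le_mul fun z w => ?_⟩
    rw [ContinuousMap.dist_le (by positivity)]
    rintro ⟨t, ht⟩
    have hsub := uIoc_zero_subset h0 ht
    have hi : ∀ z, IntervalIntegrable (fun s => F s (e z s)) volume 0 t := fun z =>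
      intervalIntegrable_iff.2 ((hF _ (he z).continuousOn).mono_set hsub)
    have h1 : P z t - P w t = ∫ s in (0 : ℝ)..t, (F s (e z s) - F s (e w s)) := by
      rw [intervalIntegral.integral_sub (hi z) (hi w)]; simp only [P]; abel
    have h2 : ‖P z t - P w t‖ ≤ 1 / 2 * Real.exp (c * |t|) * dist z w := by
      rw [h1]
      refine (norm_intervalIntegral_le (k := fun s => l s * (Real.exp (c * |s|) * dist z w))
        ((hl.mul_continuousOn (by fun_prop) isCompact_Icc).mono_set hsub) ?_).trans ?_
      · filter_upwards [ae_restrict_of_ae_restrict_of_subset hsub hlip] with s hs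
        refine (hs _ _).trans (mul_le_mul_of_nonneg_left ?_ (hl0 s))
        simp only [e, ← smul_sub]
        rw [norm_smul, Real.norm_of_nonneg (Real.exp_pos _).le, ← dist_eq_norm]
        gcongr
        exact ContinuousMap.dist_apply_le_dist _
      · refine le_trans (le_of_eq ?_)
          (mul_le_mul_of_nonneg_right (hcl t ht) (dist_nonneg (x := z) (y := w)))
        rw [← integral_mul_const]
        refine integral_congr_ae (Eventually.of_forall fun s => ?_)
        simp only [Real.norm_of_nonneg (hl0 s)]; ring
    have h6 : Real.exp (-c * |t|) * Real.exp (c * |t|) = 1 := by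
      rw [← Real.exp_add]; simp
    change dist (Real.exp (-c * |t|) • P z t) (Real.exp (-c * |t|) • P w t) ≤ _
    rw [dist_eq_norm, ← smul_sub, norm_smul, Real.norm_of_nonneg (Real.exp_pos _).le]
    calc _ ≤ Real.exp (-c * |t|) * (1 / 2 * Real.exp (c * |t|) * dist z w) := by gcongr
      _ = 1 / 2 * dist z w := by linear_combination (1 / 2 * dist z w) * h6
      _ = _ := by norm_num
  set z := hT.fixedPoint T with hz
  have hfix : T z = z := hT.fixedPoint_isFixedPt
  have hez : ∀ t ∈ Icc a b, e z t = P z t := fun t ht => by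
    have h1 : z ⟨t, ht⟩ = Real.exp (-c * |t|) • P z t := by
      conv_lhs => rw [← hfix]
      rfl
    have h6 : Real.exp (c * |t|) * Real.exp (-c * |t|) = 1 := by
      rw [← Real.exp_add]; simp
    simp only [e, IccExtend_of_mem hab z ht]
    rw [h1, smul_smul, h6, one_smul]
  exact ⟨e z, (he z).continuousOn, fun t ht => ⟨intervalIntegrable_iff.2
    ((hF _ (he z).continuousOn).mono_set (uIoc_zero_subset h0 ht)), hez t ht⟩⟩

/-! ### The metric projection onto a closed ball -/

theorem exists_ballProj (N j : ℕ) : ∃ P : Vec N → Vec N, (∀ x y, ‖P x - P y‖ ≤ ‖x - y‖) ∧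
    (∀ x, ‖P x‖ ≤ j) ∧ ∀ x, ‖x‖ ≤ j → P x = x := by
  have hK : Convex ℝ (Metric.closedBall (0 : Vec N) j) := convex_closedBall _ _
  have hex : ∀ u : Vec N, ∃ v ∈ Metric.closedBall (0 : Vec N) j,
      ∀ w ∈ Metric.closedBall (0 : Vec N) j, inner ℝ (u - v) (w - v) ≤ 0 := fun u => by
    obtain ⟨v, hv, h⟩ := exists_norm_eq_iInf_of_complete_convex
      (K := Metric.closedBall (0 : Vec N) j) ⟨0, by simp⟩ Metric.isClosed_closedBall.isComplete hK u
    exact ⟨v, hv, (norm_eq_iInf_iff_real_inner_le_zero hK hv).1 h⟩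
  choose P hP hin using hex
  -- both claims follow from the variational inequality `⟪u - P u, w - P u⟫ ≤ 0` for `w` in the ball
  refine ⟨P, fun x y => ?_, fun x => by simpa using hP x, fun x hx => ?_⟩
  · have h1 := hin x (P y) (hP y)
    have h2 := hin y (P x) (hP x)
    have h3 : ‖P x - P y‖ ^ 2 ≤ inner ℝ (x - y) (P x - P y) := by
      rw [← real_inner_self_eq_norm_sq]
      simp only [inner_sub_left, inner_sub_right, real_inner_comm] at h1 h2 ⊢
      linarith
    have h4 := real_inner_le_norm (x - y) (P x - P y)
    by_contra! h
    nlinarith [norm_nonneg (P x - P y), norm_nonneg (x - y)]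
  · have h1 := hin x x (by simpa using hx)
    rw [real_inner_self_nonpos, sub_eq_zero] at h1
    exact h1.symm

/-- The metric projection of `ℝ^N` onto the closed ball `B_j`. -/
noncomputable def ballProj (j : ℕ) : Vec N → Vec N := (exists_ballProj N j).choose

theorem norm_ballProj_sub_le (j : ℕ) (x y : Vec N) :
    ‖ballProj j x - ballProj j y‖ ≤ ‖x - y‖ := (exists_ballProj N j).choose_spec.1 x y

theorem norm_ballProj_le (j : ℕ) (x : Vec N) : ‖ballProj j x‖ ≤ j :=
  (exists_ballProj N j).choose_spec.2.1 x

theorem ballProj_of_norm_le {j : ℕ} {x : Vec N} (hx : ‖x‖ ≤ j) : ballProj j x = x :=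
  (exists_ballProj N j).choose_spec.2.2 x hx

theorem continuous_ballProj (j : ℕ) : Continuous (ballProj j : Vec N → Vec N) :=
  (LipschitzWith.of_dist_le_mul (K := 1) fun x y => by
    simpa [dist_eq_norm] using norm_ballProj_sub_le j x y).continuous

/-! ### Uniqueness and the maximal solution -/

/-- On compact subintervals of `M` around `0`, the field `F` is Lipschitz in `x` on balls, with an
integrable Lipschitz coefficient. -/
def LocLip (F : ℝ → Vec N → Vec N) (M : Set ℝ) : Prop :=
  ∀ a b : ℝ, (0 : ℝ) ∈ Icc a b → Icc a b ⊆ M → ∀ j : ℕ, ∃ l : ℝ → ℝ, (∀ s, 0 ≤ l s) ∧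
    IntegrableOn l (Icc a b) ∧ ∀ᵐ t ∂volume.restrict (Icc a b), ∀ x y : Vec N, ‖x‖ ≤ j → ‖y‖ ≤ j →
      ‖F t x - F t y‖ ≤ l t * ‖x - y‖

theorem LpLoc.integrableOn {p : ℝ≥0∞} (hp : 1 ≤ p) {m : ℝ → ℝ} (hm : LpLoc p m) (a b : ℝ) :
    IntegrableOn m (Icc a b) := (hm a b).integrable hp

section Compose

variable {F : Type*} [NormedAddCommGroup F] [MeasurableSpace F]

theorem IsC.ae_norm_le {p : ℝ≥0∞} {f : ℝ → Vec N → F} (hf : IsC p f) (j : ℕ) :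
    ∃ m : ℝ → ℝ, LpLoc p m ∧ ∀ᵐ t : ℝ, ∀ x : Vec N, ‖x‖ ≤ j → ‖f t x‖ ≤ m t := by
  obtain ⟨m, hm, h⟩ := hf.mbound _ (isCompact_closedBall (0 : Vec N) j)
  exact ⟨m, hm, by simpa using h⟩

theorem IsLC.ae_lipschitz {p : ℝ≥0∞} {f : ℝ → Vec N → F} (hf : IsLC p f) (j : ℕ) :
    ∃ l : ℝ → ℝ, (∀ s, 0 ≤ l s) ∧ LpLoc p l ∧ ∀ᵐ t : ℝ, ∀ x y : Vec N, ‖x‖ ≤ j → ‖y‖ ≤ j →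
      ‖f t x - f t y‖ ≤ l t * ‖x - y‖ := by
  obtain ⟨l, hl, h⟩ := hf.lbound _ (isCompact_closedBall (0 : Vec N) j)
  refine ⟨fun t => ‖l t‖, fun _ => norm_nonneg _, fun a b => (hl a b).norm, ?_⟩
  filter_upwards [h] with t ht x y hx hy
  refine (ht x (by simpa using hx) y (by simpa using hy)).trans ?_
  gcongr
  exact le_abs_self _

variable [BorelSpace F] [SecondCountableTopology F]

theorem aestronglyMeasurable_comp {f : ℝ → Vec N → F} (hf : Measurable (Function.uncurry f))
    {x : ℝ → Vec N} {s : Set ℝ} (hs : MeasurableSet s) (hx : ContinuousOn x s) :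
    AEStronglyMeasurable (fun t => f t (x t)) (volume.restrict s) :=
  (hf.comp_aemeasurable (aemeasurable_id.prodMk (hx.aemeasurable hs))).aestronglyMeasurable

theorem IsC.memLp_comp {p : ℝ≥0∞} {f : ℝ → Vec N → F} (hf : IsC p f) {x : ℝ → Vec N} {a b : ℝ}
    (hx : ContinuousOn x (Icc a b)) :
    MemLp (fun t => f t (x t)) p (volume.restrict (Icc a b)) := by
  obtain ⟨C, hC⟩ := isCompact_Icc.exists_bound_of_continuousOn hx
  obtain ⟨j, hj⟩ := exists_nat_ge C
  obtain ⟨m, hm, h⟩ := hf.ae_norm_le j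
  refine (hm a b).mono (aestronglyMeasurable_comp hf.measurable measurableSet_Icc hx) ?_
  filter_upwards [ae_restrict_of_ae h, ae_restrict_mem measurableSet_Icc] with t ht htI
  exact (ht _ ((hC t htI).trans hj)).trans (le_abs_self _)

theorem IsC.integrableOn_comp {p : ℝ≥0∞} (hp : 1 ≤ p) {f : ℝ → Vec N → F} (hf : IsC p f)
    {x : ℝ → Vec N} {a b : ℝ} (hx : ContinuousOn x (Icc a b)) :
    IntegrableOn (fun t => f t (x t)) (Icc a b) := (hf.memLp_comp hx).integrable hp

end Compose

theorem IsLC.locLip {p : ℝ≥0∞} (hp : 1 ≤ p) {g : ℝ → Vec N → Vec N} (hg : IsLC p g) :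
    LocLip g univ := fun a b _ _ j => by
  obtain ⟨l, hl0, hl, h⟩ := hg.ae_lipschitz j
  exact ⟨l, hl0, hl.integrableOn hp a b, ae_restrict_of_ae h⟩

theorem LocLip.mono {F : ℝ → Vec N → Vec N} {M M' : Set ℝ} (h : LocLip F M) (hM : M' ⊆ M) :
    LocLip F M' := fun a b h0 hab => h a b h0 (hab.trans hM)

variable {F : ℝ → Vec N → Vec N} {x₀ : Vec N}

theorem IsSolOn.mono {J J' : Set ℝ} {x : ℝ → Vec N} (hx : IsSolOn F x₀ J x) (h : J' ⊆ J) :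
    IsSolOn F x₀ J' x := ⟨hx.1.mono h, fun t ht => hx.2 t (h ht)⟩

theorem IsSolOn.apply_zero {J : Set ℝ} {x : ℝ → Vec N} (hx : IsSolOn F x₀ J x)
    (h : (0 : ℝ) ∈ J) : x 0 = x₀ := by simpa using (hx.2 0 h).2

theorem integrableOn_Icc_of_intervalIntegrable {E : Type*} [NormedAddCommGroup E] {φ : ℝ → E}
    {a b : ℝ} (h0 : (0 : ℝ) ∈ Icc a b) (h : ∀ t ∈ Icc a b, IntervalIntegrable φ volume 0 t) :
    IntegrableOn φ (Icc a b) := by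
  have hab : a ≤ b := h0.1.trans h0.2
  exact (intervalIntegrable_iff_integrableOn_Icc_of_le hab).1
    ((h a (left_mem_Icc.2 hab)).symm.trans (h b (right_mem_Icc.2 hab)))

theorem IsSolOn.integrableOn {a b : ℝ} {x : ℝ → Vec N} (hx : IsSolOn F x₀ (Icc a b) x)
    (h0 : (0 : ℝ) ∈ Icc a b) : IntegrableOn (fun s => F s (x s)) (Icc a b) :=
  integrableOn_Icc_of_intervalIntegrable h0 fun t ht => (hx.2 t ht).1

/-- Two solutions of the integral equations differ by the integral of the difference of their
velocities. -/
theorem IsSolOn.sub_eq {G : ℝ → Vec N → Vec N} {z₀ : Vec N} {J : Set ℝ}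
    {x z : ℝ → Vec N} (hx : IsSolOn F x₀ J x) (hz : IsSolOn G z₀ J z) :
    ∀ t ∈ J, x t - z t = (x₀ - z₀) + ∫ s in (0 : ℝ)..t, (F s (x s) - G s (z s)) := by
  intro t ht
  rw [intervalIntegral.integral_sub (hx.2 t ht).1 (hz.2 t ht).1]
  linear_combination (norm := module) (hx.2 t ht).2 - (hz.2 t ht).2

theorem uIcc_zero_eq (t : ℝ) : uIcc 0 t = Icc (min 0 t) (max 0 t) := rfl

theorem uIcc_zero_subset {J : Set ℝ} (hJ : J.OrdConnected) (h0 : (0 : ℝ) ∈ J) {t : ℝ}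
    (ht : t ∈ J) : uIcc 0 t ⊆ J := hJ.uIcc_subset h0 ht

theorem LocLip.eqOn {M J : Set ℝ} (hF : LocLip F M) (hJM : J ⊆ M) (hJ : J.OrdConnected)
    (h0 : (0 : ℝ) ∈ J) {x z : ℝ → Vec N} (hx : IsSolOn F x₀ J x) (hz : IsSolOn F x₀ J z) :
    EqOn x z J := by
  intro t ht
  have hsub := uIcc_zero_subset hJ h0 ht
  replace hx := hx.mono hsub
  replace hz := hz.mono hsub
  have h0' : (0 : ℝ) ∈ uIcc 0 t := left_mem_uIcc
  rw [uIcc_zero_eq] at *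
  obtain ⟨C, hC⟩ := isCompact_Icc.exists_bound_of_continuousOn hx.1
  obtain ⟨D, hD⟩ := isCompact_Icc.exists_bound_of_continuousOn hz.1
  obtain ⟨j, hj⟩ := exists_nat_ge (max C D)
  obtain ⟨l, hl0, hl, hlip⟩ := hF _ _ h0' (hsub.trans hJM) j
  obtain ⟨K, -, h⟩ := exists_stability hl hl0 h0' (Vec N)
  have := h _ (fun t => x t - z t) 0 0 0 ((hx.integrableOn h0').sub (hz.integrableOn h0'))
    (by simpa using hx.sub_eq hz) (integrable_zero _ _ _) (fun _ => le_rfl) (by simp) (by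
      filter_upwards [hlip, ae_restrict_mem measurableSet_Icc] with s hs hsI
      simpa using hs _ _ ((hC s hsI).trans ((le_max_left _ _).trans hj))
        ((hD s hsI).trans ((le_max_right _ _).trans hj))) t ⟨min_le_right _ _, le_max_right _ _⟩
  rw [norm_zero, add_zero, mul_zero] at this
  exact sub_eq_zero.1 (norm_le_zero_iff.1 this)

theorem zero_mem_maxInterval (F : ℝ → Vec N → Vec N) (x₀ : Vec N) : 0 ∈ maxInterval F x₀ := by
  refine ⟨fun _ => x₀, continuousOn_const, fun t ht => ?_⟩
  rw [uIcc_self, mem_singleton_iff] at ht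
  simp [ht]

theorem uIcc_subset_maxInterval {t : ℝ} (ht : t ∈ maxInterval F x₀) :
    uIcc 0 t ⊆ maxInterval F x₀ := fun s hs => by
  obtain ⟨x, hx⟩ := ht
  exact ⟨x, hx.mono (uIcc_subset_uIcc left_mem_uIcc hs)⟩

theorem mem_uIcc_zero_or {r s t : ℝ} (h : r ∈ Icc s t) : r ∈ uIcc 0 s ∨ r ∈ uIcc 0 t := by
  rcases le_total 0 r with h0 | h0
  · exact Or.inr (mem_uIcc.2 (Or.inl ⟨h0, h.2⟩))
  · exact Or.inl (mem_uIcc.2 (Or.inr ⟨h.1, h0⟩))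

theorem ordConnected_maxInterval (F : ℝ → Vec N → Vec N) (x₀ : Vec N) :
    (maxInterval F x₀).OrdConnected := ⟨fun _ hs _ ht _ hr =>
  (mem_uIcc_zero_or hr).elim (fun h => uIcc_subset_maxInterval hs h)
    fun h => uIcc_subset_maxInterval ht h⟩

theorem IsSolOn.subset_maxInterval {J : Set ℝ} (hJ : J.OrdConnected) (h0 : (0 : ℝ) ∈ J)
    {x : ℝ → Vec N} (hx : IsSolOn F x₀ J x) : J ⊆ maxInterval F x₀ := fun _ ht =>
  ⟨x, hx.mono (uIcc_zero_subset hJ h0 ht)⟩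

/-- By uniqueness, the pointwise choices in the definition of `sol` do not matter. -/
theorem LocLip.sol_eqOn {M J : Set ℝ} (hF : LocLip F M) (hJM : J ⊆ M) (hJ : J.OrdConnected)
    (h0 : (0 : ℝ) ∈ J) {x : ℝ → Vec N} (hx : IsSolOn F x₀ J x) : EqOn (sol F x₀) x J := by
  intro t ht
  have hsub := uIcc_zero_subset hJ h0 ht
  have hex : ∃ x, IsSolOn F x₀ (uIcc 0 t) x := ⟨x, hx.mono hsub⟩
  rw [sol, dif_pos hex]
  exact hF.eqOn (hsub.trans hJM) ordConnected_uIcc left_mem_uIcc hex.choose_spec (hx.mono hsub)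
    right_mem_uIcc

theorem sol_zero (F : ℝ → Vec N → Vec N) (x₀ : Vec N) : sol F x₀ 0 = x₀ := by
  have h : ∃ x, IsSolOn F x₀ (uIcc 0 0) x := zero_mem_maxInterval F x₀
  rw [sol, dif_pos h]
  exact h.choose_spec.apply_zero left_mem_uIcc

/-- The pointwise definition of `sol` gives a solution on every open interval of existence. The
continuity of `sol` is read off from the integral equation. -/
theorem LocLip.isSolOn_sol {M : Set ℝ} (hF : LocLip F M) (hMo : IsOpen M) (hM : M.OrdConnected)
    (h0 : (0 : ℝ) ∈ M) (hsub : M ⊆ maxInterval F x₀) : IsSolOn F x₀ M (sol F x₀) := by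
  have key : ∀ t ∈ M, IntervalIntegrable (fun s => F s (sol F x₀ s)) volume 0 t ∧
      sol F x₀ t = x₀ + ∫ s in (0 : ℝ)..t, F s (sol F x₀ s) := fun t ht => by
    obtain ⟨x, hx⟩ := hsub ht
    have heq := hF.sol_eqOn (uIcc_zero_subset hM h0 ht) ordConnected_uIcc left_mem_uIcc hx
    have h1 := hx.2 t right_mem_uIcc
    refine ⟨h1.1.congr fun s hs => ?_, ?_⟩
    · simp only [heq (uIoc_subset_uIcc hs)]
    · rw [heq right_mem_uIcc, h1.2]
      congr 1
      exact intervalIntegral.integral_congr fun s hs => by simp only [heq hs]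
  refine ⟨fun t ht => ?_, key⟩
  obtain ⟨δ, hδ, hball⟩ := Metric.isOpen_iff.1 hMo t ht
  have h1 : t - δ / 2 ∈ M := hball (by
    rw [Metric.mem_ball, Real.dist_eq, abs_lt]; constructor <;> linarith)
  have h2 : t + δ / 2 ∈ M := hball (by
    rw [Metric.mem_ball, Real.dist_eq, abs_lt]; constructor <;> linarith)
  have ha : min 0 (t - δ / 2) ∈ M := by rcases min_choice 0 (t - δ / 2) with h | h <;> rwa [h]
  have hb : max 0 (t + δ / 2) ∈ M := by rcases max_choice 0 (t + δ / 2) with h | h <;> rwa [h]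
  have hI : Icc (min 0 (t - δ / 2)) (max 0 (t + δ / 2)) ⊆ M := hM.out ha hb
  have h0I : (0 : ℝ) ∈ Icc (min 0 (t - δ / 2)) (max 0 (t + δ / 2)) :=
    ⟨min_le_left _ _, le_max_left _ _⟩
  have hc : ContinuousOn (sol F x₀) (Icc (min 0 (t - δ / 2)) (max 0 (t + δ / 2))) :=
    continuousOn_of_integral h0I
      (integrableOn_Icc_of_intervalIntegrable h0I fun s hs => (key s (hI hs)).1)
      fun s hs => (key s (hI hs)).2
  refine (hc.continuousAt (Icc_mem_nhds ?_ ?_)).continuousWithinAt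
  · exact (min_le_right _ _).trans_lt (by linarith)
  · exact lt_of_lt_of_le (by linarith) (le_max_right _ _)

theorem LocLip.isUniqueSolOn_sol {M : Set ℝ} (hF : LocLip F M) (hMo : IsOpen M)
    (hM : M.OrdConnected) (h0 : (0 : ℝ) ∈ M) (hsub : M ⊆ maxInterval F x₀) :
    IsUniqueSolOn F x₀ M (sol F x₀) :=
  ⟨hF.isSolOn_sol hMo hM h0 hsub, fun _ hJM hJ h0J _ hz =>
    (hF.sol_eqOn hJM hJ h0J hz).symm⟩

/-! ### Truncated fields -/

theorem IsSolOn.of_ballProj {g : ℝ → Vec N → Vec N} {J : Set ℝ} {j : ℕ} {x : ℝ → Vec N}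
    (hJ : J.OrdConnected) (h0 : (0 : ℝ) ∈ J)
    (hx : IsSolOn (fun t v => g t (ballProj j v)) x₀ J x) (h : ∀ t ∈ J, ‖x t‖ ≤ j) :
    IsSolOn g x₀ J x := by
  have heq : ∀ t ∈ J, EqOn (fun s => g s (ballProj j (x s))) (fun s => g s (x s)) (uIcc 0 t) :=
    fun t ht s hs => by simp only [ballProj_of_norm_le (h s (uIcc_zero_subset hJ h0 ht hs))]
  refine ⟨hx.1, fun t ht => ⟨(hx.2 t ht).1.congr ((heq t ht).mono uIoc_subset_uIcc), ?_⟩⟩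
  rw [← intervalIntegral.integral_congr (heq t ht)]
  exact (hx.2 t ht).2

theorem IsSolOn.ballProj {g : ℝ → Vec N → Vec N} {J : Set ℝ} {j : ℕ} {x : ℝ → Vec N}
    (hJ : J.OrdConnected) (h0 : (0 : ℝ) ∈ J)
    (hx : IsSolOn g x₀ J x) (h : ∀ t ∈ J, ‖x t‖ ≤ j) :
    IsSolOn (fun t v => g t (ballProj j v)) x₀ J x := by
  have heq : ∀ t ∈ J, EqOn (fun s => g s (x s)) (fun s => g s (Caratheodory.ballProj j (x s)))
      (uIcc 0 t) :=
    fun t ht s hs => by simp only [ballProj_of_norm_le (h s (uIcc_zero_subset hJ h0 ht hs))]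
  refine ⟨hx.1, fun t ht => ⟨(hx.2 t ht).1.congr ((heq t ht).mono uIoc_subset_uIcc), ?_⟩⟩
  rw [← intervalIntegral.integral_congr (heq t ht)]
  exact (hx.2 t ht).2

theorem IsLC.ballProj_lipschitz {p : ℝ≥0∞} {g : ℝ → Vec N → Vec N}
    (hg : IsLC p g) (j : ℕ) : ∃ l : ℝ → ℝ, (∀ s, 0 ≤ l s) ∧ LpLoc p l ∧
      ∀ᵐ t : ℝ, ∀ x y : Vec N, ‖g t (ballProj j x) - g t (ballProj j y)‖ ≤ l t * ‖x - y‖ := by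
  obtain ⟨l, hl0, hl, h⟩ := hg.ae_lipschitz j
  refine ⟨l, hl0, hl, ?_⟩
  filter_upwards [h] with t ht x y
  exact (ht _ _ (norm_ballProj_le j x) (norm_ballProj_le j y)).trans
    (mul_le_mul_of_nonneg_left (norm_ballProj_sub_le j x y) (hl0 t))

theorem IsLC.exists_isSolOn_ballProj {p : ℝ≥0∞} (hp : 1 ≤ p) {g : ℝ → Vec N → Vec N}
    (hg : IsLC p g) (j : ℕ) {a b : ℝ} (h0 : (0 : ℝ) ∈ Icc a b) (x₀ : Vec N) :
    ∃ x, IsSolOn (fun t v => g t (ballProj j v)) x₀ (Icc a b) x := by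
  obtain ⟨l, hl0, hl, hlip⟩ := hg.ballProj_lipschitz j
  exact exists_isSolOn (F := fun t v => g t (ballProj j v)) h0 (hl.integrableOn hp a b) hl0
    (fun x hx => hg.toIsC.integrableOn_comp hp ((continuous_ballProj j).comp_continuousOn hx))
    (ae_restrict_of_ae hlip) x₀

/-- A solution of the problem truncated at a larger radius continues the given solution, and still
solves the original problem until it leaves the larger ball. -/
theorem IsLC.isOpen_maxInterval {p : ℝ≥0∞} (hp : 1 ≤ p) {g : ℝ → Vec N → Vec N}
    (hg : IsLC p g) (x₀ : Vec N) : IsOpen (maxInterval g x₀) := by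
  refine isOpen_iff_mem_nhds.2 fun t ⟨x, hx⟩ => ?_
  obtain ⟨C, hC⟩ := isCompact_uIcc.exists_bound_of_continuousOn hx.1
  obtain ⟨j, hj⟩ := exists_nat_ge C
  have h0 : (0 : ℝ) ∈ Icc (min 0 t - 1) (max 0 t + 1) :=
    ⟨by linarith [min_le_left 0 t], by linarith [le_max_left 0 t]⟩
  have hsub : uIcc 0 t ⊆ Icc (min 0 t - 1) (max 0 t + 1) :=
    Icc_subset_Icc (by linarith) (by linarith)
  obtain ⟨z, hz⟩ := hg.exists_isSolOn_ballProj hp (j + 1) h0 x₀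
  have hle : (j : ℝ) ≤ ((j + 1 : ℕ) : ℝ) := by push_cast; linarith
  have hlip : LocLip (fun t v => g t (ballProj (j + 1) v)) univ := fun a b _ _ i => by
    obtain ⟨l, hl0, hl, h⟩ := hg.ballProj_lipschitz (j + 1)
    refine ⟨l, hl0, hl.integrableOn hp a b, ?_⟩
    filter_upwards [ae_restrict_of_ae h] with t ht x y _ _ using ht x y
  have heq : EqOn z x (uIcc 0 t) := hlip.eqOn (subset_univ _) ordConnected_uIcc left_mem_uIcc
    (hz.mono hsub) (hx.ballProj ordConnected_uIcc left_mem_uIcc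
      fun s hs => (hC s hs).trans (hj.trans hle))
  have htn : Icc (min 0 t - 1) (max 0 t + 1) ∈ 𝓝 t :=
    Icc_mem_nhds (by linarith [min_le_right 0 t]) (by linarith [le_max_right 0 t])
  have hev : ∀ᶠ s in 𝓝 t, ‖z s‖ < (j + 1 : ℕ) := by
    refine (hz.1.continuousAt htn).norm.eventually_lt continuousAt_const ?_
    rw [heq right_mem_uIcc]
    push_cast
    linarith [hC t right_mem_uIcc]
  obtain ⟨δ, hδ, hball⟩ := Metric.mem_nhds_iff.1 (inter_mem hev htn)
  refine Metric.mem_nhds_iff.2 ⟨δ, hδ, fun s hs => ?_⟩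
  -- a point between `0` and `s` lies between `0` and `t`, or is as close to `t` as `s` is
  have hcases : ∀ r ∈ uIcc 0 s, r ∈ uIcc 0 t ∨ r ∈ Metric.ball t δ := fun r hr => by
    have h1 : uIcc 0 s ⊆ uIcc 0 t ∪ uIcc t s := uIcc_subset_uIcc_union_uIcc
    refine (h1 hr).imp id fun h2 => ?_
    exact (convex_ball t δ).ordConnected.uIcc_subset (Metric.mem_ball_self hδ) hs h2
  have hsI : uIcc 0 s ⊆ Icc (min 0 t - 1) (max 0 t + 1) := fun r hr =>
    (hcases r hr).elim (fun h => hsub h) fun h => (hball h).2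
  refine ⟨z, (hz.mono hsI).of_ballProj ordConnected_uIcc left_mem_uIcc fun r hr => ?_⟩
  rcases hcases r hr with h | h
  · rw [heq h]; exact (hC r h).trans (hj.trans hle)
  · exact le_of_lt (hball h).1

theorem IsLC.isSolOn_sol {p : ℝ≥0∞} (hp : 1 ≤ p) {g : ℝ → Vec N → Vec N}
    (hg : IsLC p g) (x₀ : Vec N) : IsSolOn g x₀ (maxInterval g x₀) (sol g x₀) :=
  ((hg.locLip hp).mono (subset_univ _)).isSolOn_sol (hg.isOpen_maxInterval hp x₀)
    (ordConnected_maxInterval _ _) (zero_mem_maxInterval _ _) Subset.rfl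

/-! ### The linear problem along a solution -/

theorem exists_isSolOn_clm {A : ℝ → Mat N} {a b : ℝ} (h0 : (0 : ℝ) ∈ Icc a b)
    (hA : IntegrableOn A (Icc a b)) (y₀ : Vec N) :
    ∃ y, IsSolOn (fun t v => A t v) y₀ (Icc a b) y := by
  refine exists_isSolOn h0 hA.norm (fun _ => norm_nonneg _) (fun x hx => ?_)
    (Eventually.of_forall fun t x y => ?_) y₀
  · obtain ⟨C, hC⟩ := isCompact_Icc.exists_bound_of_continuousOn hx
    refine (hA.norm.mul_const C).mono' ((ContinuousLinearMap.id ℝ (Mat N)).aestronglyMeasurable_comp₂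
      hA.1 (hx.aestronglyMeasurable measurableSet_Icc)) ?_
    filter_upwards [ae_restrict_mem measurableSet_Icc] with t ht
    exact (A t).le_opNorm_of_le (hC t ht)
  · rw [← map_sub]
    exact (A t).le_opNorm _

section Linear

variable {p : ℝ≥0∞} {g : ℝ → Vec N → Vec N} {G : ℝ → Vec N → Mat N}

theorem integrableOn_comp_sol (hp : 1 ≤ p) (hg : IsLC p g) (hG : IsC p G) (x₀ : Vec N) {a b : ℝ}
    (hsub : Icc a b ⊆ maxInterval g x₀) :
    IntegrableOn (fun t => G t (sol g x₀ t)) (Icc a b) :=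
  hG.integrableOn_comp hp ((hg.isSolOn_sol hp x₀).1.mono hsub)

theorem locLip_linField (hp : 1 ≤ p) (hg : IsLC p g) (hG : IsC p G) (x₀ : Vec N) :
    LocLip (linField g G x₀) (maxInterval g x₀) := fun a b _ hsub j =>
  ⟨fun t => ‖G t (sol g x₀ t)‖, fun _ => norm_nonneg _,
    (integrableOn_comp_sol hp hg hG x₀ hsub).norm, Eventually.of_forall fun t x y _ _ => by
      simp only [linField, ← map_sub]
      exact (G t (sol g x₀ t)).le_opNorm _⟩

theorem isUniqueSolOn_linSol (hp : 1 ≤ p) (hg : IsLC p g) (hG : IsC p G) (x₀ y₀ : Vec N) :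
    IsUniqueSolOn (linField g G x₀) y₀ (maxInterval g x₀) (linSol g G x₀ y₀) := by
  refine (locLip_linField hp hg hG x₀).isUniqueSolOn_sol (hg.isOpen_maxInterval hp x₀)
    (ordConnected_maxInterval _ _) (zero_mem_maxInterval _ _) fun t ht => ?_
  exact exists_isSolOn_clm left_mem_uIcc
    (integrableOn_comp_sol hp hg hG x₀ (uIcc_subset_maxInterval ht)) y₀

end Linear

/-! ### The moduli and the sets of curves -/

/-- The `ℝ≥0∞`-valued form of `thetaOf`, finite by covering an interval with short ones. -/
theorem iSup_lintegral_optMBound_ne_top {E : Set (ℝ → Vec N → Vec N)}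
    (hE : EquicontinuousMBounds E) (q₁ q₂ : ℚ) (j : ℕ) (s : ℝ) :
    (⨆ t ∈ Icc (q₁ : ℝ) q₂, ⨆ f ∈ E, ∫⁻ u in Icc t (t + s), optMBound f j u) ≠ ∞ := by
  rcases lt_or_ge s 0 with hs | hs
  · have : (⨆ t ∈ Icc (q₁ : ℝ) q₂, ⨆ f ∈ E, ∫⁻ u in Icc t (t + s), optMBound f j u) = 0 := by
      simp only [ENNReal.iSup_eq_zero]
      intro t _ f _
      rw [Icc_eq_empty (by linarith)]; simp
    exact this ▸ ENNReal.zero_ne_top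
  have hr : 0 < |(q₁ : ℝ)| + |(q₂ : ℝ)| + s + 1 := by positivity
  set r := |(q₁ : ℝ)| + |(q₂ : ℝ)| + s + 1 with hrdef
  obtain ⟨δ, hδ, h⟩ := hE j r 1 hr one_pos
  obtain ⟨n, hn⟩ := exists_nat_gt (s / δ)
  have hn0 : (0 : ℝ) < n := lt_of_le_of_lt (by positivity) hn
  have hsn : s / n < δ := by
    rw [div_lt_iff₀ hδ] at hn; rw [div_lt_iff₀ hn0]; linarith
  have hsn0 : 0 ≤ s / n := by positivity
  -- an interval of length `k s / n` consists of `k` intervals of length less than `δ`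
  have key : ∀ k : ℕ, ∀ f ∈ E, ∀ t : ℝ, -r ≤ t → t + k * (s / n) ≤ r →
      ∫⁻ u in Icc t (t + k * (s / n)), optMBound f j u ≤ k := by
    intro k f hf t ht
    induction k with
    | zero => intro _; simp
    | succ k ih =>
      intro hk
      push_cast at hk
      have hk0 : 0 ≤ (k : ℝ) * (s / n) := by positivity
      have h1 := ih (by linarith)
      have h2 := h (t + k * (s / n)) (t + (k + 1) * (s / n)) (by linarith) (by linarith) hk
        (by linarith)
      have h3 : ∫⁻ u in Icc (t + k * (s / n)) (t + (k + 1) * (s / n)), optMBound f j u ≤ 1 := by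
        have := le_iSup₂ (f := fun f (_ : f ∈ E) =>
          ∫⁻ u in Icc (t + k * (s / n)) (t + (k + 1) * (s / n)), optMBound f j u) f hf
        simpa using this.trans h2.le
      push_cast
      calc _ ≤ ∫⁻ u in Icc t (t + k * (s / n)) ∪ Icc (t + k * (s / n)) (t + (k + 1) * (s / n)),
            optMBound f j u := lintegral_mono_set Icc_subset_Icc_union_Icc
        _ ≤ _ := (lintegral_union_le _ _ _).trans (add_le_add h1 h3)
  refine ne_top_of_le_ne_top (ENNReal.natCast_ne_top n)
    (iSup₂_le fun t ht => iSup₂_le fun f hf => ?_)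
  have hns : (n : ℝ) * (s / n) = s := by field_simp
  have := key n f hf t (by linarith [ht.1, neg_abs_le (q₁ : ℝ), abs_nonneg (q₂ : ℝ)])
    (by rw [hns]; linarith [ht.2, le_abs_self (q₂ : ℝ), abs_nonneg (q₁ : ℝ)])
  rwa [hns] at this

theorem thetaOf_nonneg (E : Set (ℝ → Vec N → Vec N)) (q₁ q₂ : ℚ) (j : ℕ) (s : ℝ) :
    0 ≤ thetaOf E q₁ q₂ j s := ENNReal.toReal_nonneg

theorem lintegral_optMBound_le_thetaOf {E : Set (ℝ → Vec N → Vec N)}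
    (hE : EquicontinuousMBounds E) {q₁ q₂ : ℚ} (j : ℕ) {f : ℝ → Vec N → Vec N} (hf : f ∈ E)
    {s t : ℝ} (hs : s ∈ Icc (q₁ : ℝ) q₂) :
    ∫⁻ u in Icc s t, optMBound f j u ≤ ENNReal.ofReal (thetaOf E q₁ q₂ j (t - s)) := by
  rw [thetaOf, ENNReal.ofReal_toReal (iSup_lintegral_optMBound_ne_top hE _ _ _ _)]
  refine le_iSup₂_of_le s hs (le_iSup₂_of_le f hf (le_of_eq ?_))
  rw [add_sub_cancel]

section Curves

variable {θ : Moduli} {q₁ q₂ : ℚ} {j : ℕ}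

theorem curves_congr {x y : ℝ → Vec N} (hx : x ∈ curves N θ q₁ q₂ j)
    (h : EqOn y x (Icc (q₁ : ℝ) q₂)) : y ∈ curves N θ q₁ q₂ j :=
  ⟨hx.1.congr h, fun t ht => by rw [h ht]; exact hx.2.1 t ht,
    fun s hs t ht => by rw [h hs, h ht]; exact hx.2.2 s hs t ht⟩

theorem const_mem_curves (hθ : ∀ q₁ q₂ j s, 0 ≤ θ q₁ q₂ j s) {c : Vec N} (hc : ‖c‖ ≤ j) :
    (fun _ => c) ∈ curves N θ q₁ q₂ j :=
  ⟨continuousOn_const, fun _ _ => hc, fun _ _ _ _ => by simpa using hθ _ _ _ _⟩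

theorem convexComb_mem_curves {x y : ℝ → Vec N} (hx : x ∈ curves N θ q₁ q₂ j)
    (hy : y ∈ curves N θ q₁ q₂ j) {σ : ℝ} (hσ : σ ∈ Icc (0 : ℝ) 1) :
    (fun t => x t + σ • (y t - x t)) ∈ curves N θ q₁ q₂ j := by
  have h1 : ∀ a b : Vec N, a + σ • (b - a) = (1 - σ) • a + σ • b := fun a b => by module
  have hσ' : 0 ≤ 1 - σ := by linarith [hσ.2]
  have h2 : ∀ (a b : Vec N) (c : ℝ), ‖a‖ ≤ c → ‖b‖ ≤ c → ‖(1 - σ) • a + σ • b‖ ≤ c := by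
    intro a b c ha hb
    refine (norm_add_le _ _).trans ?_
    rw [norm_smul, norm_smul, Real.norm_of_nonneg hσ', Real.norm_of_nonneg hσ.1]
    nlinarith [hσ.1]
  refine ⟨hx.1.add ((hy.1.sub hx.1).const_smul σ), fun t ht => ?_,
    fun s hs t ht => ?_⟩
  · beta_reduce
    rw [h1]
    exact h2 _ _ _ (hx.2.1 t ht) (hy.2.1 t ht)
  · have h3 : (x t + σ • (y t - x t)) - (x s + σ • (y s - x s)) =
        (1 - σ) • (x t - x s) + σ • (y t - y s) := by module
    rw [h3]
    exact h2 _ _ _ (hx.2.2 s hs t ht) (hy.2.2 s hs t ht)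

end Curves

/-! ### The seminorms and the topology -/

section Topology

variable {F : Type*} [NormedAddCommGroup F] {θ : Moduli} {p : ℝ≥0∞}

theorem eLpNorm_le_thetaSeminorm {q₁ q₂ : ℚ} {j : ℕ} (f : ℝ → Vec N → F) {x : ℝ → Vec N}
    (hx : x ∈ curves N θ q₁ q₂ j) :
    eLpNorm (fun t => f t (x t)) p (volume.restrict (Icc (q₁ : ℝ) q₂)) ≤
      thetaSeminorm θ p q₁ q₂ j f :=
  le_iSup₂ (f := fun x (_ : x ∈ curves N θ q₁ q₂ j) =>
    eLpNorm (fun t => f t (x t)) p (volume.restrict (Icc (q₁ : ℝ) q₂))) x hx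

theorem thetaSeminorm_sub_self (q₁ q₂ : ℚ) (j : ℕ) (f : ℝ → Vec N → F) :
    thetaSeminorm θ p q₁ q₂ j (fun t x => f t x - f t x) = 0 := by
  simp [thetaSeminorm]

/-- The norm of the inclusion of `L^p` into `L^1` on `[a, b]`. -/
noncomputable def holderConst (p : ℝ≥0∞) (a b : ℝ) : ℝ :=
  (volume (Icc a b) ^ (1 - 1 / p.toReal)).toReal

theorem holderConst_nonneg (p : ℝ≥0∞) (a b : ℝ) : 0 ≤ holderConst p a b :=
  ENNReal.toReal_nonneg

theorem lintegral_enorm_le_holderConst (hp : 1 ≤ p) {a b : ℝ} {φ : ℝ → F}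
    (hφ : AEStronglyMeasurable φ (volume.restrict (Icc a b))) :
    ∫⁻ t in Icc a b, ‖φ t‖ₑ ≤
      ENNReal.ofReal (holderConst p a b) * eLpNorm φ p (volume.restrict (Icc a b)) := by
  have h1 := eLpNorm_le_eLpNorm_mul_rpow_measure_univ hp hφ
  rw [eLpNorm_one_eq_lintegral_enorm, Measure.restrict_apply_univ, mul_comm] at h1
  simp only [ENNReal.toReal_one, div_one] at h1
  have h2 : 0 ≤ 1 - 1 / p.toReal := by
    rcases eq_or_ne p ∞ with rfl | hp'
    · simp
    · have : 1 ≤ p.toReal := by simpa using ENNReal.toReal_mono hp' hp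
      rw [sub_nonneg, div_le_one (by linarith)]
      exact this
  rwa [holderConst, ENNReal.ofReal_toReal
    (ENNReal.rpow_ne_top_of_nonneg h2 isCompact_Icc.measure_lt_top.ne)]

variable [MeasurableSpace F]

theorem eventually_thetaSeminorm_lt {f : ℝ → Vec N → F} (hf : IsThetaC θ p f) (q₁ q₂ : ℚ)
    (j : ℕ) {ε : ℝ≥0∞} (hε : 0 < ε) :
    ∀ᶠ h : FunSpace θ p N F in 𝓝 (f : FunSpace θ p N F),
      thetaSeminorm θ p q₁ q₂ j (fun t x => h t x - f t x) < ε := by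
  refine IsOpen.mem_nhds (TopologicalSpace.isOpen_generateFrom_of_mem
    ⟨f, hf, q₁, q₂, j, ε, hε, rfl⟩) ?_
  change thetaSeminorm θ p q₁ q₂ j (fun t x => f t x - f t x) < ε
  rwa [thetaSeminorm_sub_self]

variable [BorelSpace F] [SecondCountableTopology F]

theorem thetaSeminorm_sub_le (hp : 1 ≤ p) {f g h : ℝ → Vec N → F}
    (hf : Measurable (Function.uncurry f)) (hg : Measurable (Function.uncurry g))
    (hh : Measurable (Function.uncurry h)) (q₁ q₂ : ℚ) (j : ℕ) :
    thetaSeminorm θ p q₁ q₂ j (fun t x => f t x - h t x) ≤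
      thetaSeminorm θ p q₁ q₂ j (fun t x => f t x - g t x) +
        thetaSeminorm θ p q₁ q₂ j (fun t x => g t x - h t x) := by
  refine iSup₂_le fun x hx => ?_
  have h1 : ∀ {k : ℝ → Vec N → F}, Measurable (Function.uncurry k) →
      AEStronglyMeasurable (fun t => k t (x t)) (volume.restrict (Icc (q₁ : ℝ) q₂)) :=
    fun hk => aestronglyMeasurable_comp hk measurableSet_Icc hx.1
  calc eLpNorm (fun t => f t (x t) - h t (x t)) p (volume.restrict (Icc (q₁ : ℝ) q₂))
      = eLpNorm ((fun t => f t (x t) - g t (x t)) + fun t => g t (x t) - h t (x t)) p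
          (volume.restrict (Icc (q₁ : ℝ) q₂)) := by
        congr 1; ext1 t; simp
    _ ≤ _ := (eLpNorm_add_le ((h1 hf).sub (h1 hg)) ((h1 hg).sub (h1 hh)) hp).trans
        (add_le_add (eLpNorm_le_thetaSeminorm (fun t x => f t x - g t x) hx)
          (eLpNorm_le_thetaSeminorm (fun t x => g t x - h t x) hx))

/-- Convergence in `𝒯_Θ` within `Θℭ` is convergence in the seminorms. -/
theorem tendsto_funSpace (hp : 1 ≤ p) {α : Type*} {l : Filter α} {u : α → FunSpace θ p N F}
    {f : ℝ → Vec N → F} (hu : ∀ᶠ a in l, Measurable (Function.uncurry (u a)))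
    (hf : IsThetaC θ p f)
    (h : ∀ (q₁ q₂ : ℚ) (j : ℕ) (ε : ℝ≥0∞), 0 < ε →
      ∀ᶠ a in l, thetaSeminorm θ p q₁ q₂ j (fun t x => u a t x - f t x) < ε) :
    Tendsto u l (𝓝 (f : FunSpace θ p N F)) := by
  refine TopologicalSpace.tendsto_nhds_generateFrom_iff.2 ?_
  rintro _ ⟨k, hk, q₁, q₂, j, ε, hε, rfl⟩ hfk
  change thetaSeminorm θ p q₁ q₂ j (fun t x => f t x - k t x) < ε at hfk
  filter_upwards [hu, h q₁ q₂ j _ (tsub_pos_of_lt hfk)] with a ha ha'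
  refine (thetaSeminorm_sub_le hp ha hf.measurable hk.measurable q₁ q₂ j).trans_lt ?_
  exact lt_tsub_iff_right.1 ha'

end Topology

/-! ### Membership in `Θℭ` -/

section ThetaC

variable {F : Type*} [NormedAddCommGroup F] [MeasurableSpace F] {θ : Moduli} {p : ℝ≥0∞}

/-- `𝔏ℭ_p ⊆ Θℭ`, by the Lipschitz bound on `B_j`. -/
theorem IsLC.isThetaC {f : ℝ → Vec N → F} (hf : IsLC p f) : IsThetaC θ p f := by
  refine ⟨hf.toIsC, fun q₁ q₂ j u x hu hx hlim => ?_⟩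
  obtain ⟨l, hl0, hl, h⟩ := hf.ae_lipschitz j
  have hfin : eLpNorm l p (volume.restrict (Icc (q₁ : ℝ) q₂)) ≠ ∞ := (hl q₁ q₂).2.ne
  refine ENNReal.tendsto_nhds_zero.2 fun ε hε => ?_
  obtain ⟨η, hη, hηε⟩ : ∃ η : ℝ, 0 < η ∧
      ENNReal.ofReal η * eLpNorm l p (volume.restrict (Icc (q₁ : ℝ) q₂)) ≤ ε := by
    have h0 : Tendsto (fun η : ℝ => ENNReal.ofReal η *
        eLpNorm l p (volume.restrict (Icc (q₁ : ℝ) q₂))) (𝓝[>] 0) (𝓝 0) := by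
      have h1 : Tendsto (fun η : ℝ => ENNReal.ofReal η) (𝓝[>] 0) (𝓝 0) := by
        have := (ENNReal.continuous_ofReal.tendsto 0).mono_left (nhdsWithin_le_nhds (s := Ioi 0))
        rwa [ENNReal.ofReal_zero] at this
      simpa using ENNReal.Tendsto.mul_const h1 (Or.inr hfin)
    obtain ⟨η, h1, h2⟩ := ((ENNReal.tendsto_nhds_zero.1 h0 ε hε).and
      self_mem_nhdsWithin).exists
    exact ⟨η, h2, h1⟩
  filter_upwards [Metric.tendstoUniformlyOn_iff.1 hlim η hη] with n hn
  refine le_trans ?_ hηε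
  refine (eLpNorm_le_mul_eLpNorm_of_ae_le_mul (c := η) ?_ p)
  filter_upwards [ae_restrict_of_ae h, ae_restrict_mem measurableSet_Icc] with t ht htI
  refine (ht _ _ ((hu n).2.1 t htI) (hx.2.1 t htI)).trans ?_
  rw [Real.norm_of_nonneg (hl0 t), mul_comm]
  refine mul_le_mul_of_nonneg_right ?_ (hl0 t)
  rw [← dist_eq_norm, dist_comm]
  exact (hn t htI).le

/-- The defining sequential continuity of `Θℭ` in `ε`-`δ` form. -/
theorem IsThetaC.exists_delta {f : ℝ → Vec N → F} (hf : IsThetaC θ p f) {q₁ q₂ : ℚ} {j : ℕ}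
    {x : ℝ → Vec N} (hx : x ∈ curves N θ q₁ q₂ j) {ε : ℝ≥0∞} (hε : 0 < ε) :
    ∃ δ : ℝ, 0 < δ ∧ ∀ y ∈ curves N θ q₁ q₂ j, (∀ t ∈ Icc (q₁ : ℝ) q₂, ‖y t - x t‖ ≤ δ) →
      eLpNorm (fun t => f t (y t) - f t (x t)) p (volume.restrict (Icc (q₁ : ℝ) q₂)) < ε := by
  by_contra! hcon
  choose y hy hyx hyε using fun n : ℕ => hcon (1 / ((n : ℝ) + 1)) (by positivity)
  have hlim : TendstoUniformlyOn y x atTop (Icc (q₁ : ℝ) q₂) := by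
    refine Metric.tendstoUniformlyOn_iff.2 fun η hη => ?_
    obtain ⟨n, hn⟩ := exists_nat_one_div_lt hη
    filter_upwards [eventually_ge_atTop n] with m hm t ht
    rw [dist_comm, dist_eq_norm]
    exact ((hyx m t ht).trans (Nat.one_div_le_one_div hm)).trans_lt hn
  obtain ⟨n, hn⟩ := ((hf.tendsto q₁ q₂ j y x hy hx hlim).eventually (gt_mem_nhds hε)).exists
  exact (hyε n).not_gt hn

end ThetaC

/-! ### Bounds inherited by the closure -/

/-- The velocities of `g` along functions with values in `B_j` respect the moduli `θ`. This is the
form in which a bound on the optimal `m`-bounds of `g` is used. -/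
def MBounded (θ : Moduli) (g : ℝ → Vec N → Vec N) : Prop :=
  ∀ (q₁ q₂ : ℚ) (j : ℕ) (x : ℝ → Vec N), (∀ t ∈ Icc (q₁ : ℝ) q₂, ‖x t‖ ≤ j) →
    ∀ s ∈ Icc (q₁ : ℝ) q₂, ∀ t ∈ Icc (q₁ : ℝ) q₂, s ≤ t →
      ∫⁻ u in Icc s t, ‖g u (x u)‖ₑ ≤ ENNReal.ofReal (θ q₁ q₂ j (t - s))

/-- A solution of the truncated problem, projected to `B_j`, is an admissible curve; no a priori
control of the solution is needed. -/
theorem IsSolOn.ballProj_mem_curves {θ : Moduli} (hθ : ∀ q₁ q₂ j s, 0 ≤ θ q₁ q₂ j s)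
    {g : ℝ → Vec N → Vec N} (hg : MBounded θ g) {q₁ q₂ : ℚ} {j : ℕ} {x₀ : Vec N} {x : ℝ → Vec N}
    (hx : IsSolOn (fun t v => g t (Caratheodory.ballProj j v)) x₀ (Icc (q₁ : ℝ) q₂) x) :
    (fun t => Caratheodory.ballProj j (x t)) ∈ curves N θ q₁ q₂ j := by
  have key : ∀ s ∈ Icc (q₁ : ℝ) q₂, ∀ t ∈ Icc (q₁ : ℝ) q₂, s ≤ t →
      ‖x t - x s‖ ≤ θ q₁ q₂ j (t - s) := by
    intro s hs t ht hst
    rw [(hx.2 t ht).2, (hx.2 s hs).2, add_sub_add_left_eq_sub,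
      intervalIntegral.integral_interval_sub_left (hx.2 t ht).1 (hx.2 s hs).1,
      intervalIntegral.integral_of_le hst, ← ENNReal.ofReal_le_ofReal_iff (hθ _ _ _ _),
      ofReal_norm]
    exact ((enorm_integral_le_lintegral_enorm _).trans
      (lintegral_mono_set Ioc_subset_Icc_self)).trans
      (hg q₁ q₂ j _ (fun u _ => norm_ballProj_le j (x u)) s hs t ht hst)
  refine ⟨(continuous_ballProj j).comp_continuousOn hx.1, fun t _ => norm_ballProj_le j _,
    fun s hs t ht => (norm_ballProj_sub_le j _ _).trans ?_⟩
  rcases le_total s t with h | h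
  · rw [abs_of_nonneg (sub_nonneg.2 h)]; exact key s hs t ht h
  · rw [abs_of_nonpos (sub_nonpos.2 h), neg_sub, norm_sub_rev]; exact key t ht s hs h

section Closure

variable {p : ℝ≥0∞} {E : Set (ℝ → Vec N → Vec N)} {g : ℝ → Vec N → Vec N} {G : ℝ → Vec N → Mat N}

theorem exists_approx_of_mem_linClosure (h : (g, G) ∈ linClosure p E) (q₁ q₂ : ℚ) (j : ℕ)
    {ε : ℝ≥0∞} (hε : 0 < ε) : ∃ f ∈ E, ∃ J : ℝ → Vec N → Mat N, IsSC p J ∧ IsJacobian f J ∧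
      thetaSeminorm (thetaOf E) p q₁ q₂ j (fun t x => f t x - g t x) < ε ∧
      thetaSeminorm (thetaOf E) p q₁ q₂ j (fun t x => J t x - G t x) < ε := by
  obtain ⟨⟨hg, hG⟩, hcl⟩ := h
  have hg' : IsThetaC (thetaOf E) p g := IsLC.isThetaC hg
  have h1 := (eventually_thetaSeminorm_lt hg' q₁ q₂ j hε).prod_nhds
    (eventually_thetaSeminorm_lt (θ := thetaOf E) (p := p) (f := G) hG q₁ q₂ j hε)
  obtain ⟨⟨f, J⟩, ⟨h2, h3⟩, hf, hJ, hfJ⟩ := mem_closure_iff_nhds.1 hcl _ h1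
  exact ⟨f, hf, J, hJ, hfJ, h2, h3⟩

/-- The closure has the same moduli: test with countably many constant curves. -/
theorem mBounded_of_mem_linClosure (hp : 1 ≤ p) (hE : EquicontinuousMBounds E)
    (hLC : ∀ f ∈ E, IsLC p f) (h : (g, G) ∈ linClosure p E) : MBounded (thetaOf E) g := by
  intro q₁ q₂ j x hx s hs t ht hst
  have hg : IsLC p g := h.1.1
  have hsub : Icc s t ⊆ Icc (q₁ : ℝ) q₂ := Icc_subset_Icc hs.1 ht.2
  let B := Metric.closedBall (0 : Vec N) j
  have : Nonempty B := ⟨⟨0, by simp [B]⟩⟩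
  let c : ℕ → B := TopologicalSpace.denseSeq B
  have hc : ∀ i, ‖(c i : Vec N)‖ ≤ j := fun i => by
    simpa only [B, mem_closedBall_zero_iff] using (c i).2
  have hmeas : ∀ {k : ℝ → Vec N → Vec N}, Measurable (Function.uncurry k) → ∀ i,
      Measurable fun u => k u (c i) := fun hk i =>
    hk.comp (measurable_id.prodMk measurable_const)
  -- `Φ n` is the maximum over the first `n` constants; it increases to the optimal `m`-bound
  let Φ : ℕ → ℝ → ℝ≥0∞ := fun n u => ⨆ i, ⨆ (_ : i < n), ‖g u (c i)‖ₑ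
  have hΦm : ∀ n, Measurable (Φ n) := fun n =>
    Measurable.iSup fun i => Measurable.iSup fun _ => (hmeas hg.measurable i).enorm
  have hΦmono : Monotone Φ := fun m n hmn u => biSup_mono fun i hi => hi.trans_le hmn
  have hle : ∀ n, ∫⁻ u in Icc s t, Φ n u ≤ ENNReal.ofReal (thetaOf E q₁ q₂ j (t - s)) := by
    intro n
    refine ENNReal.le_of_forall_pos_le_add fun ε hε _ => ?_
    set H := holderConst p q₁ q₂
    have hH : 0 ≤ H := holderConst_nonneg p q₁ q₂
    have hη : 0 < (ε : ℝ) / (n * H + 1) := by positivity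
    obtain ⟨f, hf, -, -, -, hfg, -⟩ := exists_approx_of_mem_linClosure h q₁ q₂ j
      (ENNReal.ofReal_pos.2 hη)
    have h1 : ∀ i, ∫⁻ u in Icc s t, ‖f u (c i) - g u (c i)‖ₑ ≤
        ENNReal.ofReal H * ENNReal.ofReal ((ε : ℝ) / (n * H + 1)) := fun i => by
      refine (lintegral_mono_set hsub).trans ((lintegral_enorm_le_holderConst hp
        ((hmeas (hLC f hf).measurable i).sub
          (hmeas hg.measurable i)).aestronglyMeasurable).trans ?_)
      gcongr
      exact (eLpNorm_le_thetaSeminorm (fun t x => f t x - g t x)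
        (const_mem_curves (thetaOf_nonneg E) (hc i))).trans hfg.le
    calc ∫⁻ u in Icc s t, Φ n u
        ≤ ∫⁻ u in Icc s t, (optMBound f j u +
            ∑ i ∈ Finset.range n, ‖f u (c i) - g u (c i)‖ₑ) := by
          refine lintegral_mono fun u => iSup₂_le fun i hi => ?_
          have h2 : ‖g u (c i)‖ₑ ≤ ‖f u (c i)‖ₑ + ‖f u (c i) - g u (c i)‖ₑ := by
            rw [← enorm_sub_rev]
            simpa using enorm_add_le (f u (c i)) (g u (c i) - f u (c i))
          refine h2.trans (add_le_add ?_ ?_)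
          · exact le_iSup₂ (f := fun x (_ : x ∈ Metric.closedBall (0 : Vec N) j) => ‖f u x‖ₑ)
              (c i : Vec N) (c i).2
          · exact Finset.single_le_sum (f := fun i => ‖f u (c i) - g u (c i)‖ₑ)
              (fun _ _ => zero_le) (Finset.mem_range.2 hi)
      _ = (∫⁻ u in Icc s t, optMBound f j u) +
            ∑ i ∈ Finset.range n, ∫⁻ u in Icc s t, ‖f u (c i) - g u (c i)‖ₑ := by
          have h3 : ∀ i, Measurable fun u => ‖f u (c i) - g u (c i)‖ₑ := fun i =>
            ((hmeas (hLC f hf).measurable i).sub (hmeas hg.measurable i)).enorm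
          rw [lintegral_add_right _ (Finset.measurable_fun_sum _ fun i _ => h3 i),
            lintegral_finsetSum _ fun i _ => h3 i]
      _ ≤ ENNReal.ofReal (thetaOf E q₁ q₂ j (t - s)) + ∑ i ∈ Finset.range n,
            ENNReal.ofReal H * ENNReal.ofReal ((ε : ℝ) / (n * H + 1)) :=
          add_le_add (lintegral_optMBound_le_thetaOf hE j hf hs)
            (Finset.sum_le_sum fun i _ => h1 i)
      _ ≤ _ := by
          gcongr
          rw [Finset.sum_const, Finset.card_range, nsmul_eq_mul, ← ENNReal.ofReal_mul hH,
            ← ENNReal.ofReal_natCast, ← ENNReal.ofReal_mul (by positivity),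
            ← ENNReal.ofReal_coe_nnreal]
          refine ENNReal.ofReal_le_ofReal ?_
          rw [← mul_assoc, mul_div_assoc', div_le_iff₀ (by positivity)]
          nlinarith [hε, NNReal.coe_nonneg ε]
  obtain ⟨l, -, -, hlip⟩ := hg.ae_lipschitz j
  calc ∫⁻ u in Icc s t, ‖g u (x u)‖ₑ ≤ ∫⁻ u in Icc s t, ⨆ n, Φ n u := by
        refine lintegral_mono_ae ?_
        filter_upwards [ae_restrict_of_ae hlip, ae_restrict_mem measurableSet_Icc] with u hu huI
        have hcont : Continuous fun v : B => ‖g u v‖ₑ := by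
          refine continuous_enorm.comp (LipschitzWith.of_dist_le_mul (K := (l u).toNNReal)
            fun v w => ?_).continuous
          have hv : ‖(v : Vec N)‖ ≤ j := by
            simpa only [B, mem_closedBall_zero_iff] using v.2
          have hw : ‖(w : Vec N)‖ ≤ j := by
            simpa only [B, mem_closedBall_zero_iff] using w.2
          rw [dist_eq_norm, Subtype.dist_eq, dist_eq_norm]
          refine (hu v w hv hw).trans ?_
          gcongr
          exact Real.le_coe_toNNReal _
        have hcl : IsClosed {v : B | ‖g u v‖ₑ ≤ ⨆ n, Φ n u} :=
          isClosed_le hcont continuous_const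
        have huniv : {v : B | ‖g u v‖ₑ ≤ ⨆ n, Φ n u} = univ := by
          refine eq_univ_of_univ_subset ?_
          rw [← (TopologicalSpace.denseRange_denseSeq B).closure_range]
          refine closure_minimal ?_ hcl
          rintro _ ⟨i, rfl⟩
          have h1 : ‖g u (c i)‖ₑ ≤ Φ (i + 1) u :=
            le_iSup₂_of_le (f := fun i (_ : i < _) => ‖g u (c i)‖ₑ) i (Nat.lt_succ_self i) le_rfl
          exact h1.trans (le_iSup (fun n => Φ n u) (i + 1))
        have hxu : x u ∈ B := by simpa [B] using hx u (hsub huI)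
        have hmem : (⟨x u, hxu⟩ : B) ∈ {v : B | ‖g u v‖ₑ ≤ ⨆ n, Φ n u} := by
          rw [huniv]; exact mem_univ _
        exact hmem
    _ = ⨆ n, ∫⁻ u in Icc s t, Φ n u := lintegral_iSup hΦm hΦmono
    _ ≤ _ := iSup_le hle

end Closure

/-! ### Continuous dependence -/

theorem integral_norm_le_of_lintegral {E : Type*} [NormedAddCommGroup E] {φ : ℝ → E}
    {μ : Measure ℝ} {ρ : ℝ} (hρ : 0 ≤ ρ) (hφ : AEStronglyMeasurable φ μ)
    (h : ∫⁻ t, ‖φ t‖ₑ ∂μ ≤ ENNReal.ofReal ρ) : ∫ t, ‖φ t‖ ∂μ ≤ ρ := by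
  rw [integral_norm_eq_lintegral_enorm hφ]
  exact ENNReal.toReal_le_of_le_ofReal hρ h

/-- Solutions depend on the field and on the initial value in a Lipschitz way, at a fixed solution.
Only a Lipschitz coefficient of the limit field `g₀` enters; the neighbouring fields are merely
required to respect the moduli. -/
theorem exists_continuousDependence {p : ℝ≥0∞} (hp : 1 ≤ p) {θ : Moduli}
    (hθ : ∀ q₁ q₂ j s, 0 ≤ θ q₁ q₂ j s) {g₀ : ℝ → Vec N → Vec N} (hg₀ : IsLC p g₀)
    {x₀ : Vec N} {q₁ q₂ : ℚ} (h0 : (0 : ℝ) ∈ Icc (q₁ : ℝ) q₂)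
    (hsub : Icc (q₁ : ℝ) q₂ ⊆ maxInterval g₀ x₀) :
    ∃ (j : ℕ) (C δ : ℝ), 0 ≤ C ∧ 0 < δ ∧ ∀ (g : ℝ → Vec N → Vec N) (x₁ : Vec N) (ρ : ℝ),
      IsLC p g → MBounded θ g → 0 ≤ ρ → ρ < δ →
      thetaSeminorm θ p q₁ q₂ j (fun t x => g t x - g₀ t x) ≤ ENNReal.ofReal ρ →
      ‖x₁ - x₀‖ ≤ ρ →
      Icc (q₁ : ℝ) q₂ ⊆ maxInterval g x₁ ∧ sol g x₁ ∈ curves N θ q₁ q₂ j ∧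
        ∀ t ∈ Icc (q₁ : ℝ) q₂, ‖sol g x₁ t - sol g₀ x₀ t‖ ≤ C * ρ := by
  have hx := (hg₀.isSolOn_sol hp x₀).mono hsub
  obtain ⟨B, hB⟩ := isCompact_Icc.exists_bound_of_continuousOn hx.1
  obtain ⟨i, hi⟩ := exists_nat_ge B
  obtain ⟨l, hl0, hl, hlip⟩ := hg₀.ballProj_lipschitz (i + 1)
  obtain ⟨K, hK, hstab⟩ := exists_stability (hl.integrableOn hp q₁ q₂) hl0 h0 (Vec N)
  set H := holderConst p q₁ q₂
  have hH : 0 ≤ H := holderConst_nonneg p q₁ q₂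
  refine ⟨i + 1, K * (1 + H), 1 / (K * (1 + H) + 1), by positivity, by positivity, ?_⟩
  intro g x₁ ρ hg hm hρ hρδ hgg hx₁
  have hxi : ∀ t ∈ Icc (q₁ : ℝ) q₂, ‖sol g₀ x₀ t‖ ≤ i := fun t ht => (hB t ht).trans hi
  have hx' := hx.ballProj (j := i + 1) ordConnected_Icc h0 fun t ht =>
    (hxi t ht).trans (by push_cast; linarith)
  obtain ⟨z, hz⟩ := hg.exists_isSolOn_ballProj hp (i + 1) h0 x₁
  have hzc := hz.ballProj_mem_curves hθ hm
  -- as the projected solution is admissible, the seminorm bounds the error made by replacing `g`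
  -- by `g₀` along it
  have hdm : AEStronglyMeasurable (fun t => g t (ballProj (i + 1) (z t)) -
      g₀ t (ballProj (i + 1) (z t))) (volume.restrict (Icc (q₁ : ℝ) q₂)) :=
    (aestronglyMeasurable_comp hg.measurable measurableSet_Icc hzc.1).sub
      (aestronglyMeasurable_comp hg₀.measurable measurableSet_Icc hzc.1)
  have hint : ∫ t in Icc (q₁ : ℝ) q₂, ‖g t (ballProj (i + 1) (z t)) -
      g₀ t (ballProj (i + 1) (z t))‖ ≤ H * ρ := by
    refine integral_norm_le_of_lintegral (by positivity) hdm ?_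
    refine (lintegral_enorm_le_holderConst hp hdm).trans ?_
    rw [ENNReal.ofReal_mul hH]
    gcongr
    exact (eLpNorm_le_thetaSeminorm (fun t x => g t x - g₀ t x) hzc).trans hgg
  have hzx : ∀ t ∈ Icc (q₁ : ℝ) q₂, ‖z t - sol g₀ x₀ t‖ ≤ K * (1 + H) * ρ := by
    intro t ht
    refine (hstab _ (fun t => z t - sol g₀ x₀ t) _ _ (H * ρ)
      ((hz.integrableOn h0).sub (hx'.integrableOn h0)) (hz.sub_eq hx')
      ((hg.toIsC.integrableOn_comp hp hzc.1).sub
        (hg₀.toIsC.integrableOn_comp hp hzc.1)).norm (fun _ => norm_nonneg _) hint ?_ t ht).trans ?_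
    · filter_upwards [ae_restrict_of_ae hlip] with s hs
      have h1 := hs (z s) (sol g₀ x₀ s)
      have h2 := norm_add_le (g₀ s (ballProj (i + 1) (z s)) - g₀ s (ballProj (i + 1) (sol g₀ x₀ s)))
        (g s (ballProj (i + 1) (z s)) - g₀ s (ballProj (i + 1) (z s)))
      rw [sub_add_sub_comm, add_comm, add_sub_add_right_eq_sub] at h2
      exact h2.trans (add_le_add_left h1 _)
    · rw [mul_assoc]
      gcongr
      linarith
  -- `z` stays within distance `1` of a solution with values in `B_i`, so the truncation is inactive
  have hzi : ∀ t ∈ Icc (q₁ : ℝ) q₂, ‖z t‖ ≤ (i + 1 : ℕ) := fun t ht => by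
    have h1 : K * (1 + H) * ρ ≤ 1 := by
      have h2 : 0 ≤ K * (1 + H) := by positivity
      rw [lt_div_iff₀ (by positivity)] at hρδ
      nlinarith
    have h2 := norm_add_le (z t - sol g₀ x₀ t) (sol g₀ x₀ t)
    rw [sub_add_cancel] at h2
    push_cast
    linarith [hzx t ht, hxi t ht]
  have hz' := hz.of_ballProj ordConnected_Icc h0 hzi
  have heq : EqOn (sol g x₁) z (Icc (q₁ : ℝ) q₂) :=
    (hg.locLip hp).sol_eqOn (subset_univ _) ordConnected_Icc h0 hz'
  refine ⟨hz'.subset_maxInterval ordConnected_Icc h0, curves_congr hzc fun t ht => ?_,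
    fun t ht => ?_⟩
  · rw [heq ht, ballProj_of_norm_le (hzi t ht)]
  · rw [heq ht]; exact hzx t ht

/-- Solutions of linear problems depend on the coefficient, in `L^1`, and on the initial value in a
Lipschitz way, at a fixed solution. -/
theorem exists_linear_stability {a b : ℝ} (h0 : (0 : ℝ) ∈ Icc a b) {A₀ : ℝ → Mat N}
    (hA₀ : IntegrableOn A₀ (Icc a b)) {y₀ : Vec N} {y : ℝ → Vec N}
    (hy : IsSolOn (fun t v => A₀ t v) y₀ (Icc a b) y) :
    ∃ C δ : ℝ, 0 ≤ C ∧ 0 < δ ∧ ∀ (A : ℝ → Mat N) (y₁ : Vec N) (z : ℝ → Vec N) (ρ : ℝ),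
      IntegrableOn A (Icc a b) → IsSolOn (fun t v => A t v) y₁ (Icc a b) z → 0 ≤ ρ → ρ < δ →
      ∫ t in Icc a b, ‖A t - A₀ t‖ ≤ ρ → ‖y₁ - y₀‖ ≤ ρ → ∀ t ∈ Icc a b, ‖z t - y t‖ ≤ C * ρ := by
  obtain ⟨K, hK, hstab⟩ := exists_stability hA₀.norm (fun _ => norm_nonneg _) h0 (Vec N)
  obtain ⟨Y, hY⟩ := isCompact_Icc.exists_bound_of_continuousOn hy.1
  have hY0 : 0 ≤ Y := (norm_nonneg _).trans (hY 0 h0)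
  refine ⟨2 * K * (1 + Y), 1 / (2 * (K + 1)), by positivity, by positivity, ?_⟩
  intro A y₁ z ρ hA hz hρ hρδ hAA hyy
  obtain ⟨τ, hτ, hmax⟩ := isCompact_Icc.exists_isMaxOn ⟨0, h0⟩ (hz.1.sub hy.1).norm
  -- the maximal distance `W` is absorbed, since `W ≤ K ρ (1 + Y) + W / 2`
  set W := ‖z τ - y τ‖
  have hle : ∀ s ∈ Icc a b, ‖z s - y s‖ ≤ W := fun s hs => hmax hs
  have hzb : ∀ s ∈ Icc a b, ‖z s‖ ≤ W + Y := fun s hs => by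
    have h2 := norm_add_le (z s - y s) (y s)
    rw [sub_add_cancel] at h2
    linarith [hle s hs, hY s hs]
  have hW : W ≤ K * (ρ + ρ * (W + Y)) := by
    refine (hstab _ (fun t => z t - y t) _ (fun t => ‖A t - A₀ t‖ * (W + Y)) (ρ * (W + Y))
      ((hz.integrableOn h0).sub (hy.integrableOn h0)) (hz.sub_eq hy)
      ((hA.sub hA₀).norm.mul_const _) (fun s => by positivity) ?_ ?_ τ hτ).trans ?_
    · rw [integral_mul_const]
      gcongr
    · filter_upwards [ae_restrict_mem measurableSet_Icc] with s hs
      have h1 : A s (z s) - A₀ s (y s) = A₀ s (z s - y s) + (A s - A₀ s) (z s) := by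
        simp
      change ‖A s (z s) - A₀ s (y s)‖ ≤ _
      rw [h1]
      exact (norm_add_le _ _).trans (add_le_add ((A₀ s).le_opNorm _)
        ((A s - A₀ s).le_opNorm_of_le (hzb s hs)))
    · gcongr
  have hKρ : K * ρ ≤ 1 / 2 := by
    rw [lt_div_iff₀ (by positivity)] at hρδ
    nlinarith
  have hW0 : 0 ≤ W := norm_nonneg _
  intro t ht
  refine (hle t ht).trans ?_
  nlinarith

/-! ### The first-order expansion of fields in the closure -/

/-- Taylor's formula with the remainder in integral form, as an estimate in `ℝ≥0∞`. -/
theorem enorm_sub_sub_le_lintegral {f : Vec N → Vec N} {J : Vec N → Mat N}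
    (hf : ∀ x, HasFDerivAt f (J x) x) (hJ : Continuous J) (a b : Vec N) :
    ‖f b - f a - J a (b - a)‖ₑ ≤
      (∫⁻ σ in Icc (0 : ℝ) 1, ‖J (a + σ • (b - a)) - J a‖ₑ) * ‖b - a‖ₑ := by
  have hd : ∀ σ : ℝ, HasDerivAt (fun σ : ℝ => f (a + σ • (b - a)) - σ • J a (b - a))
      ((J (a + σ • (b - a)) - J a) (b - a)) σ := fun σ => by
    have h1 : HasDerivAt (fun σ : ℝ => a + σ • (b - a)) (b - a) σ := by
      simpa using ((hasDerivAt_id σ).smul_const (b - a)).const_add a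
    have h2 := (hf (a + σ • (b - a))).comp_hasDerivAt σ h1
    have h3 : HasDerivAt (fun σ : ℝ => σ • J a (b - a)) (J a (b - a)) σ := by
      simpa using (hasDerivAt_id σ).smul_const (J a (b - a))
    exact h2.sub h3
  have hc : Continuous fun σ : ℝ => (J (a + σ • (b - a)) - J a) (b - a) := by fun_prop
  have h1 := intervalIntegral.integral_eq_sub_of_hasDerivAt (a := 0) (b := 1)
    (fun σ _ => hd σ) (hc.intervalIntegrable _ _)
  have h2 : f b - f a - J a (b - a) =
      ∫ σ in Ioc (0 : ℝ) 1, (J (a + σ • (b - a)) - J a) (b - a) := by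
    rw [← intervalIntegral.integral_of_le zero_le_one, h1]
    simp only [one_smul, zero_smul, add_sub_cancel, add_zero, sub_zero]
    abel
  rw [h2, ← lintegral_mul_const' _ _ enorm_ne_top]
  refine (enorm_integral_le_lintegral_enorm _).trans ((lintegral_mono_set Ioc_subset_Icc_self).trans
    (lintegral_mono fun σ => ?_))
  exact ContinuousLinearMap.le_opENorm _ _

theorem exists_continuous_eqOn_Icc {a b : ℝ} (hab : a ≤ b) {x : ℝ → Vec N}
    (hx : ContinuousOn x (Icc a b)) : ∃ z, Continuous z ∧ EqOn z x (Icc a b) :=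
  ⟨IccExtend hab ((Icc a b).domRestrict x), hx.domRestrict.Icc_extend',
    fun _ ht => IccExtend_of_mem hab _ ht⟩

section Remainder

variable {p : ℝ≥0∞} {E : Set (ℝ → Vec N → Vec N)} {g : ℝ → Vec N → Vec N} {G : ℝ → Vec N → Mat N}

/-- The estimate of the remainder of `(g, G)` before the passage to the limit: `(f, J)` is within `ε`
of `(g, G)`, and Tonelli's theorem reduces the remainder of `f` to single segments `σ`. -/
theorem lintegral_remainder_le_of_approx (hp : 1 ≤ p) {q₁ q₂ : ℚ} {j : ℕ}
    (hg : Measurable (Function.uncurry g)) (hG : Measurable (Function.uncurry G))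
    {θ : Moduli} {x y : ℝ → Vec N} (hx : x ∈ curves N θ q₁ q₂ j) (hy : y ∈ curves N θ q₁ q₂ j)
    (hxc : Continuous x) (hyc : Continuous y) {M ω ε : ℝ} (hM : 0 ≤ M) (hω : 0 ≤ ω) (hε : 0 ≤ ε)
    (hxy : ∀ t ∈ Icc (q₁ : ℝ) q₂, ‖y t - x t‖ ≤ M)
    (hGω : ∀ σ ∈ Icc (0 : ℝ) 1, eLpNorm (fun t => G t (x t + σ • (y t - x t)) - G t (x t)) p
      (volume.restrict (Icc (q₁ : ℝ) q₂)) ≤ ENNReal.ofReal ω)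
    {f : ℝ → Vec N → Vec N} {J : ℝ → Vec N → Mat N} (hf : Measurable (Function.uncurry f))
    (hJ : IsSC p J) (hfJ : IsJacobian f J)
    (hfg : thetaSeminorm θ p q₁ q₂ j (fun t x => f t x - g t x) ≤ ENNReal.ofReal ε)
    (hJG : thetaSeminorm θ p q₁ q₂ j (fun t x => J t x - G t x) ≤ ENNReal.ofReal ε) :
    ∫⁻ t in Icc (q₁ : ℝ) q₂, ‖g t (y t) - g t (x t) - G t (x t) (y t - x t)‖ₑ ≤
      ENNReal.ofReal (holderConst p q₁ q₂ * (M * ω + (2 + 3 * M) * ε)) := by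
  set H := holderConst p q₁ q₂
  have hH : 0 ≤ H := holderConst_nonneg p q₁ q₂
  have hcomp : ∀ {E : Type} [NormedAddCommGroup E] [MeasurableSpace E] [BorelSpace E]
      [SecondCountableTopology E] {k h : ℝ → Vec N → E} {z w : ℝ → Vec N},
      Measurable (Function.uncurry k) → Measurable (Function.uncurry h) → Continuous z →
      Continuous w → Measurable fun t => k t (z t) - h t (w t) := fun hk hh hz hw =>
    (hk.comp (measurable_id.prodMk hz.measurable)).sub
      (hh.comp (measurable_id.prodMk hw.measurable))
  have hseg : ∀ σ : ℝ, Continuous fun t => x t + σ • (y t - x t) := fun σ => by fun_prop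
  have hbound : ∀ {E : Type} [NormedAddCommGroup E] [MeasurableSpace E] [BorelSpace E]
      [SecondCountableTopology E] {k : ℝ → E} {c : ℝ}, Measurable k →
      eLpNorm k p (volume.restrict (Icc (q₁ : ℝ) q₂)) ≤ ENNReal.ofReal c →
      ∫⁻ t in Icc (q₁ : ℝ) q₂, ‖k t‖ₑ ≤ ENNReal.ofReal (H * c) := fun hk hc => by
    refine (lintegral_enorm_le_holderConst hp hk.aestronglyMeasurable).trans ?_
    rw [ENNReal.ofReal_mul hH]
    gcongr
  have hfgz : ∀ z, Continuous z → z ∈ curves N θ q₁ q₂ j →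
      ∫⁻ t in Icc (q₁ : ℝ) q₂, ‖f t (z t) - g t (z t)‖ₑ ≤ ENNReal.ofReal (H * ε) :=
    fun z hzc hz => hbound (hcomp hf hg hzc hzc)
      ((eLpNorm_le_thetaSeminorm (fun t x => f t x - g t x) hz).trans hfg)
  have hJGz : ∀ z, Continuous z → z ∈ curves N θ q₁ q₂ j →
      ∫⁻ t in Icc (q₁ : ℝ) q₂, ‖J t (z t) - G t (z t)‖ₑ ≤ ENNReal.ofReal (H * ε) :=
    fun z hzc hz => hbound (hcomp hJ.measurable hG hzc hzc)
      ((eLpNorm_le_thetaSeminorm (fun t x => J t x - G t x) hz).trans hJG)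
  have hJσ : ∀ σ ∈ Icc (0 : ℝ) 1,
      ∫⁻ t in Icc (q₁ : ℝ) q₂, ‖J t (x t + σ • (y t - x t)) - J t (x t)‖ₑ ≤
        ENNReal.ofReal (H * ε + H * ω + H * ε) := fun σ hσ => by
    have h1 := hJGz _ (hseg σ) (convexComb_mem_curves hx hy hσ)
    have h2 := hJGz _ hxc hx
    have h3 := hbound (hcomp hG hG (hseg σ) hxc) (hGω σ hσ)
    have m1 := (hcomp hJ.measurable hG (hseg σ) (hseg σ)).enorm
    have m2 := (hcomp hJ.measurable hG hxc hxc).enorm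
    rw [ENNReal.ofReal_add (by positivity) (by positivity),
      ENNReal.ofReal_add (by positivity) (by positivity)]
    refine le_trans ?_ (add_le_add (add_le_add h1 h3) h2)
    rw [← lintegral_add_left m1, ← lintegral_add_right _ m2]
    refine lintegral_mono fun t => ?_
    have h4 : J t (x t + σ • (y t - x t)) - J t (x t) =
        ((J t (x t + σ • (y t - x t)) - G t (x t + σ • (y t - x t))) +
          (G t (x t + σ • (y t - x t)) - G t (x t))) - (J t (x t) - G t (x t)) := by abel
    beta_reduce
    rw [h4]
    have h5 : ∀ A B C : Mat N, ‖A + B - C‖ₑ ≤ ‖A‖ₑ + ‖B‖ₑ + ‖C‖ₑ := fun A B C =>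
      (enorm_sub_le (a := A + B)).trans (add_le_add_left (enorm_add_le A B) ‖C‖ₑ)
    exact h5 _ _ _
  have hjoint : Measurable fun q : ℝ × ℝ => ‖J q.1 (x q.1 + q.2 • (y q.1 - x q.1)) -
      J q.1 (x q.1)‖ₑ := by
    have h1 : Continuous fun q : ℝ × ℝ => x q.1 + q.2 • (y q.1 - x q.1) := by fun_prop
    have h2 : Continuous fun q : ℝ × ℝ => x q.1 := by fun_prop
    exact ((hJ.measurable.comp (measurable_fst.prodMk h1.measurable)).sub
      (hJ.measurable.comp (measurable_fst.prodMk h2.measurable))).enorm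
  have hlast : ∫⁻ t in Icc (q₁ : ℝ) q₂, ∫⁻ σ in Icc (0 : ℝ) 1,
      ‖J t (x t + σ • (y t - x t)) - J t (x t)‖ₑ ≤ ENNReal.ofReal (H * ε + H * ω + H * ε) := by
    rw [lintegral_lintegral_swap hjoint.aemeasurable]
    refine (lintegral_mono_ae ((ae_restrict_mem measurableSet_Icc).mono hJσ)).trans ?_
    simp
  have m1 := (hcomp hf hg hxc hxc).enorm
  have m2 := (hcomp hf hg hyc hyc).enorm
  have m3 := (hcomp hJ.measurable hG hxc hxc).enorm
  calc ∫⁻ t in Icc (q₁ : ℝ) q₂, ‖g t (y t) - g t (x t) - G t (x t) (y t - x t)‖ₑ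
      ≤ ∫⁻ t in Icc (q₁ : ℝ) q₂, (‖f t (x t) - g t (x t)‖ₑ + (‖f t (y t) - g t (y t)‖ₑ +
          (‖J t (x t) - G t (x t)‖ₑ * ENNReal.ofReal M + (∫⁻ σ in Icc (0 : ℝ) 1,
            ‖J t (x t + σ • (y t - x t)) - J t (x t)‖ₑ) * ENNReal.ofReal M))) := by
        refine lintegral_mono_ae ?_
        filter_upwards [ae_restrict_of_ae hfJ, ae_restrict_of_ae hJ.continuous,
          ae_restrict_mem measurableSet_Icc] with t ht htJ htI
        have h1 := enorm_sub_sub_le_lintegral ht htJ (x t) (y t)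
        have h2 : ‖y t - x t‖ₑ ≤ ENNReal.ofReal M := by
          rw [← ofReal_norm]; exact ENNReal.ofReal_le_ofReal (hxy t htI)
        have h3 : g t (y t) - g t (x t) - G t (x t) (y t - x t) =
            (f t (x t) - g t (x t)) + (-(f t (y t) - g t (y t)) +
              ((J t (x t) - G t (x t)) (y t - x t) +
                (f t (y t) - f t (x t) - J t (x t) (y t - x t)))) := by
          rw [sub_apply]; abel
        rw [h3]
        refine (enorm_add_le _ _).trans (add_le_add_right ((enorm_add_le _ _).trans ?_) _)
        rw [enorm_neg]
        refine add_le_add_right ((enorm_add_le _ _).trans (add_le_add ?_ ?_)) _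
        · exact (ContinuousLinearMap.le_opENorm _ _).trans (by gcongr)
        · exact h1.trans (by gcongr)
    _ ≤ ENNReal.ofReal (H * ε) + (ENNReal.ofReal (H * ε) + (ENNReal.ofReal (H * ε) *
          ENNReal.ofReal M + ENNReal.ofReal (H * ε + H * ω + H * ε) * ENNReal.ofReal M)) := by
        rw [lintegral_add_left m1, lintegral_add_left m2, lintegral_add_left (m3.mul_const _),
          lintegral_mul_const' _ _ ENNReal.ofReal_ne_top,
          lintegral_mul_const' _ _ ENNReal.ofReal_ne_top]
        gcongr
        exacts [hfgz x hxc hx, hfgz y hyc hy, hJGz x hxc hx]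
    _ = _ := by
        rw [← ENNReal.ofReal_mul (by positivity), ← ENNReal.ofReal_mul (by positivity),
          ← ENNReal.ofReal_add (by positivity) (by positivity),
          ← ENNReal.ofReal_add (by positivity) (by positivity),
          ← ENNReal.ofReal_add (by positivity) (by positivity)]
        congr 1
        ring

/-- The pair `(g, G)` inherits from the pairs `(f, J_x f)` the first-order expansion along
admissible curves, with an `L^1` remainder controlled by the oscillation of `G` along the segments
joining the curves. This is all that is left of the identity `G = J_x g`. -/
theorem lintegral_remainder_le (hp : 1 ≤ p) (hLC : ∀ f ∈ E, IsLC p f)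
    (h : (g, G) ∈ linClosure p E) {q₁ q₂ : ℚ} (hq : (q₁ : ℝ) ≤ q₂) {j : ℕ} {x y : ℝ → Vec N}
    (hx : x ∈ curves N (thetaOf E) q₁ q₂ j) (hy : y ∈ curves N (thetaOf E) q₁ q₂ j) {M ω : ℝ}
    (hM : 0 ≤ M) (hω : 0 ≤ ω) (hxy : ∀ t ∈ Icc (q₁ : ℝ) q₂, ‖y t - x t‖ ≤ M)
    (hGω : ∀ σ ∈ Icc (0 : ℝ) 1, eLpNorm (fun t => G t (x t + σ • (y t - x t)) - G t (x t)) p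
      (volume.restrict (Icc (q₁ : ℝ) q₂)) ≤ ENNReal.ofReal ω) :
    ∫⁻ t in Icc (q₁ : ℝ) q₂, ‖g t (y t) - g t (x t) - G t (x t) (y t - x t)‖ₑ ≤
      ENNReal.ofReal (holderConst p q₁ q₂ * (M * ω)) := by
  obtain ⟨x', hx'c, hx'⟩ := exists_continuous_eqOn_Icc hq hx.1
  obtain ⟨y', hy'c, hy'⟩ := exists_continuous_eqOn_Icc hq hy.1
  have hcongr : ∫⁻ t in Icc (q₁ : ℝ) q₂, ‖g t (y t) - g t (x t) - G t (x t) (y t - x t)‖ₑ =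
      ∫⁻ t in Icc (q₁ : ℝ) q₂, ‖g t (y' t) - g t (x' t) - G t (x' t) (y' t - x' t)‖ₑ :=
    setLIntegral_congr_fun measurableSet_Icc fun t ht => by
      beta_reduce
      rw [hx' ht, hy' ht]
  rw [hcongr]
  set H := holderConst p q₁ q₂
  have hlim : Tendsto (fun ε : ℝ => ENNReal.ofReal (H * (M * ω + (2 + 3 * M) * ε)))
      (𝓝[>] 0) (𝓝 (ENNReal.ofReal (H * (M * ω)))) := by
    have h1 : Continuous fun ε : ℝ => ENNReal.ofReal (H * (M * ω + (2 + 3 * M) * ε)) :=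
      ENNReal.continuous_ofReal.comp (by fun_prop)
    simpa using (h1.tendsto 0).mono_left (nhdsWithin_le_nhds (s := Ioi 0))
  refine ge_of_tendsto hlim ?_
  filter_upwards [self_mem_nhdsWithin] with ε (hε : 0 < ε)
  obtain ⟨f, hf, J, hJ, hfJ, h1, h2⟩ := exists_approx_of_mem_linClosure h q₁ q₂ j
    (ENNReal.ofReal_pos.2 hε)
  refine lintegral_remainder_le_of_approx hp h.1.1.measurable h.1.2.measurable
    (curves_congr hx hx') (curves_congr hy hy') hx'c hy'c hM hω hε.le (fun t ht => ?_)
    (fun σ hσ => ?_) (hLC f hf).measurable hJ hfJ h1.le h2.le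
  · rw [hx' ht, hy' ht]; exact hxy t ht
  · refine le_trans (le_of_eq (eLpNorm_congr_ae ?_)) (hGω σ hσ)
    filter_upwards [ae_restrict_mem measurableSet_Icc] with t ht
    rw [hx' ht, hy' ht]

end Remainder

/-! ### Differentiability with respect to the initial value -/

theorem exists_rat_Icc_subset {M : Set ℝ} (hMo : IsOpen M) (hM : M.OrdConnected) {a b : ℝ}
    (h0 : (0 : ℝ) ∈ M) (ha : a ∈ M) (hb : b ∈ M) :
    ∃ q₁ q₂ : ℚ, (q₁ : ℝ) < 0 ∧ (0 : ℝ) < q₂ ∧ (q₁ : ℝ) < a ∧ b < (q₂ : ℝ) ∧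
      Icc (q₁ : ℝ) q₂ ⊆ M := by
  have ha' : min 0 a ∈ M := by rcases min_choice 0 a with h | h <;> rwa [h]
  have hb' : max 0 b ∈ M := by rcases max_choice 0 b with h | h <;> rwa [h]
  obtain ⟨δ₁, hδ₁, h₁⟩ := Metric.isOpen_iff.1 hMo _ ha'
  obtain ⟨δ₂, hδ₂, h₂⟩ := Metric.isOpen_iff.1 hMo _ hb'
  obtain ⟨q₁, hq₁, hq₁'⟩ := exists_rat_btwn (sub_lt_self (min 0 a) hδ₁)
  obtain ⟨q₂, hq₂, hq₂'⟩ := exists_rat_btwn (lt_add_of_pos_right (max 0 b) hδ₂)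
  refine ⟨q₁, q₂, hq₁'.trans_le (min_le_left _ _), (le_max_left _ _).trans_lt hq₂,
    hq₁'.trans_le (min_le_right _ _), (le_max_right _ _).trans_lt hq₂, hM.out (h₁ ?_) (h₂ ?_)⟩
  · rw [Metric.mem_ball, Real.dist_eq, abs_lt]; constructor <;> linarith
  · rw [Metric.mem_ball, Real.dist_eq, abs_lt]; constructor <;> linarith

/-- `G` along the solution is the coefficient of the variational equation: the difference quotient
minus the solution of the linear problem is driven by `ε⁻¹` times the first-order remainder. -/
theorem tendstoUniformlyOn_differenceQuotient {p : ℝ≥0∞} (hp : 1 ≤ p)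
    {E : Set (ℝ → Vec N → Vec N)} (hLC : ∀ f ∈ E, IsLC p f) (hE : EquicontinuousMBounds E)
    {g : ℝ → Vec N → Vec N} {G : ℝ → Vec N → Mat N} (h : (g, G) ∈ linClosure p E) (x₀ : Vec N)
    {q₁ q₂ : ℚ} (h0 : (0 : ℝ) ∈ Icc (q₁ : ℝ) q₂)
    (hsub : Icc (q₁ : ℝ) q₂ ⊆ maxInterval g x₀) :
    (∀ᶠ ε : ℝ in 𝓝[>] 0, ∀ y₀ ∈ Metric.closedBall (0 : Vec N) 1,
      Icc (q₁ : ℝ) q₂ ⊆ maxInterval g (x₀ + ε • y₀)) ∧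
    TendstoUniformlyOn
      (fun (ε : ℝ) (q : ℝ × Vec N) => ε⁻¹ • (sol g (x₀ + ε • q.2) q.1 - sol g x₀ q.1))
      (fun q : ℝ × Vec N => linSol g G x₀ q.2 q.1)
      (𝓝[>] 0) (Icc (q₁ : ℝ) q₂ ×ˢ Metric.closedBall (0 : Vec N) 1) := by
  have hg : IsLC p g := h.1.1
  have hG : IsThetaC (thetaOf E) p G := h.1.2
  have hm := mBounded_of_mem_linClosure hp hE hLC h
  obtain ⟨j, C, δ, hC, hδ, hdep⟩ :=
    exists_continuousDependence hp (thetaOf_nonneg E) hg h0 hsub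
  have hnear : ∀ ε : ℝ, 0 ≤ ε → ε < δ → ∀ y₀ ∈ Metric.closedBall (0 : Vec N) 1,
      Icc (q₁ : ℝ) q₂ ⊆ maxInterval g (x₀ + ε • y₀) ∧
      sol g (x₀ + ε • y₀) ∈ curves N (thetaOf E) q₁ q₂ j ∧
        ∀ t ∈ Icc (q₁ : ℝ) q₂, ‖sol g (x₀ + ε • y₀) t - sol g x₀ t‖ ≤ C * ε := by
    intro ε hε hεδ y₀ hy₀
    refine hdep g _ ε hg hm hε hεδ (by simp only [thetaSeminorm_sub_self, zero_le]) ?_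
    rw [add_sub_cancel_left, norm_smul, Real.norm_of_nonneg hε]
    exact mul_le_of_le_one_right hε (by simpa using hy₀)
  have hlt : ∀ {c : ℝ}, 0 < c → ∀ᶠ ε : ℝ in 𝓝[>] 0, ε < c := fun hc =>
    nhdsWithin_le_nhds (gt_mem_nhds hc)
  refine ⟨?_, ?_⟩
  · filter_upwards [self_mem_nhdsWithin, hlt hδ] with ε (hε : 0 < ε) hεδ y₀ hy₀
    exact (hnear ε hε.le hεδ y₀ hy₀).1
  have hxc : sol g x₀ ∈ curves N (thetaOf E) q₁ q₂ j := by
    simpa using (hnear 0 le_rfl hδ 0 (by simp)).2.1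
  have hA := integrableOn_comp_sol hp hg hG.toIsC x₀ hsub
  obtain ⟨K, hK, hstab⟩ := exists_stability hA.norm (fun _ => norm_nonneg _) h0 (Vec N)
  set H := holderConst p q₁ q₂
  have hH : 0 ≤ H := holderConst_nonneg p q₁ q₂
  refine Metric.tendstoUniformlyOn_iff.2 fun η hη => ?_
  obtain ⟨ω, hω, hωη⟩ : ∃ ω : ℝ, 0 < ω ∧ K * (C * H * ω) < η :=
    ⟨η / (K * C * H + 1), by positivity, by
      rw [← mul_assoc, ← mul_assoc, mul_div_assoc', div_lt_iff₀ (by positivity)]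
      nlinarith⟩
  obtain ⟨δ', hδ', hosc⟩ := hG.exists_delta hxc (ENNReal.ofReal_pos.2 hω)
  filter_upwards [self_mem_nhdsWithin, hlt hδ, hlt (c := δ' / (C + 1)) (by positivity)]
    with ε (hε : 0 < ε) hεδ hεδ'
  rintro ⟨t, y₀⟩ ⟨ht, hy₀⟩
  simp only at ht hy₀ ⊢
  obtain ⟨hsub', hc', hclose⟩ := hnear ε hε.le hεδ y₀ hy₀
  have hCε : C * ε ≤ δ' := by
    rw [lt_div_iff₀ (by positivity)] at hεδ'
    nlinarith
  have hrem := lintegral_remainder_le hp hLC h (h0.1.trans h0.2) hxc hc' (M := C * ε) (ω := ω)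
    (by positivity) hω.le hclose fun σ hσ => by
      refine (hosc _ (convexComb_mem_curves hxc hc' hσ) fun s hs => ?_).le
      rw [add_sub_cancel_left, norm_smul, Real.norm_of_nonneg hσ.1]
      exact (mul_le_of_le_one_left (norm_nonneg _) hσ.2).trans ((hclose s hs).trans hCε)
  set xε := sol g (x₀ + ε • y₀)
  set x := sol g x₀
  have hx := (hg.isSolOn_sol hp x₀).mono hsub
  have hxε := (hg.isSolOn_sol hp (x₀ + ε • y₀)).mono hsub'
  have hy := (isUniqueSolOn_linSol hp hg hG.toIsC x₀ y₀).1.mono hsub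
  set y := linSol g G x₀ y₀
  have hdiff : IntegrableOn (fun s => g s (xε s) - g s (x s)) (Icc (q₁ : ℝ) q₂) :=
    (hxε.integrableOn h0).sub (hx.integrableOn h0)
  have hGd : IntegrableOn (fun s => G s (x s) (xε s - x s)) (Icc (q₁ : ℝ) q₂) := by
    obtain ⟨D, hD⟩ := isCompact_Icc.exists_bound_of_continuousOn (hxε.1.sub hx.1)
    refine (hA.norm.mul_const D).mono' ((ContinuousLinearMap.id ℝ (Mat N)).aestronglyMeasurable_comp₂
      hA.1 ((hxε.1.sub hx.1).aestronglyMeasurable measurableSet_Icc)) ?_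
    filter_upwards [ae_restrict_mem measurableSet_Icc] with s hs
    exact (G s (x s)).le_opNorm_of_le (hD s hs)
  have hR : IntegrableOn (fun s => g s (xε s) - g s (x s) - G s (x s) (xε s - x s))
      (Icc (q₁ : ℝ) q₂) := hdiff.sub hGd
  have hRle : ∫ s in Icc (q₁ : ℝ) q₂, ‖ε⁻¹ • (g s (xε s) - g s (x s) -
      G s (x s) (xε s - x s))‖ ≤ C * H * ω := by
    have h1 := integral_norm_le_of_lintegral (by positivity) hR.1 hrem
    simp only [norm_smul, integral_const_mul, norm_inv, Real.norm_of_nonneg hε.le]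
    calc _ ≤ ε⁻¹ * (H * (C * ε * ω)) := by gcongr
      _ = _ := by field_simp
  have hφ : IntegrableOn (fun s => ε⁻¹ • (g s (xε s) - g s (x s)) - G s (x s) (y s))
      (Icc (q₁ : ℝ) q₂) := (hdiff.smul ε⁻¹).sub (hy.integrableOn h0)
  have hw : ∀ t ∈ Icc (q₁ : ℝ) q₂, ε⁻¹ • (xε t - x t) - y t =
      0 + ∫ s in (0 : ℝ)..t, (ε⁻¹ • (g s (xε s) - g s (x s)) - G s (x s) (y s)) := by
    intro t ht
    have h1 := hxε.sub_eq hx t ht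
    have h2 : IntervalIntegrable (fun s => G s (x s) (y s)) volume 0 t ∧
        y t = y₀ + ∫ s in (0 : ℝ)..t, G s (x s) (y s) := hy.2 t ht
    have h3 : IntervalIntegrable (fun s => ε⁻¹ • (g s (xε s) - g s (x s))) volume 0 t :=
      ((hxε.2 t ht).1.sub (hx.2 t ht).1).smul ε⁻¹
    rw [intervalIntegral.integral_sub h3 h2.1, intervalIntegral.integral_smul, h1, h2.2, add_sub_cancel_left, smul_add, smul_smul,
      inv_mul_cancel₀ hε.ne', one_smul]
    abel
  have hfin := hstab _ (fun t => ε⁻¹ • (xε t - x t) - y t) 0 _ (C * H * ω) hφ hw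
    (hR.smul ε⁻¹).norm (fun _ => norm_nonneg _) hRle (Eventually.of_forall fun s => by
      have h1 : ε⁻¹ • (g s (xε s) - g s (x s)) - G s (x s) (y s) =
          G s (x s) (ε⁻¹ • (xε s - x s) - y s) +
            ε⁻¹ • (g s (xε s) - g s (x s) - G s (x s) (xε s - x s)) := by
        rw [map_sub, map_smul]
        module
      rw [h1]
      exact (norm_add_le _ _).trans (add_le_add_left ((G s (x s)).le_opNorm _) _)) t ht
  rw [norm_zero, zero_add] at hfin
  rw [dist_comm, dist_eq_norm]
  exact hfin.trans_lt hωη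

/-! ### Time translation of fields and solutions -/

section Translate

variable {F : Type*} [NormedAddCommGroup F] {p : ℝ≥0∞}

theorem ae_translate {P : ℝ → Prop} (h : ∀ᵐ t : ℝ, P t) (τ : ℝ) : ∀ᵐ t : ℝ, P (t + τ) :=
  (measurePreserving_add_right volume τ).quasiMeasurePreserving.ae h

theorem map_add_right_restrict_Icc (τ a b : ℝ) :
    Measure.map (fun t => t + τ) (volume.restrict (Icc a b)) =
      volume.restrict (Icc (a + τ) (b + τ)) := by
  have h := ((measurePreserving_add_right volume τ).restrict_preimage
    (measurableSet_Icc (a := a + τ) (b := b + τ))).map_eq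
  simpa using h

theorem eLpNorm_translate (φ : ℝ → F) (τ a b : ℝ) :
    eLpNorm (fun t => φ (t + τ)) p (volume.restrict (Icc a b)) =
      eLpNorm φ p (volume.restrict (Icc (a + τ) (b + τ))) := by
  rw [← map_add_right_restrict_Icc, (measurableEmbedding_addRight τ).eLpNorm_map_measure]
  rfl

theorem LpLoc.translate {m : ℝ → ℝ} (hm : LpLoc p m) (τ : ℝ) : LpLoc p fun t => m (t + τ) :=
  fun a b => by
    have h := hm (a + τ) (b + τ)
    rw [← map_add_right_restrict_Icc, (measurableEmbedding_addRight τ).memLp_map_measure_iff] at h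
    exact h

theorem measurable_translate {F : Type*} [MeasurableSpace F] {f : ℝ → Vec N → F} (hf : Measurable (Function.uncurry f)) (τ : ℝ) :
    Measurable (Function.uncurry (translate τ f)) :=
  hf.comp ((measurable_fst.add_const τ).prodMk measurable_snd)

variable [MeasurableSpace F]

theorem IsC.translate {f : ℝ → Vec N → F} (hf : IsC p f) (τ : ℝ) : IsC p (translate τ f) :=
  ⟨measurable_translate hf.measurable τ, fun K hK => by
    obtain ⟨m, hm, h⟩ := hf.mbound K hK
    exact ⟨_, hm.translate τ, ae_translate h τ⟩⟩

theorem IsLC.translate {f : ℝ → Vec N → F} (hf : IsLC p f) (τ : ℝ) : IsLC p (translate τ f) :=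
  ⟨hf.toIsC.translate τ, fun K hK => by
    obtain ⟨m, hm, h⟩ := hf.lbound K hK
    exact ⟨_, hm.translate τ, ae_translate h τ⟩⟩

theorem IsSC.translate {f : ℝ → Vec N → F} (hf : IsSC p f) (τ : ℝ) : IsSC p (translate τ f) :=
  ⟨hf.toIsC.translate τ, ae_translate hf.continuous τ⟩

end Translate

theorem IsJacobian.translate {f : ℝ → Vec N → Vec N} {J : ℝ → Vec N → Mat N}
    (h : IsJacobian f J) (τ : ℝ) : IsJacobian (translate τ f) (translate τ J) :=
  ae_translate h τ

theorem translate_zero {F : Type*} (f : ℝ → Vec N → F) : translate 0 f = f := by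
  funext t x; simp [translate]

theorem translate_translate {F : Type*} (f : ℝ → Vec N → F) (s t : ℝ) :
    translate t (translate s f) = translate (s + t) f := by
  funext u x; simp [translate, add_assoc, add_comm t s]

theorem IsSolOn.translate {F : ℝ → Vec N → Vec N} {x₀ : Vec N} {M : Set ℝ}
    {x : ℝ → Vec N} (hx : IsSolOn F x₀ M x) {s : ℝ} (hs : s ∈ M) :
    IsSolOn (translate s F) (x s) ((fun t => t + s) ⁻¹' M) fun t => x (t + s) := by
  refine ⟨hx.1.comp (by fun_prop) fun t ht => ht, fun t ht => ?_⟩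
  have h1 := (hx.2 s hs).1.symm.trans (hx.2 (t + s) ht).1
  refine ⟨by simpa [Caratheodory.translate] using h1.comp_add_right s, ?_⟩
  have h2 := intervalIntegral.integral_comp_add_right (a := 0) (b := t) (fun u => F u (x u)) s
  have h3 := intervalIntegral.integral_add_adjacent_intervals (hx.2 s hs).1 h1
  simp only [Caratheodory.translate]
  rw [h2, zero_add, (hx.2 (t + s) ht).2, ← h3]
  linear_combination (norm := module) -(hx.2 s hs).2

theorem IsSolOn.congr_field {F F' : ℝ → Vec N → Vec N} {x₀ : Vec N} {J : Set ℝ} {x : ℝ → Vec N}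
    (hx : IsSolOn F x₀ J x) (hJ : J.OrdConnected) (h0 : (0 : ℝ) ∈ J)
    (h : ∀ t ∈ J, F t (x t) = F' t (x t)) : IsSolOn F' x₀ J x := by
  have heq : ∀ t ∈ J, EqOn (fun s => F s (x s)) (fun s => F' s (x s)) (uIcc 0 t) :=
    fun t ht s hs => h s (uIcc_zero_subset hJ h0 ht hs)
  refine ⟨hx.1, fun t ht => ⟨(hx.2 t ht).1.congr ((heq t ht).mono uIoc_subset_uIcc), ?_⟩⟩
  rw [← intervalIntegral.integral_congr (heq t ht)]
  exact (hx.2 t ht).2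

theorem ordConnected_preimage_add {M : Set ℝ} (hM : M.OrdConnected) (s : ℝ) :
    ((fun t => t + s) ⁻¹' M).OrdConnected :=
  hM.preimage_mono fun _ _ h => add_le_add_left h s

section Cocycle

variable {p : ℝ≥0∞} {g : ℝ → Vec N → Vec N} {G : ℝ → Vec N → Mat N} {x₀ : Vec N} {s t : ℝ}

theorem sol_translate (hp : 1 ≤ p) (hg : IsLC p g) (hs : s ∈ maxInterval g x₀)
    (ht : t + s ∈ maxInterval g x₀) :
    t ∈ maxInterval (translate s g) (sol g x₀ s) ∧
      sol (translate s g) (sol g x₀ s) t = sol g x₀ (t + s) := by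
  have h1 := (hg.isSolOn_sol hp x₀).translate hs
  have h2 := ordConnected_preimage_add (ordConnected_maxInterval g x₀) s
  have h3 : (0 : ℝ) ∈ (fun t => t + s) ⁻¹' maxInterval g x₀ := by simpa using hs
  exact ⟨h1.subset_maxInterval h2 h3 ht,
    ((hg.translate s).locLip hp).sol_eqOn (subset_univ _) h2 h3 h1 ht⟩

/-- The maximal interval is translated along with the field. The nontrivial inclusion is the
trivial one for the translated problem, translated back. -/
theorem mem_maxInterval_translate_iff (hp : 1 ≤ p) (hg : IsLC p g)
    (hs : s ∈ maxInterval g x₀) :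
    t ∈ maxInterval (translate s g) (sol g x₀ s) ↔ t + s ∈ maxInterval g x₀ := by
  refine ⟨fun ht => ?_, fun ht => (sol_translate hp hg hs ht).1⟩
  have h1 := sol_translate hp hg (t := -s) hs (by
    rw [neg_add_cancel]; exact zero_mem_maxInterval _ _)
  rw [neg_add_cancel, sol_zero] at h1
  have h2 := sol_translate hp (hg.translate s) (t := t + s) h1.1 (by simpa using ht)
  rw [translate_translate, add_neg_cancel, translate_zero, h1.2] at h2
  exact h2.1

theorem linSol_translate (hp : 1 ≤ p) (hg : IsLC p g) (hG : IsC p G)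
    (hs : s ∈ maxInterval g x₀) (ht : t + s ∈ maxInterval g x₀) (y₀ : Vec N) :
    linSol (translate s g) (translate s G) (sol g x₀ s) (linSol g G x₀ y₀ s) t =
      linSol g G x₀ y₀ (t + s) := by
  have h1 := (isUniqueSolOn_linSol hp hg hG x₀ y₀).1.translate hs
  have h2 := ordConnected_preimage_add (ordConnected_maxInterval g x₀) s
  have h3 : (0 : ℝ) ∈ (fun t => t + s) ⁻¹' maxInterval g x₀ := by simpa using hs
  have h4 : IsSolOn (linField (translate s g) (translate s G) (sol g x₀ s)) (linSol g G x₀ y₀ s)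
      ((fun t => t + s) ⁻¹' maxInterval g x₀) fun t => linSol g G x₀ y₀ (t + s) :=
    h1.congr_field h2 h3 fun u hu => by
      simp only [translate, linField]
      rw [← (sol_translate hp hg hs hu).2]
  exact (locLip_linField hp (hg.translate s) (hG.translate s) _).sol_eqOn
    (fun u hu => (sol_translate hp hg hs hu).1) h2 h3 h4 ht

end Cocycle

/-! ### Moduli of an orbit -/

section Orbit

variable {f : ℝ → Vec N → Vec N}

theorem lintegral_optMBound_translate (f : ℝ → Vec N → Vec N) (j : ℕ) (τ a b : ℝ) :
    ∫⁻ u in Icc a b, optMBound (translate τ f) j u =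
      ∫⁻ u in Icc (a + τ) (b + τ), optMBound f j u := by
  rw [← map_add_right_restrict_Icc, (measurableEmbedding_addRight τ).lintegral_map]
  rfl

/-- The moduli of an orbit do not depend on the interval. -/
theorem iSup_lintegral_orbit {q₁ q₂ : ℚ} (hq : (q₁ : ℝ) ≤ q₂) (j : ℕ) (s : ℝ) :
    (⨆ t ∈ Icc (q₁ : ℝ) q₂, ⨆ h ∈ orbit f, ∫⁻ u in Icc t (t + s), optMBound h j u) =
      ⨆ τ : ℝ, ∫⁻ u in Icc τ (τ + s), optMBound f j u := by
  simp only [orbit, iSup_range, lintegral_optMBound_translate]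
  refine le_antisymm (iSup₂_le fun t _ => iSup_le fun τ => ?_) (iSup_le fun τ => ?_)
  · refine le_iSup_of_le (t + τ) (le_of_eq ?_)
    rw [add_right_comm]
  · refine le_iSup₂_of_le (q₁ : ℝ) ⟨le_rfl, hq⟩ (le_iSup_of_le (τ - q₁) (le_of_eq ?_))
    rw [add_sub_cancel, add_right_comm, add_sub_cancel]

theorem thetaOf_orbit_mono (hf : EquicontinuousMBounds (orbit f)) {q₁ q₂ r₁ r₂ : ℚ}
    (hq : (q₁ : ℝ) ≤ q₂) (hr : (r₁ : ℝ) ≤ r₂) (j : ℕ) {s t : ℝ} (hst : s ≤ t) :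
    thetaOf (orbit f) q₁ q₂ j s ≤ thetaOf (orbit f) r₁ r₂ j t := by
  refine ENNReal.toReal_mono (iSup_lintegral_optMBound_ne_top hf r₁ r₂ j t) ?_
  rw [iSup_lintegral_orbit hq, iSup_lintegral_orbit hr]
  exact iSup_mono fun τ => lintegral_mono_set (Icc_subset_Icc_right (by linarith))

theorem exists_thetaOf_le {E : Set (ℝ → Vec N → Vec N)} (hE : EquicontinuousMBounds E)
    (q₁ q₂ : ℚ) (j : ℕ) {ε : ℝ} (hε : 0 < ε) :
    ∃ δ > 0, ∀ s, 0 ≤ s → s < δ → thetaOf E q₁ q₂ j s ≤ ε := by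
  obtain ⟨δ, hδ, h⟩ := hE j (|(q₁ : ℝ)| + |(q₂ : ℝ)| + 1) ε (by positivity) hε
  refine ⟨min δ 1, by positivity, fun s hs0 hs => ENNReal.toReal_le_of_le_ofReal hε.le ?_⟩
  have h1 := hs.trans_le (min_le_left _ _)
  have h2 := hs.trans_le (min_le_right _ _)
  refine iSup₂_le fun t ht => (h t (t + s) ?_ (by linarith) ?_ (by linarith)).le
  · linarith [ht.1, neg_abs_le (q₁ : ℝ), abs_nonneg (q₂ : ℝ)]
  · linarith [ht.2, le_abs_self (q₂ : ℝ), abs_nonneg (q₁ : ℝ)]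

/-- The curve `t ↦ x(t - τ)`, continued to `ℝ` by constants outside `[a + τ, b + τ]`. -/
noncomputable def shiftCurve {a b : ℝ} (h : a ≤ b) (τ : ℝ) (x : ℝ → Vec N) : ℝ → Vec N :=
  fun t => x (projIcc a b h (t - τ))

theorem shiftCurve_add {a b : ℝ} (h : a ≤ b) (τ : ℝ) (x : ℝ → Vec N) {t : ℝ} (ht : t ∈ Icc a b) :
    shiftCurve h τ x (t + τ) = x t := by
  rw [shiftCurve, add_sub_cancel_right, projIcc_of_mem h ht]

theorem continuous_shiftCurve {a b : ℝ} (h : a ≤ b) (τ : ℝ) {x : ℝ → Vec N}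
    (hx : ContinuousOn x (Icc a b)) : Continuous (shiftCurve h τ x) :=
  hx.comp_continuous (by fun_prop) fun t => (projIcc a b h (t - τ)).2

theorem abs_projIcc_sub_le {a b : ℝ} (h : a ≤ b) (s t : ℝ) :
    |(projIcc a b h s : ℝ) - projIcc a b h t| ≤ |s - t| := by
  simpa [Real.dist_eq, Subtype.dist_eq] using (LipschitzWith.projIcc h).dist_le_mul s t

/-- Translation and constant extension preserve admissibility, because the moduli of an orbit are
monotone and do not depend on the interval. -/
theorem shiftCurve_mem_curves (hf : EquicontinuousMBounds (orbit f)) {q₁ q₂ r₁ r₂ : ℚ} {j : ℕ}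
    (hq : (q₁ : ℝ) ≤ q₂) (hr : (r₁ : ℝ) ≤ r₂) (τ : ℝ) {x : ℝ → Vec N}
    (hx : x ∈ curves N (thetaOf (orbit f)) q₁ q₂ j) :
    shiftCurve hq τ x ∈ curves N (thetaOf (orbit f)) r₁ r₂ j := by
  refine ⟨(continuous_shiftCurve hq τ hx.1).continuousOn,
    fun t _ => hx.2.1 _ (projIcc _ _ hq (t - τ)).2, fun s _ t _ => ?_⟩
  refine (hx.2.2 _ (projIcc _ _ hq (s - τ)).2 _ (projIcc _ _ hq (t - τ)).2).trans
    (thetaOf_orbit_mono hf hq hr j ((abs_projIcc_sub_le hq _ _).trans ?_))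
  rw [sub_sub_sub_cancel_right]

theorem thetaSeminorm_translate_le {F : Type*} [NormedAddCommGroup F]
    {p : ℝ≥0∞} (hf : EquicontinuousMBounds (orbit f)) {q₁ q₂ r₁ r₂ : ℚ} (j : ℕ) {τ : ℝ}
    (h₁ : (r₁ : ℝ) ≤ q₁ + τ) (h₂ : (q₂ : ℝ) + τ ≤ r₂) (h : ℝ → Vec N → F) :
    thetaSeminorm (thetaOf (orbit f)) p q₁ q₂ j (translate τ h) ≤
      thetaSeminorm (thetaOf (orbit f)) p r₁ r₂ j h := by
  rcases lt_or_ge (q₂ : ℝ) q₁ with hq | hq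
  · simp [thetaSeminorm, Icc_eq_empty hq.not_ge]
  refine iSup₂_le fun x hx => ?_
  have h1 : eLpNorm (fun t => translate τ h t (x t)) p (volume.restrict (Icc (q₁ : ℝ) q₂)) =
      eLpNorm (fun t => h t (shiftCurve hq τ x t)) p
        (volume.restrict (Icc ((q₁ : ℝ) + τ) (q₂ + τ))) := by
    rw [← eLpNorm_translate]
    refine eLpNorm_congr_ae ?_
    filter_upwards [ae_restrict_mem measurableSet_Icc] with t ht
    rw [shiftCurve_add hq τ x ht]
    rfl
  rw [h1]
  exact (eLpNorm_mono_measure _ (Measure.restrict_mono_set _ (Icc_subset_Icc h₁ h₂))).trans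
    (eLpNorm_le_thetaSeminorm h (shiftCurve_mem_curves hf hq (by linarith) τ hx))

/-- Arzelà–Ascoli for the sets of admissible curves. -/
theorem exists_subseq_curves {E : Set (ℝ → Vec N → Vec N)} (hE : EquicontinuousMBounds E)
    {q₁ q₂ : ℚ} {j : ℕ} {u : ℕ → ℝ → Vec N} (hu : ∀ n, u n ∈ curves N (thetaOf E) q₁ q₂ j) :
    ∃ x ∈ curves N (thetaOf E) q₁ q₂ j, ∃ φ : ℕ → ℕ, StrictMono φ ∧
      TendstoUniformlyOn (fun n => u (φ n)) x atTop (Icc (q₁ : ℝ) q₂) := by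
  let I := Icc (q₁ : ℝ) q₂
  let A : Set (BoundedContinuousFunction I (Vec N)) := {z | (∀ t, ‖z t‖ ≤ j) ∧
    ∀ s t : I, ‖z t - z s‖ ≤ thetaOf E q₁ q₂ j |(t : ℝ) - s|}
  have hA : IsCompact A := by
    refine BoundedContinuousFunction.arzela_ascoli₂ (Metric.closedBall 0 j)
      (isCompact_closedBall _ _) A ?_ (fun z t hz => by simpa using hz.1 t) ?_
    · have h1 : ∀ t : I, Continuous fun z : BoundedContinuousFunction I (Vec N) => z t :=
        fun t => continuous_eval_const t
      have h2 : A = (⋂ t, {z | ‖z t‖ ≤ j}) ∩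
          ⋂ s : I, ⋂ t : I, {z | ‖z t - z s‖ ≤ thetaOf E q₁ q₂ j |(t : ℝ) - s|} := by
        ext z; simp [A]
      rw [h2]
      exact (isClosed_iInter fun t => isClosed_le (h1 t).norm continuous_const).inter
        (isClosed_iInter fun s => isClosed_iInter fun t =>
          isClosed_le ((h1 t).sub (h1 s)).norm continuous_const)
    · refine fun t => Metric.equicontinuousAt_iff.2 fun ε hε => ?_
      obtain ⟨δ, hδ, h⟩ := exists_thetaOf_le hE q₁ q₂ j (half_pos hε)
      refine ⟨δ, hδ, fun s hs z => ?_⟩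
      rw [dist_eq_norm]
      rw [Subtype.dist_eq, dist_comm, Real.dist_eq] at hs
      exact ((z.2.2 s t).trans (h _ (abs_nonneg _) hs)).trans_lt (half_lt_self hε)
  let v : ℕ → BoundedContinuousFunction I (Vec N) := fun n =>
    BoundedContinuousFunction.mkOfCompact ⟨I.domRestrict (u n), (hu n).1.domRestrict⟩
  obtain ⟨z, hz, φ, hφ, hlim⟩ := hA.tendsto_subseq (x := v) fun n =>
    ⟨fun t => (hu n).2.1 t t.2, fun s t => (hu n).2.2 s s.2 t t.2⟩
  let x : ℝ → Vec N := Function.extend Subtype.val z 0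
  have hx : ∀ t : I, x t = z t := fun t => Subtype.val_injective.extend_apply _ _ _
  refine ⟨x, ⟨?_, fun t ht => ?_, fun s hs t ht => ?_⟩, φ, hφ, ?_⟩
  · rw [continuousOn_iff_continuous_domRestrict]
    exact z.continuous.congr fun t => (hx t).symm
  · rw [hx ⟨t, ht⟩]; exact hz.1 _
  · rw [hx ⟨t, ht⟩, hx ⟨s, hs⟩]; exact hz.2 _ _
  · refine Metric.tendstoUniformlyOn_iff.2 fun ε hε => ?_
    filter_upwards [Metric.tendsto_nhds.1 hlim ε hε] with n hn t ht
    rw [hx ⟨t, ht⟩, dist_comm]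
    exact (BoundedContinuousFunction.dist_coe_le_dist (f := v (φ n)) ⟨t, ht⟩).trans_lt hn

end Orbit

/-! ### Continuity of time translation -/

/-- Translation is continuous in `L^p_loc`, for `p < ∞`. -/
theorem tendsto_eLpNorm_translate_sub {F : Type*} [NormedAddCommGroup F] {p : ℝ≥0∞}
    (hp₁ : 1 ≤ p) (hp : p ≠ ∞) {φ : ℝ → F} {a b a' b' τ₀ : ℝ}
    (hφ : MemLp φ p (volume.restrict (Icc a' b'))) (ha : a' < a + τ₀) (hb : b + τ₀ < b') :
    Tendsto (fun τ => eLpNorm (fun t => φ (t + τ) - φ (t + τ₀)) p (volume.restrict (Icc a b)))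
      (𝓝 τ₀) (𝓝 0) := by
  have : Fact (1 ≤ p) := ⟨hp₁⟩
  have : Fact (p ≠ ∞) := ⟨hp⟩
  -- the continuous action of `ℝ` on `L^p(ℝ)`, applied to the extension of `φ` by zero
  have hψ : MemLp ((Icc a' b').indicator φ) p volume :=
    (memLp_indicator_iff_restrict measurableSet_Icc).2 hφ
  have h1 : Continuous fun τ : ℝ => DomAddAct.mk τ +ᵥ hψ.toLp :=
    DomAddAct.continuous_mk.vadd continuous_const
  have h2 : Tendsto (fun τ : ℝ => edist (DomAddAct.mk τ +ᵥ hψ.toLp)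
      (DomAddAct.mk τ₀ +ᵥ hψ.toLp)) (𝓝 τ₀) (𝓝 0) := by
    have := (h1.tendsto τ₀).edist (tendsto_const_nhds (x := DomAddAct.mk τ₀ +ᵥ hψ.toLp))
    rwa [edist_self] at this
  refine tendsto_of_tendsto_of_tendsto_of_le_of_le' tendsto_const_nhds h2
    (Eventually.of_forall fun _ => zero_le) ?_
  filter_upwards [(continuous_const.add continuous_id).tendsto τ₀ (lt_mem_nhds ha),
    (continuous_const.add continuous_id).tendsto τ₀ (gt_mem_nhds hb)] with τ hτa hτb
  simp only [Pi.add_apply, id_eq, mem_preimage, mem_ofPred_eq] at hτa hτb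
  rw [DomAddAct.mk_vadd_toLp, DomAddAct.mk_vadd_toLp, Lp.edist_toLp_toLp]
  refine le_trans (le_of_eq (eLpNorm_congr_ae ?_))
    (eLpNorm_mono_measure _ Measure.restrict_le_self)
  filter_upwards [ae_restrict_mem measurableSet_Icc] with t ht
  have h3 : τ + t ∈ Icc a' b' := ⟨by linarith [ht.1], by linarith [ht.2]⟩
  have h4 : τ₀ + t ∈ Icc a' b' := ⟨by linarith [ht.1], by linarith [ht.2]⟩
  simp only [Pi.sub_apply, vadd_eq_add, indicator_of_mem h3, indicator_of_mem h4, add_comm t]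

section Continuity

variable {f : ℝ → Vec N → Vec N} {p : ℝ≥0∞} {F : Type*} [NormedAddCommGroup F]
  [MeasurableSpace F]

/-- A rational interval which contains `[q₁, q₂] + τ` for all `τ` near `τ₀`. -/
theorem exists_rat_window (q₁ q₂ : ℚ) (τ₀ : ℝ) : ∃ r₁ r₂ : ℚ,
    (r₁ : ℝ) < q₁ + (τ₀ - 1) ∧ (q₂ : ℝ) + (τ₀ + 1) < r₂ := by
  obtain ⟨r₁, h₁⟩ := exists_rat_lt ((q₁ : ℝ) + (τ₀ - 1))
  obtain ⟨r₂, h₂⟩ := exists_rat_gt ((q₂ : ℝ) + (τ₀ + 1))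
  exact ⟨r₁, r₂, h₁, h₂⟩

theorem tendstoUniformlyOn_shiftCurve {a b : ℝ} (h : a ≤ b) {u : ℕ → ℝ → Vec N} {x : ℝ → Vec N}
    {τ : ℕ → ℝ} {τ₀ : ℝ} (hx : ContinuousOn x (Icc a b))
    (hu : TendstoUniformlyOn u x atTop (Icc a b)) (hτ : Tendsto τ atTop (𝓝 τ₀)) (s : Set ℝ) :
    TendstoUniformlyOn (fun n => shiftCurve h (τ n) (u n)) (shiftCurve h τ₀ x) atTop s := by
  refine Metric.tendstoUniformlyOn_iff.2 fun ε hε => ?_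
  obtain ⟨δ, hδ, huc⟩ := Metric.uniformContinuousOn_iff.1
    (isCompact_Icc.uniformContinuousOn_of_continuous hx) (ε / 2) (half_pos hε)
  filter_upwards [Metric.tendstoUniformlyOn_iff.1 hu (ε / 2) (half_pos hε),
    Metric.tendsto_nhds.1 hτ δ hδ] with n hn hτn t _
  have h1 := huc _ (projIcc a b h (t - τ₀)).2 _ (projIcc a b h (t - τ n)).2 (by
    rw [Real.dist_eq]
    refine (abs_projIcc_sub_le h _ _).trans_lt ?_
    rwa [sub_sub_sub_cancel_left, ← Real.dist_eq])
  have h2 := hn _ (projIcc a b h (t - τ n)).2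
  exact (dist_triangle _ (x (projIcc a b h (t - τ n))) _).trans_lt
    ((add_lt_add h1 h2).trans_eq (add_halves ε))

theorem IsThetaC.translate (hf : EquicontinuousMBounds (orbit f)) {h : ℝ → Vec N → F}
    (hh : IsThetaC (thetaOf (orbit f)) p h) (τ : ℝ) :
    IsThetaC (thetaOf (orbit f)) p (translate τ h) := by
  refine ⟨hh.toIsC.translate τ, fun q₁ q₂ j u x hu hx hlim => ?_⟩
  rcases lt_or_ge (q₂ : ℝ) q₁ with hq | hq
  · simp [Icc_eq_empty hq.not_ge]
  obtain ⟨r₁, r₂, hr₁, hr₂⟩ := exists_rat_window q₁ q₂ τ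
  have hr : (r₁ : ℝ) ≤ r₂ := by linarith
  have h1 := hh.tendsto r₁ r₂ j (fun n => shiftCurve hq τ (u n)) (shiftCurve hq τ x)
    (fun n => shiftCurve_mem_curves hf hq hr τ (hu n)) (shiftCurve_mem_curves hf hq hr τ hx)
    (tendstoUniformlyOn_shiftCurve hq hx.1 hlim tendsto_const_nhds _)
  refine tendsto_of_tendsto_of_tendsto_of_le_of_le tendsto_const_nhds h1
    (fun _ => zero_le) fun n => ?_
  have h2 : eLpNorm (fun t => Caratheodory.translate τ h t (u n t) -
      Caratheodory.translate τ h t (x t)) p (volume.restrict (Icc (q₁ : ℝ) q₂)) =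
      eLpNorm (fun t => h t (shiftCurve hq τ (u n) t) - h t (shiftCurve hq τ x t)) p
        (volume.restrict (Icc ((q₁ : ℝ) + τ) (q₂ + τ))) := by
    rw [← eLpNorm_translate]
    refine eLpNorm_congr_ae ?_
    filter_upwards [ae_restrict_mem measurableSet_Icc] with t ht
    rw [shiftCurve_add hq τ _ ht, shiftCurve_add hq τ _ ht]
    rfl
  beta_reduce
  rw [h2]
  exact eLpNorm_mono_measure _ (Measure.restrict_mono_set _
    (Icc_subset_Icc (by linarith) (by linarith)))

variable [BorelSpace F] [SecondCountableTopology F]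

/-- Orbits in `Θℭ` are continuous: along a convergent sequence of curves this is the defining
property of `Θℭ` together with continuity of translation in `L^p`, and Arzelà–Ascoli makes it
uniform in the curve. -/
theorem eventually_thetaSeminorm_translate_sub_lt (hp₁ : 1 ≤ p) (hp : p ≠ ∞)
    (hf : EquicontinuousMBounds (orbit f)) {h : ℝ → Vec N → F}
    (hh : IsThetaC (thetaOf (orbit f)) p h) (τ₀ : ℝ) (q₁ q₂ : ℚ) (j : ℕ) {ε : ℝ≥0∞}
    (hε : 0 < ε) : ∀ᶠ τ in 𝓝 τ₀, thetaSeminorm (thetaOf (orbit f)) p q₁ q₂ j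
      (fun t x => translate τ h t x - translate τ₀ h t x) < ε := by
  rcases lt_or_ge (q₂ : ℝ) q₁ with hq | hq
  · exact Eventually.of_forall fun τ => by simpa [thetaSeminorm, Icc_eq_empty hq.not_ge] using hε
  by_contra hcon
  obtain ⟨τ, hτ, hle⟩ := exists_seq_forall_of_frequently (not_eventually.1 hcon)
  obtain ⟨ε', hε', hε'ε⟩ := exists_between hε
  have hex : ∀ n, ∃ x ∈ curves N (thetaOf (orbit f)) q₁ q₂ j, ε' < eLpNorm (fun t =>
      translate (τ n) h t (x t) - translate τ₀ h t (x t)) p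
        (volume.restrict (Icc (q₁ : ℝ) q₂)) := fun n => by
    have := hε'ε.trans_le (not_lt.1 (hle n))
    rw [thetaSeminorm] at this
    obtain ⟨x, hx⟩ := lt_iSup_iff.1 this
    obtain ⟨hxc, hx⟩ := lt_iSup_iff.1 hx
    exact ⟨x, hxc, hx⟩
  choose u hu huε using hex
  obtain ⟨x, hx, φ, hφ, hlim⟩ := exists_subseq_curves hf hu
  have hτφ := hτ.comp hφ.tendsto_atTop
  obtain ⟨r₁, r₂, hr₁, hr₂⟩ := exists_rat_window q₁ q₂ τ₀
  have hr : (r₁ : ℝ) ≤ r₂ := by linarith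
  have hA := hh.tendsto r₁ r₂ j (fun n => shiftCurve hq (τ (φ n)) (u (φ n)))
    (shiftCurve hq τ₀ x) (fun n => shiftCurve_mem_curves hf hq hr _ (hu _))
    (shiftCurve_mem_curves hf hq hr _ hx) (tendstoUniformlyOn_shiftCurve hq hx.1 hlim hτφ _)
  have hB := (tendsto_eLpNorm_translate_sub hp₁ hp (a := q₁) (b := q₂) (τ₀ := τ₀)
    (hh.toIsC.memLp_comp (a := r₁) (b := r₂) (continuous_shiftCurve hq τ₀ hx.1).continuousOn)
    (by linarith) (by linarith)).comp hτφ
  have hC := (hh.translate hf τ₀).tendsto q₁ q₂ j _ x (fun n => hu (φ n)) hx hlim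
  -- the error splits into a change of curve at time `τ`, a translation of a fixed function of
  -- `L^p`, and a change of curve at time `τ₀`
  have hsum := (hA.add hB).add hC
  simp only [add_zero] at hsum
  obtain ⟨n, hn, hnτ⟩ := ((hsum.eventually (gt_mem_nhds hε')).and
    (Metric.tendsto_nhds.1 hτφ 1 one_pos)).exists
  refine absurd (huε (φ n)) (not_lt.2 (le_trans ?_ hn.le))
  simp only [Function.comp_apply, Real.dist_eq, abs_lt] at hnτ ⊢
  set σ := τ (φ n)
  set v := u (φ n)
  have hv : v ∈ curves N (thetaOf (orbit f)) q₁ q₂ j := hu (φ n)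
  have hm : ∀ {z : ℝ → Vec N} (s : ℝ), ContinuousOn z (Icc (q₁ : ℝ) q₂) →
      AEStronglyMeasurable (fun t => h (t + s) (z t)) (volume.restrict (Icc (q₁ : ℝ) q₂)) :=
    fun s hz => aestronglyMeasurable_comp (measurable_translate hh.measurable s)
      measurableSet_Icc hz
  have hys : ContinuousOn (fun t => shiftCurve hq τ₀ x (t + σ)) (Icc (q₁ : ℝ) q₂) :=
    ((continuous_shiftCurve hq τ₀ hx.1).comp (by fun_prop)).continuousOn
  have h1 : eLpNorm (fun t => h (t + σ) (v t) - h (t + σ) (shiftCurve hq τ₀ x (t + σ))) p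
      (volume.restrict (Icc (q₁ : ℝ) q₂)) ≤ eLpNorm (fun t => h t (shiftCurve hq σ v t) -
        h t (shiftCurve hq τ₀ x t)) p (volume.restrict (Icc (r₁ : ℝ) r₂)) := by
    refine le_trans (le_of_eq ?_) (eLpNorm_mono_measure _ (Measure.restrict_mono_set _
      (Icc_subset_Icc (by linarith : (r₁ : ℝ) ≤ q₁ + σ) (by linarith : (q₂ : ℝ) + σ ≤ r₂))))
    rw [← eLpNorm_translate]
    refine eLpNorm_congr_ae ?_
    filter_upwards [ae_restrict_mem measurableSet_Icc] with t ht
    rw [shiftCurve_add hq σ _ ht]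
  have h2 : eLpNorm (fun t => h (t + τ₀) (x t) - h (t + τ₀) (v t)) p
      (volume.restrict (Icc (q₁ : ℝ) q₂)) = eLpNorm (fun t => translate τ₀ h t (v t) -
        translate τ₀ h t (x t)) p (volume.restrict (Icc (q₁ : ℝ) q₂)) :=
    eLpNorm_sub_comm _ _ _ _
  have h3 : eLpNorm (fun t => translate σ h t (v t) - translate τ₀ h t (v t)) p
      (volume.restrict (Icc (q₁ : ℝ) q₂)) = eLpNorm
        (((fun t => h (t + σ) (v t) - h (t + σ) (shiftCurve hq τ₀ x (t + σ))) +
          fun t => h (t + σ) (shiftCurve hq τ₀ x (t + σ)) -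
            h (t + τ₀) (shiftCurve hq τ₀ x (t + τ₀))) +
          fun t => h (t + τ₀) (x t) - h (t + τ₀) (v t)) p
        (volume.restrict (Icc (q₁ : ℝ) q₂)) := by
    refine eLpNorm_congr_ae ?_
    filter_upwards [ae_restrict_mem measurableSet_Icc] with t ht
    simp only [Pi.add_apply, shiftCurve_add hq τ₀ _ ht, translate]
    abel
  have hys₀ : ContinuousOn (fun t => shiftCurve hq τ₀ x (t + τ₀)) (Icc (q₁ : ℝ) q₂) :=
    ((continuous_shiftCurve hq τ₀ hx.1).comp (by fun_prop)).continuousOn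
  have m1 := (hm σ hv.1).sub (hm σ hys)
  have m2 := (hm σ hys).sub (hm τ₀ hys₀)
  have m3 := (hm τ₀ hx.1).sub (hm τ₀ hv.1)
  rw [h3]
  refine (eLpNorm_add_le (m1.add m2) m3 hp₁).trans (add_le_add ((eLpNorm_add_le m1 m2 hp₁).trans
    (add_le_add h1 le_rfl)) h2.le)

/-- Joint continuity of `(τ, h) ↦ h_τ` for `𝒯_Θ`, within `Θℭ`. -/
theorem tendsto_translate (hp₁ : 1 ≤ p) (hp : p ≠ ∞) (hf : EquicontinuousMBounds (orbit f))
    {α : Type*} {l : Filter α} {τ : α → ℝ} {τ₀ : ℝ} (hτ : Tendsto τ l (𝓝 τ₀))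
    {u : α → FunSpace (thetaOf (orbit f)) p N F} {h : ℝ → Vec N → F}
    (hum : ∀ᶠ a in l, Measurable (Function.uncurry (u a)))
    (hh : IsThetaC (thetaOf (orbit f)) p h)
    (hu : Tendsto u l (𝓝 (h : FunSpace (thetaOf (orbit f)) p N F))) :
    Tendsto (β := FunSpace (thetaOf (orbit f)) p N F) (fun a => translate (τ a) (u a)) l
      (𝓝 (translate τ₀ h)) := by
  refine tendsto_funSpace hp₁ (hum.mono fun a ha => measurable_translate ha _)
    (hh.translate hf τ₀) fun q₁ q₂ j ε hε => ?_
  have hε2 : 0 < ε / 2 := ENNReal.half_pos hε.ne'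
  obtain ⟨r₁, r₂, hr₁, hr₂⟩ := exists_rat_window q₁ q₂ τ₀
  filter_upwards [hum, hu (eventually_thetaSeminorm_lt hh r₁ r₂ j hε2),
    hτ (eventually_thetaSeminorm_translate_sub_lt hp₁ hp hf hh τ₀ q₁ q₂ j hε2),
    Metric.tendsto_nhds.1 hτ 1 one_pos] with a ha h1 h2 h3
  rw [Real.dist_eq, abs_lt] at h3
  have h4 := (thetaSeminorm_translate_le (p := p) hf (q₁ := q₁) (q₂ := q₂) j (τ := τ a)
    (by linarith) (by linarith) (fun t x => u a t x - h t x)).trans_lt h1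
  refine (thetaSeminorm_sub_le hp₁ (measurable_translate ha _)
    (measurable_translate hh.measurable (τ a)) (measurable_translate hh.measurable _)
    q₁ q₂ j).trans_lt ?_
  rw [← ENNReal.add_halves ε]
  exact ENNReal.add_lt_add h4 h2

end Continuity

/-! ### The flow on the hull -/

section Hull

variable {p : ℝ≥0∞} {f : ℝ → Vec N → Vec N}

theorem isLC_of_mem_orbit (hf : IsLC p f) : ∀ h ∈ orbit f, IsLC p h := by
  rintro _ ⟨τ, rfl⟩
  exact hf.translate τ

theorem tendsto_baseMap (hp₁ : 1 ≤ p) (hp : p ≠ ∞) (hE : EquicontinuousMBounds (orbit f))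
    {α : Type*} {l : Filter α} {τ : α → ℝ} {τ₀ : ℝ} (hτ : Tendsto τ l (𝓝 τ₀))
    {u : α → FunSpace (thetaOf (orbit f)) p N (Vec N) × FunSpace (thetaOf (orbit f)) p N (Mat N)}
    {P : FunSpace (thetaOf (orbit f)) p N (Vec N) × FunSpace (thetaOf (orbit f)) p N (Mat N)}
    (hum₁ : ∀ᶠ a in l, Measurable (Function.uncurry (u a).1))
    (hum₂ : ∀ᶠ a in l, Measurable (Function.uncurry (u a).2))
    (hP₁ : IsLC p P.1) (hP₂ : IsThetaC (thetaOf (orbit f)) p P.2) (hu : Tendsto u l (𝓝 P)) :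
    Tendsto (β := FunSpace (thetaOf (orbit f)) p N (Vec N) ×
        FunSpace (thetaOf (orbit f)) p N (Mat N))
      (fun a => (translate (τ a) (u a).1, translate (τ a) (u a).2)) l
      (𝓝 (translate τ₀ P.1, translate τ₀ P.2)) :=
  (tendsto_translate hp₁ hp hE hτ hum₁ (IsLC.isThetaC hP₁)
    ((continuous_fst.tendsto P).comp hu)).prodMk_nhds
  (tendsto_translate hp₁ hp hE hτ hum₂ hP₂ ((continuous_snd.tendsto P).comp hu))

theorem baseMap_mem (hp₁ : 1 ≤ p) (hp : p ≠ ∞) (hf : IsLC p f)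
    (hE : EquicontinuousMBounds (orbit f)) (q : ℝ × linHull p f) :
    baseMap p f q ∈ linHull p f := by
  obtain ⟨τ, ⟨P, ⟨hP₁, hP₂⟩, hcl⟩⟩ := q
  refine ⟨⟨IsLC.translate hP₁ τ, IsThetaC.translate hE hP₂ τ⟩, ?_⟩
  let S : Set (FunSpace (thetaOf (orbit f)) p N (Vec N) ×
    FunSpace (thetaOf (orbit f)) p N (Mat N)) :=
    {P | P.1 ∈ orbit f ∧ IsSC p P.2 ∧ IsJacobian P.1 P.2}
  have h1 := tendsto_baseMap hp₁ hp hE (l := 𝓝[S] P) (tendsto_const_nhds (x := τ))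
    (u := id) (P := P)
    (eventually_mem_nhdsWithin.mono fun Q hQ => (isLC_of_mem_orbit hf _ hQ.1).measurable)
    (eventually_mem_nhdsWithin.mono fun Q hQ => hQ.2.1.measurable) hP₁ hP₂
    nhdsWithin_le_nhds
  have : (𝓝[S] P).NeBot := mem_closure_iff_nhdsWithin_neBot.1 hcl
  refine mem_closure_of_tendsto h1 (eventually_mem_nhdsWithin.mono fun Q hQ => ?_)
  obtain ⟨⟨σ, hσ⟩, hSC, hJ⟩ := hQ
  refine ⟨⟨σ + τ, ?_⟩, hSC.translate τ, hJ.translate τ⟩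
  exact (translate_translate f σ τ).symm.trans (congrArg (translate τ) hσ)

theorem continuous_baseMap (hp₁ : 1 ≤ p) (hp : p ≠ ∞) (hE : EquicontinuousMBounds (orbit f)) :
    Continuous (baseMap p f) :=
  continuous_iff_continuousAt.2 fun q =>
    tendsto_baseMap hp₁ hp hE (continuous_fst.tendsto q) (u := fun q => q.2.1) (P := q.2.1)
      (Eventually.of_forall fun a => (a.2.2.1.1 : IsLC p a.2.1.1).measurable)
      (Eventually.of_forall fun a =>
        (a.2.2.1.2 : IsThetaC (thetaOf (orbit f)) p a.2.1.2).measurable)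
      q.2.2.1.1 q.2.2.1.2 ((continuous_subtype_val.comp continuous_snd).tendsto q)

/-- Quantitative joint continuity of both solutions, at a fixed pair `(g₀, G₀)` and fixed initial
values, uniformly on a compact interval. -/
theorem exists_sol_near (hp₁ : 1 ≤ p) {E : Set (ℝ → Vec N → Vec N)} (hLC : ∀ h ∈ E, IsLC p h)
    (hE : EquicontinuousMBounds E) {g₀ : ℝ → Vec N → Vec N} {G₀ : ℝ → Vec N → Mat N}
    (hP : (g₀, G₀) ∈ linClosure p E) {x₀ : Vec N} (y₀ : Vec N) {q₁ q₂ : ℚ}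
    (h0 : (0 : ℝ) ∈ Icc (q₁ : ℝ) q₂) (hsub : Icc (q₁ : ℝ) q₂ ⊆ maxInterval g₀ x₀) {η : ℝ}
    (hη : 0 < η) :
    ∃ (j : ℕ) (ρ ω ρ' : ℝ), 0 < ρ ∧ 0 < ω ∧ 0 < ρ' ∧
      ∀ (g : ℝ → Vec N → Vec N) (G : ℝ → Vec N → Mat N) (x₁ y₁ : Vec N),
      (g, G) ∈ linClosure p E →
      thetaSeminorm (thetaOf E) p q₁ q₂ j (fun t x => g t x - g₀ t x) < ENNReal.ofReal ρ →
      thetaSeminorm (thetaOf E) p q₁ q₂ j (fun t x => G t x - G₀ t x) < ENNReal.ofReal ω →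
      dist x₁ x₀ < ρ → dist y₁ y₀ < ρ' →
      Icc (q₁ : ℝ) q₂ ⊆ maxInterval g x₁ ∧ ∀ t ∈ Icc (q₁ : ℝ) q₂,
        ‖sol g x₁ t - sol g₀ x₀ t‖ ≤ η ∧ ‖linSol g G x₁ y₁ t - linSol g₀ G₀ x₀ y₀ t‖ ≤ η := by
  have hg₀ : IsLC p g₀ := hP.1.1
  have hG₀ : IsThetaC (thetaOf E) p G₀ := hP.1.2
  obtain ⟨j, C, δ, hC, hδ, hdep⟩ :=
    exists_continuousDependence hp₁ (thetaOf_nonneg E) hg₀ h0 hsub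
  have hA₀ := integrableOn_comp_sol hp₁ hg₀ hG₀.toIsC x₀ hsub
  have hy := (isUniqueSolOn_linSol hp₁ hg₀ hG₀.toIsC x₀ y₀).1.mono hsub
  obtain ⟨D, δ', hD, hδ', hlin⟩ := exists_linear_stability h0 hA₀ hy
  have hxc : sol g₀ x₀ ∈ curves N (thetaOf E) q₁ q₂ j :=
    (hdep g₀ x₀ 0 hg₀ (mBounded_of_mem_linClosure hp₁ hE hLC hP) le_rfl hδ (by simp only [thetaSeminorm_sub_self, zero_le])
      (by simp)).2.1
  set H := holderConst p q₁ q₂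
  have hH : 0 ≤ H := holderConst_nonneg p q₁ q₂
  -- `ρ'` is the admissible error for the linear problem
  obtain ⟨ρ', hρ'0, hρ'δ, hρ'η⟩ : ∃ ρ' : ℝ, 0 < ρ' ∧ ρ' < δ' ∧ D * ρ' ≤ η := by
    refine ⟨min (δ' / 2) (η / (D + 1)), by positivity,
      (min_le_left _ _).trans_lt (half_lt_self hδ'), ?_⟩
    refine (mul_le_mul_of_nonneg_left (min_le_right _ _) hD).trans ?_
    rw [mul_div_assoc', div_le_iff₀ (by positivity)]
    nlinarith
  obtain ⟨ω, hω, hωρ⟩ : ∃ ω : ℝ, 0 < ω ∧ H * (ω + ω) ≤ ρ' := by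
    refine ⟨ρ' / (2 * H + 1), by positivity, ?_⟩
    rw [← two_mul, ← mul_assoc, mul_div_assoc', div_le_iff₀ (by positivity)]
    nlinarith
  obtain ⟨κ, hκ, hosc⟩ := hG₀.exists_delta hxc (ENNReal.ofReal_pos.2 hω)
  -- `ρ` is the admissible error for the nonlinear problem
  obtain ⟨ρ, hρ0, hρδ, hρη, hρκ⟩ : ∃ ρ : ℝ, 0 < ρ ∧ ρ < δ ∧ C * ρ ≤ η ∧ C * ρ ≤ κ := by
    have h1 : 0 < min η κ := lt_min hη hκ
    have h2 : C * min (δ / 2) (min η κ / (C + 1)) ≤ min η κ := by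
      refine (mul_le_mul_of_nonneg_left (min_le_right _ _) hC).trans ?_
      rw [mul_div_assoc', div_le_iff₀ (by positivity)]
      nlinarith
    exact ⟨min (δ / 2) (min η κ / (C + 1)), by positivity,
      (min_le_left _ _).trans_lt (half_lt_self hδ), h2.trans (min_le_left _ _),
      h2.trans (min_le_right _ _)⟩
  refine ⟨j, ρ, ω, ρ', hρ0, hω, hρ'0, fun g G x₁ y₁ hQ h1 h2 h3 h4 => ?_⟩
  have hg : IsLC p g := hQ.1.1
  have hG : IsThetaC (thetaOf E) p G := hQ.1.2
  rw [dist_eq_norm] at h3 h4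
  obtain ⟨hsub', hx'c, hclose⟩ := hdep g x₁ ρ hg
    (mBounded_of_mem_linClosure hp₁ hE hLC hQ) hρ0.le hρδ h1.le h3.le
  refine ⟨hsub', fun t ht => ⟨(hclose t ht).trans hρη, ?_⟩⟩
  have hA := integrableOn_comp_sol hp₁ hg hG.toIsC x₁ hsub'
  have hz := (isUniqueSolOn_linSol hp₁ hg hG.toIsC x₁ y₁).1.mono hsub'
  refine (hlin _ y₁ _ ρ' hA hz hρ'0.le hρ'δ ?_ h4.le t ht).trans hρ'η
  refine (integral_norm_le_of_lintegral (by positivity) (hA.sub hA₀).1 ?_).trans hωρ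
  refine (lintegral_enorm_le_holderConst hp₁ (hA.sub hA₀).1).trans ?_
  rw [ENNReal.ofReal_mul hH, ENNReal.ofReal_add hω.le hω.le]
  gcongr
  have hm₁ := aestronglyMeasurable_comp hG.measurable measurableSet_Icc hx'c.1
  have hm₂ := aestronglyMeasurable_comp hG₀.measurable measurableSet_Icc hx'c.1
  have hm₃ := aestronglyMeasurable_comp hG₀.measurable measurableSet_Icc hxc.1
  have hsplit : (fun t => G t (sol g x₁ t)) - (fun t => G₀ t (sol g₀ x₀ t)) =
      (fun t => G t (sol g x₁ t) - G₀ t (sol g x₁ t)) +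
        fun t => G₀ t (sol g x₁ t) - G₀ t (sol g₀ x₀ t) := by
    ext1 t; simp
  rw [hsplit]
  exact (eLpNorm_add_le (hm₁.sub hm₂) (hm₂.sub hm₃) hp₁).trans (add_le_add
    ((eLpNorm_le_thetaSeminorm (fun t x => G t x - G₀ t x) hx'c).trans h2.le)
    (hosc _ hx'c fun s hs => (hclose s hs).trans hρκ).le)

theorem eventually_sol_near (hp₁ : 1 ≤ p) (hf : IsLC p f) (hE : EquicontinuousMBounds (orbit f))
    (P : linHull p f) (x₀ y₀ : Vec N) {q₁ q₂ : ℚ} (h0 : (0 : ℝ) ∈ Icc (q₁ : ℝ) q₂)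
    (hsub : Icc (q₁ : ℝ) q₂ ⊆ maxInterval P.1.1 x₀) {η : ℝ} (hη : 0 < η) :
    ∀ᶠ q : linHull p f × Vec N × Vec N in 𝓝 (P, x₀, y₀),
      Icc (q₁ : ℝ) q₂ ⊆ maxInterval q.1.1.1 q.2.1 ∧ ∀ t ∈ Icc (q₁ : ℝ) q₂,
        ‖sol q.1.1.1 q.2.1 t - sol P.1.1 x₀ t‖ ≤ η ∧
        ‖linSol q.1.1.1 q.1.1.2 q.2.1 q.2.2 t - linSol P.1.1 P.1.2 x₀ y₀ t‖ ≤ η := by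
  obtain ⟨⟨g₀, G₀⟩, hP⟩ := P
  have hg₀ : IsLC p g₀ := hP.1.1
  have hG₀ : IsThetaC (thetaOf (orbit f)) p G₀ := hP.1.2
  obtain ⟨j, ρ, ω, ρ', hρ, hω, hρ', h⟩ :=
    exists_sol_near hp₁ (isLC_of_mem_orbit hf) hE hP y₀ h0 hsub hη
  have hc₁ : Tendsto (fun q : linHull p f × Vec N × Vec N => q.1.1.1)
      (𝓝 (⟨(g₀, G₀), hP⟩, x₀, y₀)) (𝓝 (g₀ : FunSpace (thetaOf (orbit f)) p N (Vec N))) :=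
    (continuous_fst.comp (continuous_subtype_val.comp continuous_fst)).tendsto _
  have hc₂ : Tendsto (fun q : linHull p f × Vec N × Vec N => q.1.1.2)
      (𝓝 (⟨(g₀, G₀), hP⟩, x₀, y₀)) (𝓝 (G₀ : FunSpace (thetaOf (orbit f)) p N (Mat N))) :=
    (continuous_snd.comp (continuous_subtype_val.comp continuous_fst)).tendsto _
  have hc₃ : Tendsto (fun q : linHull p f × Vec N × Vec N => q.2.1)
      (𝓝 (⟨(g₀, G₀), hP⟩, x₀, y₀)) (𝓝 x₀) := (continuous_fst.comp continuous_snd).tendsto _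
  have hc₄ : Tendsto (fun q : linHull p f × Vec N × Vec N => q.2.2)
      (𝓝 (⟨(g₀, G₀), hP⟩, x₀, y₀)) (𝓝 y₀) := (continuous_snd.comp continuous_snd).tendsto _
  filter_upwards [hc₁ (eventually_thetaSeminorm_lt (IsLC.isThetaC hg₀) q₁ q₂ j
      (ENNReal.ofReal_pos.2 hρ)),
    hc₂ (eventually_thetaSeminorm_lt hG₀ q₁ q₂ j (ENNReal.ofReal_pos.2 hω)),
    Metric.tendsto_nhds.1 hc₃ ρ hρ, Metric.tendsto_nhds.1 hc₄ ρ' hρ'] with q h1 h2 h3 h4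
  exact h q.1.1.1 q.1.1.2 q.2.1 q.2.2 q.1.2 h1 h2 h3 h4

/-- Around a point of the domain, a compact interval of existence whose interior contains the
time. -/
theorem exists_rat_Icc_of_mem_flowDomain (hp₁ : 1 ≤ p) {P : linHull p f} {x₀ : Vec N} {t₀ : ℝ}
    (h : t₀ ∈ maxInterval P.1.1 x₀) : ∃ q₁ q₂ : ℚ, (0 : ℝ) ∈ Icc (q₁ : ℝ) q₂ ∧
      Icc (q₁ : ℝ) q₂ ∈ 𝓝 t₀ ∧ Icc (q₁ : ℝ) q₂ ⊆ maxInterval P.1.1 x₀ := by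
  have hg : IsLC p P.1.1 := P.2.1.1
  obtain ⟨q₁, q₂, h1, h2, h3, h4, h5⟩ := exists_rat_Icc_subset (hg.isOpen_maxInterval hp₁ x₀)
    (ordConnected_maxInterval _ _) (zero_mem_maxInterval _ _) h h
  exact ⟨q₁, q₂, ⟨h1.le, h2.le⟩, Icc_mem_nhds h3 h4, h5⟩

theorem isOpen_flowDomain (hp₁ : 1 ≤ p) (hf : IsLC p f)
    (hE : EquicontinuousMBounds (orbit f)) : IsOpen (flowDomain p f) := by
  refine isOpen_iff_mem_nhds.2 ?_
  rintro ⟨t₀, P, x₀, y₀⟩ h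
  obtain ⟨q₁, q₂, h0, htn, hsub⟩ := exists_rat_Icc_of_mem_flowDomain hp₁ h
  have h1 := (continuous_snd.tendsto (t₀, P, x₀, y₀))
    (eventually_sol_near hp₁ hf hE P x₀ y₀ h0 hsub one_pos)
  have h2 := (continuous_fst.tendsto (t₀, P, x₀, y₀)) htn
  filter_upwards [h1, h2] with q hq hqt
  exact hq.1 hqt

/-- A uniform approximation by a continuous function, evaluated at a nearby time. -/
theorem tendsto_of_eventually_near {X : Type*} [TopologicalSpace X] {E : Type*}
    [NormedAddCommGroup E] {u : X → ℝ → E} {u₀ : ℝ → E} {t₀ : ℝ} {z : X} {I : Set ℝ}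
    (hI : I ∈ 𝓝 t₀) (hu₀ : ContinuousAt u₀ t₀)
    (h : ∀ η > 0, ∀ᶠ q in 𝓝 z, ∀ t ∈ I, ‖u q t - u₀ t‖ ≤ η) :
    Tendsto (fun q : ℝ × X => u q.2 q.1) (𝓝 (t₀, z)) (𝓝 (u₀ t₀)) := by
  refine Metric.tendsto_nhds.2 fun ε hε => ?_
  have h1 := continuous_snd.tendsto (t₀, z) (h (ε / 2) (half_pos hε))
  have h2 := continuous_fst.tendsto (t₀, z) hI
  have h3 := continuous_fst.tendsto (t₀, z) (Metric.tendsto_nhds.1 hu₀ (ε / 2) (half_pos hε))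
  filter_upwards [h1, h2, h3] with q hq1 hq2 hq3
  have h4 := hq1 q.1 hq2
  rw [← dist_eq_norm] at h4
  exact (dist_triangle _ _ _).trans_lt ((add_lt_add_of_le_of_lt h4 hq3).trans_eq (add_halves ε))

theorem continuousOn_flowMap (hp₁ : 1 ≤ p) (hp : p ≠ ∞) (hf : IsLC p f)
    (hE : EquicontinuousMBounds (orbit f)) : ContinuousOn (flowMap p f) (flowDomain p f) := by
  rintro ⟨t₀, P, x₀, y₀⟩ h
  refine ContinuousAt.continuousWithinAt ?_
  obtain ⟨q₁, q₂, h0, htn, hsub⟩ := exists_rat_Icc_of_mem_flowDomain hp₁ h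
  have hg : IsLC p P.1.1 := P.2.1.1
  have hG : IsThetaC (thetaOf (orbit f)) p P.1.2 := P.2.1.2
  have hMn : maxInterval P.1.1 x₀ ∈ 𝓝 t₀ := mem_of_superset htn hsub
  have hbase : ContinuousAt (fun q : ℝ × linHull p f × Vec N × Vec N =>
      baseMap p f (q.1, q.2.1)) (t₀, P, x₀, y₀) :=
    ((continuous_baseMap hp₁ hp hE).comp (by fun_prop)).continuousAt
  refine hbase.prodMk (ContinuousAt.prodMk ?_ ?_)
  · exact tendsto_of_eventually_near (u := fun q : linHull p f × Vec N × Vec N =>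
      sol q.1.1.1 q.2.1) htn ((hg.isSolOn_sol hp₁ x₀).1.continuousAt hMn) fun η hη =>
      (eventually_sol_near hp₁ hf hE P x₀ y₀ h0 hsub hη).mono fun q hq t ht => (hq.2 t ht).1
  · exact tendsto_of_eventually_near (u := fun q : linHull p f × Vec N × Vec N =>
      linSol q.1.1.1 q.1.1.2 q.2.1 q.2.2) htn
      ((isUniqueSolOn_linSol hp₁ hg hG.toIsC x₀ y₀).1.1.continuousAt hMn) fun η hη =>
      (eventually_sol_near hp₁ hf hE P x₀ y₀ h0 hsub hη).mono fun q hq t ht => (hq.2 t ht).2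

theorem isLinearizedSkewProductFlow (hp₁ : 1 ≤ p) (hp : p ≠ ∞) (hf : IsLC p f)
    (hE : EquicontinuousMBounds (orbit f)) : IsLinearizedSkewProductFlow p f where
  base_mem := baseMap_mem hp₁ hp hf hE
  base_continuous := continuous_baseMap hp₁ hp hE
  isOpen_domain := isOpen_flowDomain hp₁ hf hE
  continuousOn := continuousOn_flowMap hp₁ hp hf hE
  zero_mem _ _ _ := zero_mem_maxInterval _ _
  map_zero P x₀ y₀ := by
    refine Prod.ext (Prod.ext (translate_zero _) (translate_zero _)) (Prod.ext (sol_zero _ _) ?_)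
    exact sol_zero _ _
  mem_iff := by
    rintro P ⟨Q, hQ⟩ x₀ y₀ x₁ y₁ s t hs heq
    obtain ⟨rfl, rfl, rfl⟩ : baseMap p f (s, P) = Q ∧ sol P.1.1 x₀ s = x₁ ∧
      linSol P.1.1 P.1.2 x₀ y₀ s = y₁ := by simpa [flowMap] using heq
    have hg : IsLC p P.1.1 := P.2.1.1
    have h1 := mem_maxInterval_translate_iff hp₁ hg (t := t) hs
    rw [add_comm t s] at h1
    exact h1
  map_add := by
    rintro P ⟨Q, hQ⟩ x₀ y₀ x₁ y₁ s t hs heq hst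
    obtain ⟨rfl, rfl, rfl⟩ : baseMap p f (s, P) = Q ∧ sol P.1.1 x₀ s = x₁ ∧
      linSol P.1.1 P.1.2 x₀ y₀ s = y₁ := by simpa [flowMap] using heq
    have hg : IsLC p P.1.1 := P.2.1.1
    have hG : IsThetaC (thetaOf (orbit f)) p P.1.2 := P.2.1.2
    have hst' : t + s ∈ maxInterval P.1.1 x₀ := by rw [add_comm]; exact hst
    refine Prod.ext (Prod.ext (translate_translate _ s t).symm (translate_translate _ s t).symm)
      (Prod.ext ?_ ?_)
    · have h1 := (sol_translate hp₁ hg hs hst').2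
      rw [add_comm t s] at h1
      exact h1.symm
    · have h1 := linSol_translate hp₁ hg hG.toIsC hs hst' y₀
      rw [add_comm t s] at h1
      exact h1.symm

end Hull

end Caratheodory

open Caratheodory
theorem mainTheorem3 (N : ℕ) (p : ℝ≥0∞) (hp₁ : 1 ≤ p) (hp : p ≠ ∞) :
    (∀ E₁ : Set (ℝ → Vec N → Vec N),
      (∀ f ∈ E₁, IsLC p f) → EquicontinuousMBounds E₁ → (∀ f ∈ E₁, HasSCJacobian p f) →
      ∀ (g : ℝ → Vec N → Vec N) (G : ℝ → Vec N → Mat N), (g, G) ∈ linClosure p E₁ →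
      ∀ x₀ : Vec N,
        -- the maximal solution of the first problem and the solution of the second one exist
        (IsOpen (maxInterval g x₀) ∧ (maxInterval g x₀).OrdConnected ∧ 0 ∈ maxInterval g x₀ ∧
          IsUniqueSolOn g x₀ (maxInterval g x₀) (sol g x₀) ∧
          ∀ y₀ : Vec N,
            IsUniqueSolOn (linField g G x₀) y₀ (maxInterval g x₀) (linSol g G x₀ y₀)) ∧
        ∀ T₀ T₁ : ℝ, Icc T₀ T₁ ⊆ maxInterval g x₀ →
          (∀ᶠ ε : ℝ in 𝓝[>] 0, ∀ y₀ ∈ Metric.closedBall (0 : Vec N) 1,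
            Icc T₀ T₁ ⊆ maxInterval g (x₀ + ε • y₀)) ∧
          TendstoUniformlyOn
            (fun (ε : ℝ) (q : ℝ × Vec N) => ε⁻¹ • (sol g (x₀ + ε • q.2) q.1 - sol g x₀ q.1))
            (fun q : ℝ × Vec N => linSol g G x₀ q.2 q.1)
            (𝓝[>] 0) (Icc T₀ T₁ ×ˢ Metric.closedBall (0 : Vec N) 1)) ∧
    (∀ f : ℝ → Vec N → Vec N,
      IsLC p f → EquicontinuousMBounds (orbit f) → HasSCJacobian p f →
      IsLinearizedSkewProductFlow p f) := by
  refine ⟨fun E₁ hLC hE _ g G h x₀ => ?_,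
    fun f hf hE _ => isLinearizedSkewProductFlow hp₁ hp hf hE⟩
  have hg : IsLC p g := h.1.1
  have hG : IsThetaC (thetaOf E₁) p G := h.1.2
  have hopen := hg.isOpen_maxInterval hp₁ x₀
  have hord := ordConnected_maxInterval g x₀
  have h0 := zero_mem_maxInterval g x₀
  refine ⟨⟨hopen, hord, h0, ((hg.locLip hp₁).mono (subset_univ _)).isUniqueSolOn_sol hopen hord h0
    Subset.rfl, isUniqueSolOn_linSol hp₁ hg hG.toIsC x₀⟩, fun T₀ T₁ hT => ?_⟩
  obtain ⟨q₁, q₂, h1, h2, hTq, hsub⟩ : ∃ q₁ q₂ : ℚ, (q₁ : ℝ) < 0 ∧ (0 : ℝ) < q₂ ∧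
      Icc T₀ T₁ ⊆ Icc (q₁ : ℝ) q₂ ∧ Icc (q₁ : ℝ) q₂ ⊆ maxInterval g x₀ := by
    rcases le_or_gt T₀ T₁ with hTT | hTT
    · obtain ⟨q₁, q₂, h1, h2, h3, h4, h5⟩ := exists_rat_Icc_subset hopen hord h0
        (hT (left_mem_Icc.2 hTT)) (hT (right_mem_Icc.2 hTT))
      exact ⟨q₁, q₂, h1, h2, Icc_subset_Icc h3.le h4.le, h5⟩
    · obtain ⟨q₁, q₂, h1, h2, -, -, h5⟩ := exists_rat_Icc_subset hopen hord h0 h0 h0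
      exact ⟨q₁, q₂, h1, h2, by simp [Icc_eq_empty hTT.not_ge], h5⟩
  obtain ⟨hA, hB⟩ := tendstoUniformlyOn_differenceQuotient hp₁ hLC hE h x₀ ⟨h1.le, h2.le⟩ hsub
  exact ⟨hA.mono fun ε hε y₀ hy₀ => hTq.trans (hε y₀ hy₀), hB.mono (prod_mono_left hTq)⟩
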